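/- An \emph{ECP instance} is a triple $(G,F,r)$ where $G=(V,E,\Gamma)$ is a finite directed multigraph without self-loops, with edge set $E\subseteq V\times V$ and multiplicities $\Gamma\colon E\to\{1,2,\dots\}$; $F\subseteq E$ is a set of \emph{priority edges} such that every node has at most one outgoing edge in $F$ and $\Gamma(e)=1$ for all $e\in F$; and $r\in V$. An \emph{$r$-ECP} is a sequence $p$ of edges forming a closed path from $r$ to $r$ that contains each $e\in E$ exactly $\Gamma(e)$ times (parallel copies of an edge are not distinguished) and that \emph{respects} $F$: for every $(u,v)\in F$, no edge with tail $u$ occurs in $p$ before $(u,v)$. Theorem. All $r$-ECPs can be enumerated in linear time per solution. Precisely, on a unit-cost word RAM with addition and truncated subtraction there are one program and a constant $C$ such that, for every ECP instance with $V=\{0,\dots,n-1\}$, given as $n$, $r$, $|E|$ and the list of the edges in any order with their multiplicities and priority flags, the program, using words with values below $(n+M+2)^C$ where $M=\sum_{e\in E}\Gamma(e)$ is the length of an Eulerian cycle, outputs each $r$-ECP exactly once, outputs nothing else, and halts after at most $$C\,(n+|E|)+C\,k\,(n+M)$$ steps, where $k$ is the number of $r$-ECPs. -/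

import Mathlib

/-! ## Directed multigraphs, Eulerian cycles, priority edges -/

/-- A directed multigraph without self-loops on the node type `V`: a finite edge set
`edges ⊆ V × V` and a positive multiplicity for every edge (values of `mult` off `edges`
are irrelevant). An edge `(u, v)` has tail `u` and head `v`. -/
structure DiMultigraph (V : Type) where
  edges : Finset (V × V)
  mult : V × V → ℕ
  mult_pos : ∀ e ∈ edges, 0 < mult e
  loopless : ∀ v, (v, v) ∉ edges

namespace DiMultigraph

variable {V : Type}

/-- `G.IsPath u p v`: the sequence of edges `p` is a `u`-`v` path; nodes and edges may be
repeated, and the empty sequence is a `u`-`u` path. -/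
def IsPath (G : DiMultigraph V) : V → List (V × V) → V → Prop
  | u, [], v => u = v
  | u, e :: p, v => e ∈ G.edges ∧ e.1 = u ∧ G.IsPath e.2 p v

/-- `p` is an `r`-Eulerian cycle: an `r`-`r` path that contains every edge `e` exactly
`mult e` times. The copies of an edge are not distinguished. -/
def IsEulerianCycle [DecidableEq V] (G : DiMultigraph V) (r : V) (p : List (V × V)) : Prop :=
  G.IsPath r p r ∧ ∀ e ∈ G.edges, p.count e = G.mult e

/-- The total multiplicity of all edges, which is the length of every Eulerian cycle. -/
def totalMult (G : DiMultigraph V) : ℕ := ∑ e ∈ G.edges, G.mult e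

end DiMultigraph

/-- `p` respects `F`: for every `f ∈ F`, no edge with the same tail as `f` occurs in `p`
before an occurrence of `f`. -/
def RespectsPriority {V : Type} (F : Finset (V × V)) (p : List (V × V)) : Prop :=
  ∀ f ∈ F, ∀ p₁ p₂ : List (V × V), p = p₁ ++ f :: p₂ → ∀ e ∈ p₁, e.1 ≠ f.1

/-- An instance `(G, F, r)` of the problem of Eulerian cycles with priority edges, with node
set `{0, …, n - 1}`. -/
structure ECPInstance where
  n : ℕ
  G : DiMultigraph (Fin n)
  F : Finset (Fin n × Fin n)
  r : Fin n
  F_subset : F ⊆ G.edges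
  F_tail : ∀ e ∈ F, ∀ f ∈ F, e.1 = f.1 → e = f
  F_mult : ∀ e ∈ F, G.mult e = 1

namespace ECPInstance

/-- The `r`-Eulerian cycles of `G` that respect the priority edges. -/
def IsECP (I : ECPInstance) (p : List (Fin I.n × Fin I.n)) : Prop :=
  I.G.IsEulerianCycle I.r p ∧ RespectsPriority I.F p

/-- The presentation of an instance as a sequence of words, for a list `L` of its edges:
`n`, `r`, the number of edges, and then tail, head, multiplicity and priority flag of each
edge, in the order of `L`. -/
def encode (I : ECPInstance) (L : List (Fin I.n × Fin I.n)) : List ℕ :=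
  I.n :: (I.r : ℕ) :: L.length ::
    L.flatMap fun e => [(e.1 : ℕ), (e.2 : ℕ), I.G.mult e, if e ∈ I.F then 1 else 0]

end ECPInstance

/-- The presentation of a sequence of edges as a sequence of words: its length, followed by
tail and head of each of its edges. -/
def encodeEdges {n : ℕ} (p : List (Fin n × Fin n)) : List ℕ :=
  p.length :: p.flatMap fun e => [(e.1 : ℕ), (e.2 : ℕ)]

/-! ## A word RAM with step count -/

namespace RAM

/-- A configuration: scalar variables, arrays with random access, and the words written so
far to the write-only output. -/
structure State where
  reg : ℕ → ℕ
  mem : ℕ → ℕ → ℕ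
  out : List ℕ

/-- Assignment of the value `v` to the scalar variable `x`. -/
def State.setReg (s : State) (x v : ℕ) : State :=
  { s with reg := Function.update s.reg x v }

/-- Assignment of the value `v` to the entry `i` of the array `a`. -/
def State.setMem (s : State) (a i v : ℕ) : State :=
  { s with mem := Function.update s.mem a (Function.update (s.mem a) i v) }

/-- Appending the word `v` to the output. -/
def State.write (s : State) (v : ℕ) : State :=
  { s with out := s.out ++ [v] }

/-- Expressions: constants, scalar variables, array entries `a[i]`, addition, truncated
subtraction. -/
inductive Expr where
  | const (k : ℕ)
  | var (x : ℕ)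
  | get (a : ℕ) (i : Expr)
  | add (e₁ e₂ : Expr)
  | sub (e₁ e₂ : Expr)

/-- The value of an expression. -/
def Expr.eval (s : State) : Expr → ℕ
  | .const k => k
  | .var x => s.reg x
  | .get a i => s.mem a (i.eval s)
  | .add e₁ e₂ => e₁.eval s + e₂.eval s
  | .sub e₁ e₂ => e₁.eval s - e₂.eval s

/-- The time to evaluate an expression: one step for each of its nodes. -/
def Expr.cost : Expr → ℕ
  | .const _ => 1
  | .var _ => 1
  | .get _ i => i.cost + 1
  | .add e₁ e₂ => e₁.cost + e₂.cost + 1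
  | .sub e₁ e₂ => e₁.cost + e₂.cost + 1

/-- Programs: no operation, `x := e`, `a[i] := e`, output of `e`, composition, branching on
`e ≠ 0`, and repetition as long as `e ≠ 0`. The names of variables and arrays are literals in
the program, so a program has finitely many variables and arrays. -/
inductive Prog where
  | skip
  | set (x : ℕ) (e : Expr)
  | put (a : ℕ) (i e : Expr)
  | emit (e : Expr)
  | seq (P Q : Prog)
  | ite (e : Expr) (P Q : Prog)
  | loop (e : Expr) (P : Prog)

/-- `Exec W P s s' t`: on words with values below `W`, the program `P` started in `s` halts
in `s'` after `t` steps. There is no such execution if a value that is stored or output, or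
the index of an array entry that is stored, does not fit in a word. -/
inductive Exec (W : ℕ) : Prog → State → State → ℕ → Prop
  | skip (s : State) : Exec W .skip s s 1
  | set (s : State) (x : ℕ) (e : Expr) (he : e.eval s < W) :
      Exec W (.set x e) s (s.setReg x (e.eval s)) (e.cost + 1)
  | put (s : State) (a : ℕ) (i e : Expr) (hi : i.eval s < W) (he : e.eval s < W) :
      Exec W (.put a i e) s (s.setMem a (i.eval s) (e.eval s)) (i.cost + e.cost + 1)
  | emit (s : State) (e : Expr) (he : e.eval s < W) :
      Exec W (.emit e) s (s.write (e.eval s)) (e.cost + 1)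
  | seq {P Q : Prog} {s s' s'' : State} {t t' : ℕ} :
      Exec W P s s' t → Exec W Q s' s'' t' → Exec W (.seq P Q) s s'' (t + t')
  | ite_true {e : Expr} {P Q : Prog} {s s' : State} {t : ℕ} :
      e.eval s ≠ 0 → Exec W P s s' t → Exec W (.ite e P Q) s s' (e.cost + 1 + t)
  | ite_false {e : Expr} {P Q : Prog} {s s' : State} {t : ℕ} :
      e.eval s = 0 → Exec W Q s s' t → Exec W (.ite e P Q) s s' (e.cost + 1 + t)
  | loop_true {e : Expr} {P : Prog} {s s' s'' : State} {t t' : ℕ} :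
      e.eval s ≠ 0 → Exec W P s s' t → Exec W (.loop e P) s' s'' t' →
        Exec W (.loop e P) s s'' (e.cost + 1 + t + t')
  | loop_false {e : Expr} {P : Prog} {s : State} :
      e.eval s = 0 → Exec W (.loop e P) s s (e.cost + 1)

/-- The initial configuration: the input is in array `0`, everything else is `0`, and nothing
has been output. -/
def init (input : List ℕ) : State where
  reg := fun _ => 0
  mem := fun a i => if a = 0 then input.getD i 0 else 0
  out := []

end RAM

/-! ## A program logic for the word RAM -/

namespace RAM

/-! The combinatorial core is the correspondence behind the BEST theorem. An Eulerian cycle from the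
root is determined by the order in which it uses the exits of each node. In a balanced graph such a
family of orders, a schedule, comes from a cycle if the last exits of the nodes other than the root
form a spanning tree directed to the root (`Core.Good.exists_sol`), and every cycle arises in this
way (`Core.IsSol.arb`, `Core.IsSol.exists_good`). A priority edge fixes the first entry of the order
at its tail. Where it is the only exit of a node other than the root this demands nothing, and the
flag is dropped; at any other node except the root it cannot be the last exit, having multiplicity
one. So a solution is a tree that avoids the remaining flagged edges together with an arrangement of
the remaining exits, and every such tree has at least one arrangement. The enumeration has no dead
ends.

The arrangements for a fixed tree are multiset permutations, node by node. They are listed in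
lexicographic order of the whole schedule: filling in ascending order gives the least one, and the
successor changes the last position that can be increased and refills what follows
(`Core.Good.key_le_of_ascending`, `Core.Good.key_le_of_succ`). One step takes time linear in the
length of the cycle plus the number of nodes.

The trees form a hierarchy whose top is one tree `t0`, in whose numbering parents precede children
and subtrees are intervals. A tree that deviates from `t0` has as parent the tree in which the edge
of `t0` is restored at the smallest deviating node; this is a tree again because all smaller nodes
reach the root along `t0`. Conversely, a child is made by exchanging the edge at a node `v` below
the smallest deviation for one whose head does not lead back to `v` (`Core.IsChild.stage`,
`Core.IsSol.isChild`, `Core.mem_solsFrom_iff`). Whether it leads back is decided by comparing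
numbers, once the first node below the smallest deviation is known on every path
(`Core.Entry.onChain_iff`). The tree itself records the way back to its parent, so the traversal is
a single loop without a stack (`RAM.enumerate_spec`). Each tree is entered once and left once, at
linear cost, and yields a solution that pays for it.

The preparation checks balance and searches from the root against the direction of the usable edges,
which produces `t0` and its numbering. If balance fails or the tail of some edge is not reached,
there is no solution (`Inst.IsSol.not_infeasible`), and only `O(n + |E|)` steps have been spent.
Otherwise `t0` already yields a solution, so that everything else is charged to the output. -/

@[simp] theorem State.setReg_reg (s : State) (x v y : ℕ) :
    (s.setReg x v).reg y = if y = x then v else s.reg y := by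
  simp [State.setReg, Function.update_apply]

@[simp] theorem State.setReg_mem (s : State) (x v : ℕ) : (s.setReg x v).mem = s.mem := rfl

@[simp] theorem State.setReg_out (s : State) (x v : ℕ) : (s.setReg x v).out = s.out := rfl

@[simp] theorem State.setMem_reg (s : State) (a i v : ℕ) : (s.setMem a i v).reg = s.reg := rfl

@[simp] theorem State.setMem_mem (s : State) (a i v b : ℕ) :
    (s.setMem a i v).mem b = if b = a then Function.update (s.mem a) i v else s.mem b := by
  by_cases h : b = a
  · subst h; simp [State.setMem]
  · simp [State.setMem, h]

@[simp] theorem State.setMem_out (s : State) (a i v : ℕ) : (s.setMem a i v).out = s.out := rfl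

@[simp] theorem State.write_reg (s : State) (v : ℕ) : (s.write v).reg = s.reg := rfl

@[simp] theorem State.write_mem (s : State) (v : ℕ) : (s.write v).mem = s.mem := rfl

@[simp] theorem State.write_out (s : State) (v : ℕ) : (s.write v).out = s.out ++ [v] := rfl

/-- The scalar variables that a program assigns. -/
def Prog.wreg : Prog → List ℕ
  | .skip => []
  | .set x _ => [x]
  | .put _ _ _ => []
  | .emit _ => []
  | .seq P Q => P.wreg ++ Q.wreg
  | .ite _ P Q => P.wreg ++ Q.wreg
  | .loop _ P => P.wreg

/-- The arrays that a program assigns. -/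
def Prog.warr : Prog → List ℕ
  | .skip => []
  | .set _ _ => []
  | .put a _ _ => [a]
  | .emit _ => []
  | .seq P Q => P.warr ++ Q.warr
  | .ite _ P Q => P.warr ++ Q.warr
  | .loop _ P => P.warr

/-- Whether a program contains an output command. -/
def Prog.emits : Prog → Bool
  | .skip => false
  | .set _ _ => false
  | .put _ _ _ => false
  | .emit _ => true
  | .seq P Q => P.emits || Q.emits
  | .ite _ P Q => P.emits || Q.emits
  | .loop _ P => P.emits

/-- What an execution of `P` cannot change. -/
structure Frame (P : Prog) (s s' : State) : Prop where
  reg : ∀ x, x ∉ P.wreg → s'.reg x = s.reg x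
  mem : ∀ a, a ∉ P.warr → s'.mem a = s.mem a
  out : P.emits = false → s'.out = s.out

theorem Frame.refl (P : Prog) (s : State) : Frame P s s :=
  ⟨fun _ _ => rfl, fun _ _ => rfl, fun _ => rfl⟩

theorem Frame.trans {P : Prog} {s s' s'' : State} (h : Frame P s s') (h' : Frame P s' s'') :
    Frame P s s'' :=
  ⟨fun x hx => (h'.reg x hx).trans (h.reg x hx), fun a ha => (h'.mem a ha).trans (h.mem a ha),
    fun ho => (h'.out ho).trans (h.out ho)⟩

/-- The specifications below mention only what a program is run for. That all other variables,
arrays and the output survive is a syntactic matter, and `decide` settles the side conditions. -/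
theorem Exec.frame {W : ℕ} {P : Prog} {s s' : State} {t : ℕ} (h : Exec W P s s' t) :
    Frame P s s' := by
  induction h with
  | skip s => exact Frame.refl _ _
  | set s x e he =>
    refine ⟨fun y hy => ?_, fun _ _ => rfl, fun _ => rfl⟩
    simp only [Prog.wreg, List.mem_singleton] at hy
    simp [hy]
  | put s a i e hi he =>
    refine ⟨fun _ _ => rfl, fun b hb => ?_, fun _ => rfl⟩
    simp only [Prog.warr, List.mem_singleton] at hb
    simp [hb]
  | emit s e he =>
    exact ⟨fun _ _ => rfl, fun _ _ => rfl, fun ho => by simp [Prog.emits] at ho⟩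
  | seq _ _ ih₁ ih₂ =>
    refine ⟨fun x hx => ?_, fun a ha => ?_, fun ho => ?_⟩
    · simp only [Prog.wreg, List.mem_append, not_or] at hx
      rw [ih₂.reg x hx.2, ih₁.reg x hx.1]
    · simp only [Prog.warr, List.mem_append, not_or] at ha
      rw [ih₂.mem a ha.2, ih₁.mem a ha.1]
    · simp only [Prog.emits, Bool.or_eq_false_iff] at ho
      rw [ih₂.out ho.2, ih₁.out ho.1]
  | ite_true _ _ ih =>
    refine ⟨fun x hx => ?_, fun a ha => ?_, fun ho => ?_⟩
    · simp only [Prog.wreg, List.mem_append, not_or] at hx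
      exact ih.reg x hx.1
    · simp only [Prog.warr, List.mem_append, not_or] at ha
      exact ih.mem a ha.1
    · simp only [Prog.emits, Bool.or_eq_false_iff] at ho
      exact ih.out ho.1
  | ite_false _ _ ih =>
    refine ⟨fun x hx => ?_, fun a ha => ?_, fun ho => ?_⟩
    · simp only [Prog.wreg, List.mem_append, not_or] at hx
      exact ih.reg x hx.2
    · simp only [Prog.warr, List.mem_append, not_or] at ha
      exact ih.mem a ha.2
    · simp only [Prog.emits, Bool.or_eq_false_iff] at ho
      exact ih.out ho.2
  | loop_true _ _ _ ih₁ ih₂ =>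
    exact ⟨fun x hx => (ih₂.reg x hx).trans (ih₁.reg x hx),
      fun a ha => (ih₂.mem a ha).trans (ih₁.mem a ha), fun ho => (ih₂.out ho).trans (ih₁.out ho)⟩
  | loop_false _ => exact Frame.refl _ _

attribute [simp] Expr.eval Expr.cost

/-- Total correctness with time: started in `s`, the program `P` halts in a state `s'` after `t`
steps with `Q s' t`. -/
def WP (W : ℕ) (P : Prog) (s : State) (Q : State → ℕ → Prop) : Prop :=
  ∃ s' t, Exec W P s s' t ∧ Q s' t

/-- The continuation also receives the frame of the execution, so that no specification has to list
what it leaves alone. -/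
theorem WP.mono {W : ℕ} {P : Prog} {s : State} {Q R : State → ℕ → Prop} (h : WP W P s Q)
    (hQR : ∀ s' t, Frame P s s' → Q s' t → R s' t) : WP W P s R := by
  obtain ⟨s', t, he, hq⟩ := h
  exact ⟨s', t, he, hQR s' t he.frame hq⟩

@[simp] theorem wp_skip {W : ℕ} {s : State} {Q : State → ℕ → Prop} : WP W .skip s Q ↔ Q s 1 := by
  constructor
  · rintro ⟨s', t, he, hq⟩
    cases he
    exact hq
  · exact fun h => ⟨s, 1, .skip s, h⟩

@[simp] theorem wp_set {W x : ℕ} {e : Expr} {s : State} {Q : State → ℕ → Prop} :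
    WP W (.set x e) s Q ↔ e.eval s < W ∧ Q (s.setReg x (e.eval s)) (e.cost + 1) := by
  constructor
  · rintro ⟨s', t, he, hq⟩
    cases he with
    | set _ _ _ h => exact ⟨h, hq⟩
  · exact fun h => ⟨_, _, .set s x e h.1, h.2⟩

@[simp] theorem wp_put {W a : ℕ} {i e : Expr} {s : State} {Q : State → ℕ → Prop} :
    WP W (.put a i e) s Q ↔ (i.eval s < W ∧ e.eval s < W) ∧
      Q (s.setMem a (i.eval s) (e.eval s)) (i.cost + e.cost + 1) := by
  constructor
  · rintro ⟨s', t, he, hq⟩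
    cases he with
    | put _ _ _ _ h h' => exact ⟨⟨h, h'⟩, hq⟩
  · exact fun h => ⟨_, _, .put s a i e h.1.1 h.1.2, h.2⟩

@[simp] theorem wp_emit {W : ℕ} {e : Expr} {s : State} {Q : State → ℕ → Prop} :
    WP W (.emit e) s Q ↔ e.eval s < W ∧ Q (s.write (e.eval s)) (e.cost + 1) := by
  constructor
  · rintro ⟨s', t, he, hq⟩
    cases he with
    | emit _ _ h => exact ⟨h, hq⟩
  · exact fun h => ⟨_, _, .emit s e h.1, h.2⟩

@[simp] theorem wp_seq {W : ℕ} {P P' : Prog} {s : State} {Q : State → ℕ → Prop} :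
    WP W (.seq P P') s Q ↔ WP W P s fun s₁ t₁ => WP W P' s₁ fun s₂ t₂ => Q s₂ (t₁ + t₂) := by
  constructor
  · rintro ⟨s', t, he, hq⟩
    cases he with
    | seq h h' => exact ⟨_, _, h, _, _, h', hq⟩
  · rintro ⟨_, _, h, _, _, h', hq⟩
    exact ⟨_, _, .seq h h', hq⟩

@[simp] theorem wp_ite {W : ℕ} {e : Expr} {P P' : Prog} {s : State} {Q : State → ℕ → Prop} :
    WP W (.ite e P P') s Q ↔
      (e.eval s ≠ 0 → WP W P s fun s' t => Q s' (e.cost + 1 + t)) ∧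
      (e.eval s = 0 → WP W P' s fun s' t => Q s' (e.cost + 1 + t)) := by
  constructor
  · rintro ⟨s', t, he, hq⟩
    cases he with
    | ite_true h h' => exact ⟨fun _ => ⟨_, _, h', hq⟩, fun h0 => absurd h0 h⟩
    | ite_false h h' => exact ⟨fun h0 => absurd h h0, fun _ => ⟨_, _, h', hq⟩⟩
  · rintro ⟨h₁, h₂⟩
    by_cases h : e.eval s = 0
    · obtain ⟨s', t, he, hq⟩ := h₂ h
      exact ⟨_, _, .ite_false h he, hq⟩
    · obtain ⟨s', t, he, hq⟩ := h₁ h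
      exact ⟨_, _, .ite_true h he, hq⟩

/-- The rule for loops: in an invariant `I s N`, the number `N` is a potential that pays for every
iteration. -/
theorem WP.loop_pot {W : ℕ} {e : Expr} {P : Prog} {s : State} {Q : State → ℕ → Prop}
    (I : State → ℕ → Prop) (N : ℕ) (hI : I s N)
    (body : ∀ s₁ N₁, Frame P s s₁ → I s₁ N₁ → e.eval s₁ ≠ 0 →
      WP W P s₁ fun s₂ t => ∃ N₂, I s₂ N₂ ∧ e.cost + 1 + t + N₂ ≤ N₁)
    (hQ : ∀ s₁ N₁ t, Frame P s s₁ → I s₁ N₁ → e.eval s₁ = 0 → t + N₁ ≤ N + e.cost + 1 → Q s₁ t) :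
    WP W (.loop e P) s Q := by
  -- Each iteration takes at least one step and lowers the potential by as many steps as it takes.
  -- Induction on a bound for the potential therefore gives termination and time together; with
  -- bound `0` no iteration is possible.
  suffices H : ∀ B s₁ N₁, N₁ ≤ B → Frame P s s₁ → I s₁ N₁ →
      WP W (.loop e P) s₁ fun s₂ t => ∃ N₂, Frame P s s₂ ∧ I s₂ N₂ ∧ e.eval s₂ = 0 ∧
        t + N₂ ≤ N₁ + e.cost + 1 by
    obtain ⟨s₂, t, he, N₂, hf, hi, h0, ht⟩ := H N s N le_rfl (Frame.refl _ _) hI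
    exact ⟨s₂, t, he, hQ s₂ N₂ t hf hi h0 ht⟩
  intro B
  induction B with
  | zero =>
    intro s₁ N₁ hB hf hi
    by_cases h0 : e.eval s₁ = 0
    · exact ⟨s₁, _, .loop_false h0, N₁, hf, hi, h0, by omega⟩
    · obtain ⟨s₂, t, he, N₂, hi', ht⟩ := body s₁ N₁ hf hi h0
      omega
  | succ B ih =>
    intro s₁ N₁ hB hf hi
    by_cases h0 : e.eval s₁ = 0
    · exact ⟨s₁, _, .loop_false h0, N₁, hf, hi, h0, by omega⟩
    · obtain ⟨s₂, t, he, N₂, hi', ht⟩ := body s₁ N₁ hf hi h0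
      obtain ⟨s₃, t', he', N₃, hf', hi'', h0', ht'⟩ :=
        ih s₂ N₂ (by omega) (hf.trans he.frame) hi'
      exact ⟨s₃, _, .loop_true h0 he he', N₃, hf', hi'', h0', by omega⟩

/-- The rule for loops with a potential that is a function of the state. -/
theorem WP.loop {W : ℕ} {e : Expr} {P : Prog} {s : State} {Q : State → ℕ → Prop}
    (I : State → Prop) (φ : State → ℕ) (hI : I s)
    (body : ∀ s₁, Frame P s s₁ → I s₁ → e.eval s₁ ≠ 0 →
      WP W P s₁ fun s₂ t => I s₂ ∧ e.cost + 1 + t + φ s₂ ≤ φ s₁)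
    (hQ : ∀ s₁ t, Frame P s s₁ → I s₁ → e.eval s₁ = 0 → t + φ s₁ ≤ φ s + e.cost + 1 → Q s₁ t) :
    WP W (.loop e P) s Q := by
  refine WP.loop_pot (fun s₁ N₁ => I s₁ ∧ N₁ = φ s₁) (φ s) ⟨hI, rfl⟩ ?_ ?_
  · rintro s₁ _ hf ⟨hi, rfl⟩ h0
    exact (body s₁ hf hi h0).mono fun s₂ t _ h => ⟨φ s₂, ⟨h.1, rfl⟩, h.2⟩
  · rintro s₁ _ t hf ⟨hi, rfl⟩ h0 ht
    exact hQ s₁ t hf hi h0 ht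

theorem wp_loop_of_eq_zero {W : ℕ} {e : Expr} {P : Prog} {s : State} {Q : State → ℕ → Prop}
    (h0 : e.eval s = 0) (h : Q s (e.cost + 1)) : WP W (.loop e P) s Q :=
  ⟨_, _, .loop_false h0, h⟩

theorem wp_loop_of_ne_zero {W : ℕ} {e : Expr} {P : Prog} {s : State} {Q : State → ℕ → Prop}
    (h0 : e.eval s ≠ 0)
    (h : WP W P s fun s₁ t₁ => WP W (.loop e P) s₁ fun s₂ t₂ => Q s₂ (e.cost + 1 + t₁ + t₂)) :
    WP W (.loop e P) s Q := by
  obtain ⟨s₁, t₁, h₁, s₂, t₂, h₂, hq⟩ := h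
  exact ⟨_, _, .loop_true h0 h₁ h₂, hq⟩

infixr:50 " ;; " => Prog.seq

end RAM

/-! ## Eulerian cycles as schedules -/

/-- The instance in the form in which the enumeration works on it: nodes are numbers below `l`,
the root is `0`, edges are numbers below `m`, and nonzero `pr i` marks the edge `i` as the
compulsory first exit of its tail. The exits of the node `v` occupy the positions from `st v` to
`st (v + 1) - 1` of a schedule. The edges `t0 v` form a spanning tree directed to the root, in
which the subtree of `v` consists of the nodes from `v` to `en v - 1`. -/
structure Core where
  l : ℕ
  m : ℕ
  M : ℕ
  tl : ℕ → ℕ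
  hd : ℕ → ℕ
  mu : ℕ → ℕ
  pr : ℕ → ℕ
  st : ℕ → ℕ
  t0 : ℕ → ℕ
  en : ℕ → ℕ

namespace Core

/-- The number of edges, with multiplicity, leaving `v`. -/
def outDeg (K : Core) (v : ℕ) : ℕ := ∑ i ∈ Finset.range K.m with K.tl i = v, K.mu i

/-- The number of edges, with multiplicity, entering `v`. -/
def inDeg (K : Core) (v : ℕ) : ℕ := ∑ i ∈ Finset.range K.m with K.hd i = v, K.mu i

/-- The path from `w` to the root along the edges selected by `T` visits `v`. -/
inductive OnChain (K : Core) (T : ℕ → ℕ) (v : ℕ) : ℕ → Prop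
  | refl : OnChain K T v v
  | step (w : ℕ) : w ≠ 0 → OnChain K T v (K.hd (T w)) → OnChain K T v w

/-- The properties of the data of a `Core`. -/
structure Valid (K : Core) : Prop where
  l_pos : 0 < K.l
  tl_lt : ∀ i < K.m, K.tl i < K.l
  hd_lt : ∀ i < K.m, K.hd i < K.l
  mu_pos : ∀ i < K.m, 0 < K.mu i
  st_zero : K.st 0 = 0
  st_succ : ∀ v < K.l, K.st (v + 1) = K.st v + K.outDeg v
  st_last : K.st K.l = K.M
  balance : ∀ v < K.l, K.outDeg v = K.inDeg v
  pr_mu : ∀ i < K.m, K.pr i ≠ 0 → K.mu i = 1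
  pr_unique : ∀ i < K.m, ∀ j < K.m, K.pr i ≠ 0 → K.pr j ≠ 0 → K.tl i = K.tl j → i = j
  pr_two : ∀ i < K.m, K.pr i ≠ 0 → K.tl i ≠ 0 → 2 ≤ K.outDeg (K.tl i)
  t0_lt : ∀ v, 0 < v → v < K.l → K.t0 v < K.m
  t0_tl : ∀ v, 0 < v → v < K.l → K.tl (K.t0 v) = v
  t0_pr : ∀ v, 0 < v → v < K.l → K.pr (K.t0 v) = 0
  t0_hd : ∀ v, 0 < v → v < K.l → K.hd (K.t0 v) < v
  en_spec : ∀ v < K.l, ∀ w < K.l, K.OnChain K.t0 v w ↔ v ≤ w ∧ w < K.en v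

/-- `K.IsWalk u q v`: the sequence of edges `q` leads from `u` to `v`. -/
def IsWalk (K : Core) : ℕ → List ℕ → ℕ → Prop
  | u, [], v => u = v
  | u, i :: q, v => i < K.m ∧ K.tl i = u ∧ K.IsWalk (K.hd i) q v

structure IsSol (K : Core) (q : List ℕ) : Prop where
  walk : K.IsWalk 0 q 0
  count : ∀ i < K.m, q.count i = K.mu i
  prio : ∀ i < K.m, K.pr i ≠ 0 → ∀ q₁ q₂, q = q₁ ++ i :: q₂ → ∀ j ∈ q₁, K.tl j ≠ K.tl i

/-- The edges of `q` that leave `v`, in their order. -/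
def exits (K : Core) (q : List ℕ) (v : ℕ) : List ℕ := q.filter fun i => K.tl i = v

/-- The edge by which `q` leaves `v` for the last time. -/
def lst (K : Core) (q : List ℕ) (v : ℕ) : ℕ := (K.exits q v).getLastD 0

/-- The root can be reached from `v` along the edges selected by `T`. -/
inductive Reaches (K : Core) (T : ℕ → ℕ) : ℕ → Prop
  | root : Reaches K T 0
  | step (v : ℕ) : v ≠ 0 → Reaches K T (K.hd (T v)) → Reaches K T v

/-- `T` selects the edges of a spanning tree directed to the root, none of which is a
compulsory first exit. -/
structure Arb (K : Core) (T : ℕ → ℕ) : Prop where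
  lt : ∀ v, 0 < v → v < K.l → T v < K.m
  tl : ∀ v, 0 < v → v < K.l → K.tl (T v) = v
  pr : ∀ v, 0 < v → v < K.l → K.pr (T v) = 0
  reaches : ∀ v < K.l, K.Reaches T v

/-- The node to which a position of a schedule belongs. -/
def blk (K : Core) (p : ℕ) : ℕ := Nat.findGreatest (fun v => K.st v ≤ p) K.l

/-- The sequence of exits of `v` in the schedule `f`. -/
def sched (K : Core) (f : ℕ → ℕ) (v : ℕ) : List ℕ :=
  (List.range' (K.st v) (K.st (v + 1) - K.st v)).map f

/-- The schedule `f` uses every edge as often as it should, begins with the compulsory first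
exits, and its last exits are those of the tree `T`. -/
structure Good (K : Core) (T f : ℕ → ℕ) : Prop where
  lt : ∀ p < K.M, f p < K.m
  tl : ∀ p < K.M, K.tl (f p) = K.blk p
  count : ∀ i < K.m, {p ∈ Finset.range K.M | f p = i}.card = K.mu i
  prio : ∀ i < K.m, K.pr i ≠ 0 → f (K.st (K.tl i)) = i
  last : ∀ v, 0 < v → v < K.l → f (K.st (v + 1) - 1) = T v

variable {K : Core}

theorem Valid.st_mono (hK : K.Valid) {u v : ℕ} (huv : u ≤ v) (hv : v ≤ K.l) :
    K.st u ≤ K.st v := by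
  induction v, huv using Nat.le_induction with
  | base => exact le_rfl
  | succ v _ ih =>
    rw [hK.st_succ v (by omega)]
    exact (ih (by omega)).trans (Nat.le_add_right _ _)

theorem Valid.st_le (hK : K.Valid) {v : ℕ} (hv : v ≤ K.l) : K.st v ≤ K.M :=
  hK.st_last ▸ hK.st_mono hv le_rfl

theorem Valid.blk_eq (hK : K.Valid) {v p : ℕ} (hv : v < K.l) (h₁ : K.st v ≤ p)
    (h₂ : p < K.st (v + 1)) : K.blk p = v := by
  unfold blk
  rw [Nat.findGreatest_eq_iff]
  refine ⟨hv.le, fun _ => h₁, fun w hw hwl hp => ?_⟩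
  have := hK.st_mono (show v + 1 ≤ w from hw) hwl
  omega

theorem Valid.blk_spec (hK : K.Valid) {p : ℕ} (hp : p < K.M) :
    K.blk p < K.l ∧ K.st (K.blk p) ≤ p ∧ p < K.st (K.blk p + 1) := by
  have h₁ : K.st (K.blk p) ≤ p :=
    Nat.findGreatest_spec (P := fun v => K.st v ≤ p) (Nat.zero_le K.l)
      (by rw [hK.st_zero]; exact Nat.zero_le p)
  have h₂ : K.blk p ≤ K.l := Nat.findGreatest_le _
  have h₃ : K.blk p < K.l := by
    rcases h₂.lt_or_eq with h | h
    · exact h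
    · rw [h, hK.st_last] at h₁; omega
  refine ⟨h₃, h₁, ?_⟩
  by_contra hc
  exact Nat.findGreatest_is_greatest (P := fun v => K.st v ≤ p) (Nat.lt_add_one (K.blk p)) h₃
    (by omega)

theorem Valid.st_add_outDeg_le (hK : K.Valid) {v : ℕ} (hv : v < K.l) :
    K.st v + K.outDeg v ≤ K.M := by
  rw [← hK.st_succ v hv]; exact hK.st_le hv

theorem Valid.outDeg_pos (hK : K.Valid) {i : ℕ} (hi : i < K.m) : 0 < K.outDeg (K.tl i) := by
  have : K.mu i ≤ K.outDeg (K.tl i) :=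
    Finset.single_le_sum (f := K.mu) (fun _ _ => Nat.zero_le _) (by simp [hi])
  exact (hK.mu_pos i hi).trans_le this

theorem Valid.outDeg_pos' (hK : K.Valid) {v : ℕ} (h0 : 0 < v) (hv : v < K.l) :
    0 < K.outDeg v := by
  have := hK.outDeg_pos (hK.t0_lt v h0 hv)
  rwa [hK.t0_tl v h0 hv] at this

theorem count_map_range' (f : ℕ → ℕ) (i a n : ℕ) :
    ((List.range' a n).map f).count i = {p ∈ Finset.Ico a (a + n) | f p = i}.card := by
  induction n generalizing a with
  | zero => simp
  | succ n ih =>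
    rw [List.range'_succ, List.map_cons, List.count_cons, ih,
      ← Finset.insert_Ico_add_one_left_eq_Ico (show a < a + (n + 1) by omega), Finset.filter_insert]
    have : a + 1 + n = a + (n + 1) := by omega
    rw [this]
    by_cases h : f a = i
    · rw [if_pos h, Finset.card_insert_of_notMem (by simp)]; simp [h]
    · rw [if_neg h]; simp [h]

theorem length_sched (hK : K.Valid) {f : ℕ → ℕ} {v : ℕ} (hv : v < K.l) :
    (K.sched f v).length = K.outDeg v := by
  simp [sched, hK.st_succ v hv]

/-- An edge stands only in the block of its tail, so counting in that block counts all its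
occurrences. -/
theorem count_sched (hK : K.Valid) {f : ℕ → ℕ} (htl : ∀ p < K.M, K.tl (f p) = K.blk p) {i : ℕ}
    (hi : i < K.m) :
    (K.sched f (K.tl i)).count i = {p ∈ Finset.range K.M | f p = i}.card := by
  have hv := hK.tl_lt i hi
  rw [sched, count_map_range']
  congr 1
  have hs := hK.st_succ _ hv
  have hle := hK.st_le (show _ + 1 ≤ K.l from hv)
  ext p
  simp only [Finset.mem_filter, Finset.mem_Ico, Finset.mem_range]
  constructor
  · rintro ⟨⟨h₁, h₂⟩, rfl⟩
    exact ⟨by omega, rfl⟩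
  · rintro ⟨h₁, rfl⟩
    have h₂ := hK.blk_spec h₁
    rw [← htl p h₁] at h₂
    exact ⟨⟨h₂.2.1, by omega⟩, rfl⟩

theorem mem_sched (hK : K.Valid) {f : ℕ → ℕ} (hlt : ∀ p < K.M, f p < K.m)
    (htl : ∀ p < K.M, K.tl (f p) = K.blk p) {i v : ℕ} (hv : v < K.l) (hi : i ∈ K.sched f v) :
    i < K.m ∧ K.tl i = v := by
  simp only [sched, List.mem_map, List.mem_range'_1] at hi
  obtain ⟨p, ⟨h₁, h₂⟩, rfl⟩ := hi
  have hle := hK.st_le (show _ + 1 ≤ K.l from hv)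
  have hp : p < K.M := by omega
  exact ⟨hlt p hp, by rw [htl p hp, hK.blk_eq hv h₁ (by omega)]⟩

theorem IsWalk.lt {u v : ℕ} {q : List ℕ} (h : K.IsWalk u q v) : ∀ i ∈ q, i < K.m := by
  induction q generalizing u with
  | nil => simp
  | cons i q ih =>
    obtain ⟨h₁, _, h₃⟩ := h
    simp only [List.mem_cons, forall_eq_or_imp]
    exact ⟨h₁, ih h₃⟩

theorem IsWalk.snoc {u v : ℕ} {q : List ℕ} (h : K.IsWalk u q v) {i : ℕ} (hi : i < K.m)
    (ht : K.tl i = v) : K.IsWalk u (q ++ [i]) (K.hd i) := by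
  induction q generalizing u with
  | nil => exact ⟨hi, ht.trans h.symm, rfl⟩
  | cons j q ih => exact ⟨h.1, h.2.1, ih h.2.2⟩

/-- Each passage through `w` enters and leaves once; only the two ends of the walk can break the
balance. -/
theorem IsWalk.degree {u v : ℕ} {q : List ℕ} (h : K.IsWalk u q v) (w : ℕ) :
    q.countP (K.tl · = w) + (if v = w then 1 else 0) =
      q.countP (K.hd · = w) + (if u = w then 1 else 0) := by
  induction q generalizing u with
  | nil => rw [show u = v from h]; simp
  | cons i q ih =>
    have := ih h.2.2
    rw [List.countP_cons, List.countP_cons, h.2.1]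
    simp only [decide_eq_true_eq]
    omega

theorem countP_eq_sum_count {m : ℕ} (p : ℕ → Prop) [DecidablePred p] {q : List ℕ}
    (h : ∀ i ∈ q, i < m) : q.countP (p ·) = ∑ i ∈ Finset.range m with p i, q.count i := by
  induction q with
  | nil => simp
  | cons j q ih =>
    simp only [List.mem_cons, forall_eq_or_imp] at h
    rw [List.countP_cons, ih h.2]
    simp only [List.count_cons, Finset.sum_add_distrib, beq_iff_eq, decide_eq_true_eq]
    congr 1
    rw [Finset.sum_ite_eq]
    simp [h.1]

theorem length_exits (q : List ℕ) (v : ℕ) : (K.exits q v).length = q.countP (K.tl · = v) := by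
  rw [exits, List.countP_eq_length_filter]

theorem count_exits (q : List ℕ) (i : ℕ) : (K.exits q (K.tl i)).count i = q.count i := by
  rw [exits, List.count_filter]; simp

theorem IsSol.length_exits (hq : List ℕ) (h : K.IsSol hq) (v : ℕ) :
    (K.exits hq v).length = K.outDeg v := by
  rw [Core.length_exits, countP_eq_sum_count (K.tl · = v) h.walk.lt]
  exact Finset.sum_congr rfl fun i hi => h.count i (by simp at hi; exact hi.1)

theorem exits_append (q₁ q₂ : List ℕ) (v : ℕ) :
    K.exits (q₁ ++ q₂) v = K.exits q₁ v ++ K.exits q₂ v := List.filter_append ..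

/-- A walk is determined by its start and the sequences of exits. -/
theorem IsWalk.eq_of_exits {q q' : List ℕ} {u v v' : ℕ} (h : K.IsWalk u q v)
    (h' : K.IsWalk u q' v') (he : ∀ i < K.m, K.exits q (K.tl i) = K.exits q' (K.tl i)) :
    q = q' := by
  induction q generalizing u q' with
  | nil =>
    cases q' with
    | nil => rfl
    | cons j q' =>
      have := he j h'.1
      simp [exits] at this
  | cons i q ih =>
    cases q' with
    | nil =>
      have := he i h.1
      simp [exits] at this
    | cons j q' =>
      have hij : i = j := by
        have := he i h.1
        have htl : K.tl j = K.tl i := h'.2.1.trans h.2.1.symm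
        simp only [exits, htl, decide_true, List.filter_cons_of_pos, List.cons.injEq] at this
        exact this.1
      subst hij
      congr 1
      refine ih h.2.2 h'.2.2 fun k hk => ?_
      have := he k hk
      simp only [exits, List.filter_cons] at this
      split at this
      · simpa [exits] using this
      · exact this

/-- Every schedule whose last exits form a tree belongs to a solution. -/
theorem Good.exists_sol (hK : K.Valid) {T f : ℕ → ℕ} (hT : K.Arb T) (hf : K.Good T f) :
    ∃ q, K.IsSol q ∧ ∀ v < K.l, K.exits q v = K.sched f v := by
  -- a longest walk from the root that follows the schedule
  have hbound : ∀ q u, K.IsWalk 0 q u → (∀ v < K.l, K.exits q v <+: K.sched f v) →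
      q.length ≤ ∑ i ∈ Finset.range K.m, K.mu i := by
    intro q u hq hpre
    have h₁ := countP_eq_sum_count (fun _ => True) hq.lt
    simp only [decide_true, List.countP_true, Finset.filter_true] at h₁
    rw [h₁]
    refine Finset.sum_le_sum fun i hi => ?_
    have hi : i < K.m := by simpa using hi
    rw [← count_exits (K := K), ← hf.count i hi, ← count_sched hK hf.tl hi]
    exact (hpre _ (hK.tl_lt i hi)).sublist.count_le i
  obtain ⟨n, ⟨q, u, hlen, hq, hpre⟩, hmax⟩ : ∃ n, (∃ q u, q.length = n ∧ K.IsWalk 0 q u ∧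
      ∀ v < K.l, K.exits q v <+: K.sched f v) ∧ ∀ q u, K.IsWalk 0 q u →
      (∀ v < K.l, K.exits q v <+: K.sched f v) → q.length ≤ n := by
    let S : Set ℕ := {n | ∃ q u, q.length = n ∧ K.IsWalk 0 q u ∧
      ∀ v < K.l, K.exits q v <+: K.sched f v}
    have hne : S.Nonempty := ⟨0, [], 0, rfl, rfl, fun v _ => by simp [exits]⟩
    have hbdd : BddAbove S := ⟨_, by
      rintro n ⟨q, u, rfl, hq, hpre⟩
      exact hbound q u hq hpre⟩
    exact ⟨sSup S, Nat.sSup_mem hne hbdd, fun q u hq hpre => le_csSup hbdd ⟨q, u, rfl, hq, hpre⟩⟩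
  have hul : u < K.l := by
    have key : ∀ (q : List ℕ) (a : ℕ), a < K.l → K.IsWalk a q u → u < K.l := by
      intro q
      induction q with
      | nil => rintro a ha rfl; exact ha
      | cons i q ih => exact fun a _ h => ih _ (hK.hd_lt i h.1) h.2.2
    exact key q 0 hK.l_pos hq
  -- it is stuck at its end
  have hstuck : K.exits q u = K.sched f u := by
    obtain ⟨rest, hrest⟩ := hpre u hul
    cases rest with
    | nil => simpa using hrest
    | cons i rest =>
      exfalso
      have hi : i ∈ K.sched f u := by rw [← hrest]; simp
      obtain ⟨him, hit⟩ := mem_sched hK hf.lt hf.tl hul hi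
      have := hmax (q ++ [i]) (K.hd i) (hq.snoc him hit) fun v hv => by
        rw [exits_append]
        by_cases hvu : v = u
        · subst hvu
          refine ⟨rest, ?_⟩
          rw [← hrest]
          simp [exits, hit]
        · have : K.exits [i] v = [] := by simp [exits, hit, Ne.symm hvu]
          rw [this, List.append_nil]
          exact hpre v hv
      simp at this
      omega
  have hcnt : ∀ i < K.m, q.count i ≤ K.mu i := fun i hi => by
    rw [← count_exits (K := K), ← hf.count i hi, ← count_sched hK hf.tl hi]
    exact (hpre _ (hK.tl_lt i hi)).sublist.count_le i
  have hin : ∀ w, q.countP (K.hd · = w) ≤ K.inDeg w := fun w => by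
    rw [countP_eq_sum_count (K.hd · = w) hq.lt]
    exact Finset.sum_le_sum fun i hi => hcnt i (by simp at hi; exact hi.1)
  have hout_of : ∀ w < K.l, K.exits q w = K.sched f w →
      q.countP (K.tl · = w) = K.outDeg w := fun w hw h => by
    rw [← length_exits, h, length_sched hK hw]
  -- At any other node the walk would have entered `u` once more often than it left it. But all
  -- exits of `u` are used up, and `u` has no more entries than exits.
  have hu0 : u = 0 := by
    by_contra hu0
    have h₁ := hq.degree u
    have h₂ := hin u
    rw [hout_of u hul hstuck, if_pos rfl, if_neg (Ne.symm hu0), hK.balance u hul] at h₁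
    omega
  subst hu0
  -- Induction along the tree, away from the root. Once all exits of the head of `T v` are used,
  -- balance forces all entries of that head to be used, among them every copy of `T v`. As `T v`
  -- stands last in the schedule of `v`, nothing is left over at `v`.
  have hall : ∀ v, K.Reaches T v → v < K.l → K.exits q v = K.sched f v := by
    intro v hv
    induction hv with
    | root => exact fun _ => hstuck
    | step v h0 _ ih =>
      intro hvl
      have h0' : 0 < v := Nat.pos_of_ne_zero h0
      have hTm := hT.lt v h0' hvl
      have hw := hK.hd_lt _ hTm
      have h₁ := hq.degree (K.hd (T v))
      rw [hout_of _ hw (ih hw), hK.balance _ hw,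
        countP_eq_sum_count (K.hd · = K.hd (T v)) hq.lt] at h₁
      have h₂ : q.count (T v) = K.mu (T v) := by
        have h₃ := (Finset.sum_eq_sum_iff_of_le (s := {i ∈ Finset.range K.m | K.hd i = K.hd (T v)})
          (f := fun i => q.count i) (g := K.mu) fun i hi => hcnt i (by simp at hi; exact hi.1)).1
          (by rw [inDeg] at h₁; omega)
        exact h₃ _ (by simp [hTm])
      obtain ⟨rest, hrest⟩ := hpre v hvl
      rcases rest.eq_nil_or_concat with rfl | ⟨rest, i, rfl⟩
      · simpa using hrest
      · exfalso
        have hlast : (K.sched f v).getLast? = some (T v) := by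
          have hpos := hK.outDeg_pos' h0' hvl
          have hs := hK.st_succ v hvl
          rw [← hf.last v h0' hvl, sched, List.getLast?_map, List.getLast?_range']
          rw [if_neg (by omega)]
          simp only [Option.map_some, Option.some.injEq]
          congr 1
          omega
        rw [← hrest] at hlast
        simp only [← List.append_assoc, List.concat_eq_append, List.getLast?_append,
          List.getLast?_singleton, Option.some_or, Option.some.injEq] at hlast
        subst hlast
        have h₃ := count_exits (K := K) q (T v)
        have h₄ := count_sched hK hf.tl hTm
        rw [hf.count _ hTm, hT.tl v h0' hvl, ← hrest] at h₄
        rw [hT.tl v h0' hvl] at h₃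
        simp only [List.count_append, List.concat_eq_append, List.count_singleton_self] at h₄
        omega
  have hall' : ∀ v < K.l, K.exits q v = K.sched f v := fun v hv => hall v (hT.reaches v hv) hv
  refine ⟨q, ⟨hq, fun i hi => ?_, fun i hi hpr q₁ q₂ hqq j hj hjt => ?_⟩, hall'⟩
  · rw [← count_exits (K := K), hall' _ (hK.tl_lt i hi), count_sched hK hf.tl hi, hf.count i hi]
  · have hv := hK.tl_lt i hi
    have hc : q.count i = 1 := by
      rw [← count_exits (K := K), hall' _ hv, count_sched hK hf.tl hi, hf.count i hi,
        hK.pr_mu i hi hpr]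
    -- The first exit of this node is `i`. If some exit preceded the given occurrence of `i`, there
    -- would be an earlier copy of `i`, against multiplicity one.
    have hh : (K.exits q (K.tl i)).head? = some i := by
      have hpos := hK.outDeg_pos hi
      have hs := hK.st_succ _ hv
      rw [hall' _ hv, sched, show K.st (K.tl i + 1) - K.st (K.tl i) =
        (K.st (K.tl i + 1) - K.st (K.tl i) - 1) + 1 by omega, List.range'_succ]
      simp [hf.prio i hi hpr]
    have hne : K.exits q₁ (K.tl i) ≠ [] :=
      List.ne_nil_of_mem (a := j) (by simp [exits, hj, hjt])
    rw [hqq, exits_append, List.head?_append_of_ne_nil _ hne] at hh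
    have h₁ : i ∈ K.exits q₁ (K.tl i) := List.mem_of_mem_head? hh
    have h₂ : i ∈ q₁ := List.mem_of_mem_filter h₁
    rw [hqq, List.count_append, List.count_cons_self] at hc
    have := List.count_pos_iff.2 h₂
    omega

theorem IsSol.exits_prio {q : List ℕ} (hK : K.Valid) (hq : K.IsSol q) {i : ℕ} (hi : i < K.m)
    (hpr : K.pr i ≠ 0) : ∃ rest, K.exits q (K.tl i) = i :: rest := by
  have hmem : i ∈ q := List.count_pos_iff.1 (by rw [hq.count i hi]; exact hK.mu_pos i hi)
  obtain ⟨q₁, q₂, rfl⟩ := List.append_of_mem hmem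
  have h₁ : K.exits q₁ (K.tl i) = [] := by
    simp only [exits, List.filter_eq_nil_iff, decide_eq_true_eq]
    exact hq.prio i hi hpr q₁ q₂ rfl
  refine ⟨K.exits q₂ (K.tl i), ?_⟩
  rw [exits_append, h₁]
  simp [exits]

theorem IsSol.exits_ne_nil {q : List ℕ} (hK : K.Valid) (hq : K.IsSol q) {v : ℕ} (h0 : 0 < v)
    (hv : v < K.l) : K.exits q v ≠ [] := by
  have := hq.length_exits q v
  have hpos := hK.outDeg_pos' h0 hv
  intro hnil
  rw [hnil] at this
  simp at this
  omega

theorem lst_eq_getLast {q : List ℕ} {v : ℕ} (h : K.exits q v ≠ []) :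
    K.lst q v = (K.exits q v).getLast h := by
  rw [lst, List.getLastD_eq_getLast?, List.getLast?_eq_some_getLast h]; rfl

/-- After its last exit from a node other than the root the cycle does not return there. Hence the
last exits met along a path of `K.lst q` come later and later in the cycle, and the path can only
stop at the root. A compulsory edge is the first of at least two exits and occurs once, so it is not
the last. -/
theorem IsSol.arb {q : List ℕ} (hK : K.Valid) (hq : K.IsSol q) : K.Arb (K.lst q) := by
  have hmem : ∀ v, 0 < v → v < K.l → K.lst q v ∈ K.exits q v := fun v h0 hv => by
    rw [lst_eq_getLast (hq.exits_ne_nil hK h0 hv)]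
    exact List.getLast_mem _
  have hlt : ∀ v, 0 < v → v < K.l → K.lst q v < K.m := fun v h0 hv =>
    hq.walk.lt _ (List.mem_of_mem_filter (hmem v h0 hv))
  have htl : ∀ v, 0 < v → v < K.l → K.tl (K.lst q v) = v := fun v h0 hv => by
    have := hmem v h0 hv
    simp only [exits, List.mem_filter, decide_eq_true_eq] at this
    exact this.2
  refine ⟨hlt, htl, fun v h0 hv => ?_, fun v hv => ?_⟩
  · by_contra hpr
    obtain ⟨rest, hrest⟩ := hq.exits_prio hK (hlt v h0 hv) hpr
    have h₂ := hK.pr_two _ (hlt v h0 hv) hpr (by rw [htl v h0 hv]; omega)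
    rw [← hq.length_exits q, hrest] at h₂
    have hr : rest ≠ [] := by rintro rfl; simp at h₂
    have h₃ := lst_eq_getLast (hq.exits_ne_nil hK h0 hv)
    have h₄ := hq.count _ (hlt v h0 hv)
    rw [← count_exits (K := K), hrest, hK.pr_mu _ (hlt v h0 hv) hpr, List.count_cons_self] at h₄
    have h₅ : K.lst q v ∈ rest := by
      rw [htl v h0 hv] at hrest
      simp only [hrest] at h₃
      rw [List.getLast_cons hr] at h₃
      rw [h₃]
      have : rest.getLast hr ∈ rest := List.getLast_mem hr
      exact this
    have := List.count_pos_iff.2 h₅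
    omega
  -- Induction on the suffix `q₂`. If the rest of the suffix leaves the tail of its first edge no
  -- more, then this edge is the last exit there, and its head is where the rest starts.
  · have key : ∀ q₂ q₁ u, q = q₁ ++ q₂ → K.IsWalk u q₂ 0 →
        K.Reaches (K.lst q) u ∧ ∀ v, K.exits q₂ v ≠ [] → K.Reaches (K.lst q) v := by
      intro q₂
      induction q₂ with
      | nil =>
        rintro q₁ u _ rfl
        exact ⟨.root, by simp [exits]⟩
      | cons i q₂ ih =>
        rintro q₁ u hqq ⟨_, rfl, hw⟩
        obtain ⟨h₁, h₂⟩ := ih (q₁ ++ [i]) _ (by simp [hqq]) hw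
        have h₃ : K.Reaches (K.lst q) (K.tl i) := by
          by_cases h0 : K.tl i = 0
          · rw [h0]; exact .root
          by_cases he : K.exits q₂ (K.tl i) = []
          · refine .step _ h0 ?_
            have : K.lst q (K.tl i) = i := by
              have : K.exits q (K.tl i) = K.exits q₁ (K.tl i) ++ [i] := by
                rw [hqq, exits_append]
                congr 1
                simp only [exits, decide_true, List.filter_cons_of_pos, List.cons.injEq, true_and]
                exact he
              rw [lst, this]
              simp
            rw [this]
            exact h₁
          · exact h₂ _ he
        refine ⟨h₃, fun v hv => ?_⟩
        by_cases hvi : K.tl i = v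
        · exact hvi ▸ h₃
        · refine h₂ v ?_
          simpa [exits, List.filter_cons, hvi] using hv
    rcases Nat.eq_zero_or_pos v with rfl | h0
    · exact .root
    · exact (key q [] 0 rfl hq.walk).2 v (hq.exits_ne_nil hK h0 hv)

/-- The sequences of exits of a solution form a schedule. -/
theorem IsSol.exists_good {q : List ℕ} (hK : K.Valid) (hq : K.IsSol q) :
    ∃ f, K.Good (K.lst q) f ∧ ∀ v < K.l, K.exits q v = K.sched f v := by
  -- The default `0` is never used below `K.M`: the block of a node is as long as its list of exits.
  let f : ℕ → ℕ := fun p => (K.exits q (K.blk p)).getD (p - K.st (K.blk p)) 0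
  have hsched : ∀ v < K.l, K.exits q v = K.sched f v := by
    intro v hv
    refine List.ext_getElem (by rw [hq.length_exits, length_sched hK hv]) fun n h₁ h₂ => ?_
    have hs := hK.st_succ v hv
    have hb : K.blk (K.st v + n) = v :=
      hK.blk_eq hv (by omega) (by rw [hq.length_exits] at h₁; omega)
    simp [sched, f, hb, h₁]
  have hmem : ∀ p < K.M, f p ∈ K.exits q (K.blk p) := fun p hp => by
    obtain ⟨h₁, h₂, h₃⟩ := hK.blk_spec hp
    rw [hK.st_succ _ h₁] at h₃
    have : p - K.st (K.blk p) < (K.exits q (K.blk p)).length := by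
      rw [hq.length_exits]; omega
    simp only [f]
    rw [List.getD_eq_getElem _ _ this]
    exact List.getElem_mem this
  have htl : ∀ p < K.M, K.tl (f p) = K.blk p := fun p hp => by
    have := hmem p hp
    simp only [exits, List.mem_filter, decide_eq_true_eq] at this
    exact this.2
  refine ⟨f, ⟨fun p hp => hq.walk.lt _ (List.mem_of_mem_filter (hmem p hp)), htl, fun i hi => ?_,
    fun i hi hpr => ?_, fun v h0 hv => ?_⟩, hsched⟩
  · rw [← count_sched hK htl hi, ← hsched _ (hK.tl_lt i hi), count_exits, hq.count i hi]
  · obtain ⟨rest, hrest⟩ := hq.exits_prio hK hi hpr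
    have hv := hK.tl_lt i hi
    have hpos := hK.outDeg_pos hi
    have hs := hK.st_succ _ hv
    have hb : K.blk (K.st (K.tl i)) = K.tl i := hK.blk_eq hv le_rfl (by omega)
    simp only [f]
    rw [hb, hrest]
    simp
  · have hne := hq.exits_ne_nil hK h0 hv
    have hpos := hK.outDeg_pos' h0 hv
    have hs := hK.st_succ _ hv
    have hb : K.blk (K.st (v + 1) - 1) = v := hK.blk_eq hv (by omega) (by omega)
    have hl := hq.length_exits q v
    rw [lst_eq_getLast hne, List.getLast_eq_getElem]
    simp only [f]
    rw [hb, List.getD_eq_getElem _ _ (by omega)]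
    congr 1
    omega

end Core

/-! ## Schedules with a given tree in lexicographic order -/

namespace Core

/-- The number of compulsory first exits of `v`, which is `0` or `1`. -/
def numPrio (K : Core) (v : ℕ) : ℕ := {i ∈ Finset.range K.m | K.pr i ≠ 0 ∧ K.tl i = v}.card

/-- The first position of the exits of `v` that is not compulsory. -/
def lo (K : Core) (v : ℕ) : ℕ := K.st v + K.numPrio v

/-- The end of the positions of the exits of `v` other than the exit in the tree. -/
def hi (K : Core) (v : ℕ) : ℕ := K.st (v + 1) - (if v = 0 then 0 else 1)

/-- The position `p` is vacant if every node `v` has filled its positions before `ptr v`. -/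
def Vacant (K : Core) (ptr : ℕ → ℕ) (p : ℕ) : Prop :=
  p < K.M ∧ ptr (K.blk p) ≤ p ∧ p < K.hi (K.blk p)

/-- The entry at the position `p` is neither a compulsory first exit nor an exit in the tree. -/
def Free (K : Core) (p : ℕ) : Prop := K.Vacant K.lo p

open scoped Classical in
/-- The array `A` is a schedule for the tree `T` except at the vacant positions, and `cnt e` copies
of the edge `e` are yet to be placed. -/
structure Partial (K : Core) (T A cnt ptr : ℕ → ℕ) : Prop where
  lo_le : ∀ v < K.l, K.lo v ≤ ptr v
  le_hi : ∀ v < K.l, ptr v ≤ K.hi v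
  lt : ∀ p < K.M, ¬ K.Vacant ptr p → A p < K.m
  tl : ∀ p < K.M, ¬ K.Vacant ptr p → K.tl (A p) = K.blk p
  prio : ∀ i < K.m, K.pr i ≠ 0 → A (K.st (K.tl i)) = i
  last : ∀ v, 0 < v → v < K.l → A (K.st (v + 1) - 1) = T v
  count : ∀ e < K.m, cnt e + {p ∈ Finset.range K.M | ¬ K.Vacant ptr p ∧ A p = e}.card = K.mu e

/-- The first `M` entries of an array, in lexicographic order. -/
def key (K : Core) (f : ℕ → ℕ) : Lex (Fin K.M → ℕ) := toLex fun p => f p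

variable {K : Core}

theorem Valid.numPrio_le_one (hK : K.Valid) (v : ℕ) : K.numPrio v ≤ 1 := by
  rw [numPrio, Finset.card_le_one]
  simp only [Finset.mem_filter, Finset.mem_range, and_imp]
  intro i hi hpi hti j hj hpj htj
  exact hK.pr_unique i hi j hj hpi hpj (hti.trans htj.symm)

theorem numPrio_pos_iff {v : ℕ} : 0 < K.numPrio v ↔ ∃ i < K.m, K.pr i ≠ 0 ∧ K.tl i = v := by
  rw [numPrio, Finset.card_pos, Finset.filter_nonempty_iff]
  simp

/-- At a node other than the root the compulsory exit and the tree exit need two different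
positions, which `pr_two` provides. -/
theorem Valid.lo_le_hi (hK : K.Valid) {v : ℕ} (hv : v < K.l) : K.lo v ≤ K.hi v := by
  have hs := hK.st_succ v hv
  have h₁ := hK.numPrio_le_one v
  unfold lo hi
  rcases Nat.eq_zero_or_pos (K.numPrio v) with h | h
  · rcases Nat.eq_zero_or_pos v with rfl | h0
    · rw [if_pos rfl]; omega
    · have := hK.outDeg_pos' h0 hv
      rw [if_neg (by omega)]; omega
  · obtain ⟨i, hi, hpr, rfl⟩ := numPrio_pos_iff.1 h
    have := hK.outDeg_pos hi
    split
    · omega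
    · have := hK.pr_two i hi hpr (by assumption)
      omega

theorem Valid.hi_le (hK : K.Valid) {v : ℕ} (hv : v < K.l) : K.hi v ≤ K.M :=
  (Nat.sub_le _ _).trans (hK.st_le (show v + 1 ≤ K.l from hv))

theorem st_le_lo (v : ℕ) : K.st v ≤ K.lo v := Nat.le_add_right _ _

theorem hi_le_st (v : ℕ) : K.hi v ≤ K.st (v + 1) := Nat.sub_le _ _

theorem Valid.not_free (hK : K.Valid) {p : ℕ} (hp : p < K.M) (h : ¬ K.Free p) :
    (∃ i < K.m, K.pr i ≠ 0 ∧ K.st (K.tl i) = p) ∨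
      (0 < K.blk p ∧ p + 1 = K.st (K.blk p + 1)) := by
  obtain ⟨h₁, h₂, h₃⟩ := hK.blk_spec hp
  have h₄ := hK.numPrio_le_one (K.blk p)
  by_cases h₅ : K.lo (K.blk p) ≤ p
  · right
    have h₆ : K.hi (K.blk p) ≤ p := by
      by_contra hc
      exact h ⟨hp, h₅, by omega⟩
    unfold hi at h₆
    split at h₆ <;> omega
  · left
    unfold lo at h₅
    obtain ⟨i, hi, hpr, hti⟩ := numPrio_pos_iff.1 (show 0 < K.numPrio (K.blk p) by omega)
    exact ⟨i, hi, hpr, by rw [hti]; omega⟩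

/-- The positions that are not free hold compulsory first exits and tree exits, which are the same
in all schedules for `T`. -/
theorem Partial.not_free_eq (hK : K.Valid) {T A cnt ptr f : ℕ → ℕ} (hA : K.Partial T A cnt ptr)
    (hf : K.Good T f) {p : ℕ} (hp : p < K.M) (h : ¬ K.Free p) : A p = f p := by
  rcases hK.not_free hp h with ⟨i, hi, hpr, rfl⟩ | ⟨h₁, h₂⟩
  · rw [hA.prio i hi hpr, hf.prio i hi hpr]
  · have h₃ := (hK.blk_spec hp).1
    have h₄ := hA.last _ h₁ h₃
    have h₅ := hf.last _ h₁ h₃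
    rw [← h₂, Nat.add_sub_cancel] at h₄ h₅
    rw [h₄, h₅]

theorem not_vacant_hi {p : ℕ} : ¬ K.Vacant K.hi p := fun h => by
  obtain ⟨_, h₁, h₂⟩ := h; omega

/-- Two arrays of filling levels that agree on the nodes have the same vacant positions. -/
theorem Valid.vacant_congr (hK : K.Valid) {ptr ptr' : ℕ → ℕ} (h : ∀ v < K.l, ptr v = ptr' v)
    (p : ℕ) : K.Vacant ptr p ↔ K.Vacant ptr' p := by
  unfold Vacant
  refine and_congr_right fun hp => ?_
  rw [h _ (hK.blk_spec hp).1]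

theorem Partial.congr (hK : K.Valid) {T A A' cnt cnt' ptr ptr' : ℕ → ℕ}
    (h : K.Partial T A cnt ptr) (hA : ∀ p < K.M, A p = A' p) (hcnt : ∀ e < K.m, cnt e = cnt' e)
    (hptr : ∀ v < K.l, ptr v = ptr' v) : K.Partial T A' cnt' ptr' := by
  have hv := hK.vacant_congr hptr
  refine ⟨fun v hv => hptr v hv ▸ h.lo_le v hv, fun v hv => hptr v hv ▸ h.le_hi v hv,
    fun p hp hq => hA p hp ▸ h.lt p hp (by rwa [hv]),
    fun p hp hq => hA p hp ▸ h.tl p hp (by rwa [hv]), fun i hi hpr => ?_, fun v h0 hvl => ?_,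
    fun e he => ?_⟩
  · rw [← hA _ ?_, h.prio i hi hpr]
    have := hK.outDeg_pos hi
    have := hK.st_add_outDeg_le (hK.tl_lt i hi)
    omega
  · rw [← hA _ ?_, h.last v h0 hvl]
    have := hK.outDeg_pos' h0 hvl
    have := hK.st_add_outDeg_le hvl
    have := hK.st_succ v hvl
    omega
  · rw [← hcnt e he, ← h.count e he]
    congr 2
    ext p
    simp only [Finset.mem_filter, Finset.mem_range]
    refine and_congr_right fun hp => ?_
    rw [hv, hA p hp]

/-- The copies yet to be placed just fit into the vacant positions. -/
theorem Partial.sum_cnt (hK : K.Valid) {T A cnt ptr : ℕ → ℕ} (h : K.Partial T A cnt ptr) {v : ℕ}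
    (hv : v < K.l) : ∑ e ∈ Finset.range K.m with K.tl e = v, cnt e = K.hi v - ptr v := by
  classical
  have hs := hK.st_succ v hv
  have hlo := h.lo_le v hv
  have hhi := h.le_hi v hv
  have hst := st_le_lo (K := K) v
  have hst' := hi_le_st (K := K) v
  have hM := hK.st_le (show v + 1 ≤ K.l from hv)
  have h₁ : ∑ e ∈ Finset.range K.m with K.tl e = v,
      (cnt e + {p ∈ Finset.range K.M | ¬ K.Vacant ptr p ∧ A p = e}.card) = K.outDeg v :=
    Finset.sum_congr rfl fun e he => h.count e (by simp at he; exact he.1)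
  rw [Finset.sum_add_distrib] at h₁
  -- The filled positions of the block of `v`, grouped by their entries.
  have h₂ : ∑ e ∈ Finset.range K.m with K.tl e = v,
      {p ∈ Finset.range K.M | ¬ K.Vacant ptr p ∧ A p = e}.card =
      {p ∈ Finset.Ico (K.st v) (K.st (v + 1)) | ¬ K.Vacant ptr p}.card := by
    rw [Finset.card_eq_sum_card_fiberwise (f := A)
      (t := {e ∈ Finset.range K.m | K.tl e = v})]
    · refine Finset.sum_congr rfl fun e he => congrArg _ ?_
      simp only [Finset.mem_filter, Finset.mem_range] at he
      ext p
      simp only [Finset.mem_filter, Finset.mem_range, Finset.mem_Ico]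
      constructor
      · rintro ⟨hp, hq, rfl⟩
        have := hK.blk_spec hp
        rw [← h.tl p hp hq, he.2] at this
        exact ⟨⟨this.2, hq⟩, rfl⟩
      · rintro ⟨⟨hp, hq⟩, rfl⟩
        exact ⟨by omega, hq, rfl⟩
    · intro p hp
      simp only [Finset.coe_filter, Finset.mem_Ico, Set.mem_ofPred_eq, Finset.mem_range] at hp ⊢
      exact ⟨h.lt p (by omega) hp.2,
        by rw [h.tl p (by omega) hp.2, hK.blk_eq hv hp.1.1 hp.1.2]⟩
  have h₃ : {p ∈ Finset.Ico (K.st v) (K.st (v + 1)) | K.Vacant ptr p} =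
      Finset.Ico (ptr v) (K.hi v) := by
    ext p
    simp only [Finset.mem_filter, Finset.mem_Ico]
    constructor
    · rintro ⟨hp, _, hq⟩
      rwa [hK.blk_eq hv hp.1 hp.2] at hq
    · rintro ⟨hp, hq⟩
      have hb := hK.blk_eq hv (p := p) (by omega) (by omega)
      exact ⟨⟨by omega, by omega⟩, by omega, by rw [hb]; omega, by rw [hb]; omega⟩
  have h₄ := Finset.card_filter_add_card_filter_not (s := Finset.Ico (K.st v) (K.st (v + 1)))
    (K.Vacant ptr)
  rw [h₃, Nat.card_Ico, Nat.card_Ico] at h₄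
  omega

theorem Partial.ptr_lt_hi (hK : K.Valid) {T A cnt ptr : ℕ → ℕ} (h : K.Partial T A cnt ptr)
    {e : ℕ} (he : e < K.m) (hc : 0 < cnt e) : ptr (K.tl e) < K.hi (K.tl e) := by
  have h₁ := h.sum_cnt hK (hK.tl_lt e he)
  have h₂ : cnt e ≤ ∑ e' ∈ Finset.range K.m with K.tl e' = K.tl e, cnt e' :=
    Finset.single_le_sum (f := cnt) (fun _ _ => Nat.zero_le _) (by simp [he])
  omega

theorem Partial.good (hK : K.Valid) {T A cnt ptr : ℕ → ℕ} (h : K.Partial T A cnt ptr)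
    (hc : ∀ e < K.m, cnt e = 0) : K.Good T A := by
  have hv : ∀ p, ¬ K.Vacant ptr p := by
    rintro p ⟨hp, h₁, h₂⟩
    have := h.sum_cnt hK (hK.blk_spec hp).1
    rw [Finset.sum_eq_zero fun e he => hc e (by simp at he; exact he.1)] at this
    omega
  refine ⟨fun p hp => h.lt p hp (hv p), fun p hp => h.tl p hp (hv p), fun i hi => ?_, h.prio,
    h.last⟩
  have := h.count i hi
  simp only [hv, not_false_eq_true, true_and] at this
  rw [hc i hi, Nat.zero_add] at this
  convert this

theorem Good.partial (hK : K.Valid) {T A : ℕ → ℕ} (h : K.Good T A) :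
    K.Partial T A (fun _ => 0) K.hi :=
  ⟨fun _ hv => hK.lo_le_hi hv, fun _ _ => le_rfl, fun p hp _ => h.lt p hp,
    fun p hp _ => h.tl p hp, h.prio, h.last, fun e he => by
      simp only [not_vacant_hi, not_false_eq_true, true_and]
      rw [Nat.zero_add, ← h.count e he]⟩

theorem prio_lt_lo {i : ℕ} (hi : i < K.m) (hpr : K.pr i ≠ 0) :
    K.st (K.tl i) < K.lo (K.tl i) := by
  have := numPrio_pos_iff.2 ⟨i, hi, hpr, rfl⟩
  unfold lo
  omega

theorem hi_eq {v : ℕ} (h0 : 0 < v) : K.hi v = K.st (v + 1) - 1 := by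
  rw [hi, if_neg (by omega)]

theorem Valid.ptr_blk (hK : K.Valid) {v p : ℕ} (hv : v < K.l) (h₁ : K.lo v ≤ p)
    (h₂ : p < K.hi v) : K.blk p = v :=
  hK.blk_eq hv ((st_le_lo v).trans h₁) (h₂.trans_le (hi_le_st v))

theorem Valid.vacant_update (hK : K.Valid) {ptr : ℕ → ℕ} {v : ℕ} (hv : v < K.l)
    (hlo : K.lo v ≤ ptr v) (hhi : ptr v < K.hi v) (p : ℕ) :
    K.Vacant ptr p ↔ K.Vacant (Function.update ptr v (ptr v + 1)) p ∨ p = ptr v := by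
  have hb := hK.ptr_blk hv hlo hhi
  have hM := hK.hi_le hv
  unfold Vacant
  by_cases h : K.blk p = v
  · rw [h, Function.update_self]
    constructor
    · rintro ⟨h₁, h₂, h₃⟩
      by_cases hp : p = ptr v
      · exact .inr hp
      · exact .inl ⟨h₁, by omega, h₃⟩
    · rintro (⟨h₁, h₂, h₃⟩ | rfl)
      · exact ⟨h₁, by omega, h₃⟩
      · exact ⟨by omega, le_rfl, hhi⟩
  · rw [Function.update_of_ne h]
    constructor
    · exact .inl
    · rintro (h₁ | rfl)
      · exact h₁
      · exact absurd hb h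

/-- Placing a copy of the edge `e` at the first vacant position of its tail. -/
theorem Partial.place (hK : K.Valid) {T A cnt ptr : ℕ → ℕ} (h : K.Partial T A cnt ptr)
    {e : ℕ} (he : e < K.m) (hc : 0 < cnt e) :
    K.Partial T (Function.update A (ptr (K.tl e)) e) (Function.update cnt e (cnt e - 1))
      (Function.update ptr (K.tl e) (ptr (K.tl e) + 1)) := by
  classical
  have hv := hK.tl_lt e he
  have hlt := h.ptr_lt_hi hK he hc
  have hlo := h.lo_le _ hv
  have hvac := hK.vacant_update hv hlo hlt
  have hb := hK.ptr_blk hv hlo hlt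
  set a := ptr (K.tl e) with ha
  have haM : a < K.M := hlt.trans_le (hK.hi_le hv)
  have hself : ¬ K.Vacant (Function.update ptr (K.tl e) (a + 1)) a := by
    rintro ⟨_, h₁, _⟩
    rw [hb, Function.update_self] at h₁
    omega
  have hva : K.Vacant ptr a := (hvac a).2 (.inr rfl)
  have hnv : ∀ p, ¬ K.Vacant (Function.update ptr (K.tl e) (a + 1)) p ↔
      ¬ K.Vacant ptr p ∨ p = a := by
    intro p
    by_cases hp : p = a
    · subst hp; simp [hself]
    · rw [hvac]; simp [hp]
  refine ⟨fun v hvl => ?_, fun v hvl => ?_, fun p hp hq => ?_, fun p hp hq => ?_,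
    fun i hi hpr => ?_, fun v h0 hvl => ?_, fun e' he' => ?_⟩
  · by_cases hve : v = K.tl e
    · subst hve; rw [Function.update_self]; omega
    · rw [Function.update_of_ne hve]; exact h.lo_le v hvl
  · by_cases hve : v = K.tl e
    · subst hve; rw [Function.update_self]; omega
    · rw [Function.update_of_ne hve]; exact h.le_hi v hvl
  · by_cases hpa : p = a
    · subst hpa; rwa [Function.update_self]
    · rw [Function.update_of_ne hpa]
      exact h.lt p hp (by simpa [hpa] using (hnv p).1 hq)
  · by_cases hpa : p = a
    · subst hpa; rw [Function.update_self, hb]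
    · rw [Function.update_of_ne hpa]
      exact h.tl p hp (by simpa [hpa] using (hnv p).1 hq)
  · rw [Function.update_of_ne, h.prio i hi hpr]
    intro hia
    have hbi : K.blk (K.st (K.tl i)) = K.tl i := by
      have := hK.outDeg_pos hi
      have hs := hK.st_succ _ (hK.tl_lt i hi)
      exact hK.blk_eq (hK.tl_lt i hi) le_rfl (by omega)
    have := prio_lt_lo hi hpr
    rw [hia, hb] at hbi
    rw [← hbi] at this
    rw [← hbi] at hia
    omega
  · rw [Function.update_of_ne, h.last v h0 hvl]
    intro hia
    have hbi : K.blk (K.st (v + 1) - 1) = v := by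
      have := hK.outDeg_pos' h0 hvl
      have hs := hK.st_succ _ hvl
      exact hK.blk_eq hvl (by omega) (by omega)
    rw [hia, hb] at hbi
    rw [hbi, hi_eq h0] at hlt
    omega
  · have h₁ := h.count e' he'
    have h₂ : {p ∈ Finset.range K.M | ¬ K.Vacant (Function.update ptr (K.tl e) (a + 1)) p ∧
        Function.update A a e p = e'} =
        if e = e' then insert a {p ∈ Finset.range K.M | ¬ K.Vacant ptr p ∧ A p = e'}
        else {p ∈ Finset.range K.M | ¬ K.Vacant ptr p ∧ A p = e'} := by
      ext p
      by_cases hpa : p = a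
      · subst hpa
        split_ifs with hee
        · simp only [← hee, hself, Finset.mem_filter, Finset.mem_range, haM, not_false_eq_true,
            Function.update_self, Finset.mem_insert, true_or, and_self]
        · simp [hee, hva]
      · have h₃ := hnv p
        simp only [hpa, or_false] at h₃
        split_ifs with hee <;> simp [hpa, h₃]
    rw [h₂]
    split_ifs with hee
    · subst hee
      rw [Function.update_self, Finset.card_insert_of_notMem (by simp [hva])]
      omega
    · rw [Function.update_of_ne (Ne.symm hee)]
      exact h₁

/-- Removing the last placed entry of a node. -/
theorem Partial.unplace (hK : K.Valid) {T A cnt ptr : ℕ → ℕ} (h : K.Partial T A cnt ptr)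
    {p v : ℕ} (hv : v < K.l) (hlo : K.lo v ≤ p) (hp : ptr v = p + 1) :
    K.Partial T A (Function.update cnt (A p) (cnt (A p) + 1)) (Function.update ptr v p) := by
  classical
  have hhi := h.le_hi v hv
  set ptr' := Function.update ptr v p with hptr'
  have hpp : ptr = Function.update ptr' v (ptr' v + 1) := by
    funext w
    by_cases hw : w = v
    · subst hw; simp [hptr', hp]
    · simp [hptr', hw]
  have hp' : ptr' v = p := by simp [hptr']
  have hvac := hK.vacant_update hv (ptr := ptr') (by omega) (by omega)
  rw [← hpp, hp'] at hvac
  have hb : K.blk p = v := hK.ptr_blk hv hlo (by omega)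
  have hpM : p < K.M := by have := hK.hi_le hv; omega
  have hself : ¬ K.Vacant ptr p := by
    rintro ⟨_, h₁, _⟩
    rw [hb] at h₁
    omega
  have hle : ∀ q, ¬ K.Vacant ptr' q → ¬ K.Vacant ptr q := fun q h₁ h₂ => h₁ ((hvac q).2 (.inl h₂))
  refine ⟨fun w hw => ?_, fun w hw => ?_, fun q hq h₁ => h.lt q hq (hle q h₁),
    fun q hq h₁ => h.tl q hq (hle q h₁), h.prio, h.last, fun e he => ?_⟩
  · by_cases hwv : w = v
    · subst hwv; omega
    · rw [hptr', Function.update_of_ne hwv]; exact h.lo_le w hw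
  · by_cases hwv : w = v
    · subst hwv; omega
    · rw [hptr', Function.update_of_ne hwv]; exact h.le_hi w hw
  · have h₁ := h.count e he
    have h₂ : {q ∈ Finset.range K.M | ¬ K.Vacant ptr q ∧ A q = e} =
        if A p = e then insert p {q ∈ Finset.range K.M | ¬ K.Vacant ptr' q ∧ A q = e}
        else {q ∈ Finset.range K.M | ¬ K.Vacant ptr' q ∧ A q = e} := by
      ext q
      by_cases hqp : q = p
      · subst hqp
        split_ifs with hee
        · simp [hself, hee, hpM]
        · simp [hee]
      · have h₃ := hvac q
        simp only [hqp, or_false] at h₃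
        split_ifs with hee <;> simp [hqp, h₃]
    rw [h₂] at h₁
    split_ifs at h₁ with hee
    · subst hee
      rw [Finset.card_insert_of_notMem (by simp [hvac])] at h₁
      rw [Function.update_self]
      omega
    · rw [Function.update_of_ne (Ne.symm hee)]
      exact h₁

/-- The copies yet to be placed are those that a full schedule has at the vacant positions. -/
theorem Partial.cnt_eq {T A cnt ptr : ℕ → ℕ} (h : K.Partial T A cnt ptr)
    (hA : K.Good T A) {e : ℕ} (he : e < K.m) :
    0 < cnt e ↔ ∃ p, K.Vacant ptr p ∧ A p = e := by
  classical
  have h₁ := h.count e he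
  have h₂ := hA.count e he
  have h₃ := Finset.card_filter_add_card_filter_not
    (s := {p ∈ Finset.range K.M | A p = e}) (K.Vacant ptr)
  rw [Finset.filter_filter, Finset.filter_filter, h₂] at h₃
  simp only [and_comm (a := A _ = e)] at h₃
  have h₄ : cnt e = {p ∈ Finset.range K.M | K.Vacant ptr p ∧ A p = e}.card := by omega
  rw [h₄, Finset.card_pos, Finset.filter_nonempty_iff]
  constructor
  · rintro ⟨p, _, hp⟩; exact ⟨p, hp⟩
  · rintro ⟨p, hp⟩; exact ⟨p, by simpa using hp.1.1, hp⟩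

/-- If two schedules first differ at `j`, then the entry of one at `j` occurs in the other at a
later position of the same node. -/
theorem Good.exchange (hK : K.Valid) {T f g : ℕ → ℕ} (hf : K.Good T f) (hg : K.Good T g) {j : ℕ}
    (hj : j < K.M) (hagree : ∀ p < j, f p = g p) (hne : f j ≠ g j) :
    K.Free j ∧ ∃ p, j < p ∧ K.Free p ∧ K.blk p = K.blk j ∧ f p = g j := by
  classical
  have hfix : ∀ p < K.M, ¬ K.Free p → f p = g p := fun p hp h =>
    (hf.partial hK).not_free_eq hK hg hp h
  refine ⟨by_contra fun h => hne (hfix j hj h), ?_⟩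
  by_contra hc
  push Not at hc
  have h₁ := hf.count (g j) (hg.lt j hj)
  have h₂ := hg.count (g j) (hg.lt j hj)
  -- Every occurrence of `g j` in `f` is one in `g`: before `j` by agreement, at fixed positions
  -- because they coincide, and at later free positions there is none by assumption. Since `g` has
  -- one more at `j`, the multiplicities would differ.
  have h₃ : {p ∈ Finset.range K.M | f p = g j} ⊂ {p ∈ Finset.range K.M | g p = g j} := by
    rw [Finset.ssubset_iff_of_subset]
    · exact ⟨j, by simp [hj], by simp [hne]⟩
    · intro p
      simp only [Finset.mem_filter, Finset.mem_range]
      rintro ⟨hp, hpj⟩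
      refine ⟨hp, ?_⟩
      rcases lt_trichotomy p j with h | rfl | h
      · rw [← hagree p h, hpj]
      · rfl
      · by_cases hfr : K.Free p
        · refine absurd hpj (hc p h hfr ?_)
          rw [← hf.tl p hp, ← hg.tl j hj, hpj]
        · rw [← hfix p hp hfr, hpj]
  have := Finset.card_lt_card h₃
  omega

theorem key_lt_key {f g : ℕ → ℕ} :
    K.key f < K.key g ↔ ∃ i < K.M, (∀ j < i, f j = g j) ∧ f i < g i := by
  constructor
  · rintro ⟨i, h₁, h₂⟩
    exact ⟨i, i.2, fun j hj => h₁ ⟨j, hj.trans i.2⟩ hj, h₂⟩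
  · rintro ⟨i, hi, h₁, h₂⟩
    exact ⟨⟨i, hi⟩, fun j hj => h₁ j hj, h₂⟩

theorem key_eq_key {f g : ℕ → ℕ} : K.key f = K.key g ↔ ∀ p < K.M, f p = g p := by
  constructor
  · intro h p hp
    exact congrFun (toLex.injective h) ⟨p, hp⟩
  · intro h
    exact congrArg toLex (funext fun p => h p p.2)

/-- If `g` were smaller, its entry at the first difference would, by `Good.exchange`, occur in `f`
at a later free position of the same node, after a greater one. -/
theorem Good.key_le_of_ascending (hK : K.Valid) {T f g : ℕ → ℕ} (hf : K.Good T f)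
    (hg : K.Good T g) {q : ℕ} (hagree : ∀ p < q, f p = g p)
    (hasc : ∀ p p', q ≤ p → p < p' → K.Free p → K.Free p' → K.blk p = K.blk p' → f p ≤ f p') :
    K.key f ≤ K.key g := by
  by_contra hc
  obtain ⟨j, hj, h₁, h₂⟩ := key_lt_key.1 (not_le.1 hc)
  obtain ⟨h₃, p, h₄, h₅, h₆, h₇⟩ := hf.exchange hK hg hj (fun p hp => (h₁ p hp).symm) (by omega)
  have hqj : q ≤ j := by
    by_contra hq
    rw [hagree j (by omega)] at h₂
    omega
  have := hasc j p hqj h₄ h₃ h₅ h₆.symm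
  omega

theorem Good.key_le_of_descending (hK : K.Valid) {T f g : ℕ → ℕ} (hf : K.Good T f)
    (hg : K.Good T g) {q : ℕ} (hagree : ∀ p < q, f p = g p)
    (hdesc : ∀ p p', q ≤ p → p < p' → K.Free p → K.Free p' → K.blk p = K.blk p' → f p' ≤ f p) :
    K.key g ≤ K.key f := by
  by_contra hc
  obtain ⟨j, hj, h₁, h₂⟩ := key_lt_key.1 (not_le.1 hc)
  obtain ⟨h₃, p, h₄, h₅, h₆, h₇⟩ := hf.exchange hK hg hj h₁ (by omega)
  have hqj : q ≤ j := by
    by_contra hq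
    rw [hagree j (by omega)] at h₂
    omega
  have := hdesc j p hqj h₄ h₃ h₅ h₆.symm
  omega

/-- This is why the successor is what it is. A greater `g` cannot first differ from `f` after `i`,
where `f` descends and is maximal. If it differs before `i`, it exceeds `f'` at the same place. If
it differs at `i`, its entry there is one that `f` has later at this node, hence at least `f' i`; in
case of equality the ascending rest of `f'` is minimal. -/
theorem Good.key_le_of_succ (hK : K.Valid) {T f f' g : ℕ → ℕ} (hf : K.Good T f)
    (hf' : K.Good T f') (hg : K.Good T g) {i : ℕ} (hi : i < K.M)
    (hagree : ∀ p < i, f p = f' p) (hlt : f i < f' i)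
    (hmin : ∀ p, i < p → K.Free p → K.blk p = K.blk i → f i < f p → f' i ≤ f p)
    (hdesc : ∀ p p', i + 1 ≤ p → p < p' → K.Free p → K.Free p' → K.blk p = K.blk p' → f p' ≤ f p)
    (hasc : ∀ p p', i + 1 ≤ p → p < p' → K.Free p → K.Free p' → K.blk p = K.blk p' →
      f' p ≤ f' p')
    (hfg : K.key f < K.key g) : K.key f' ≤ K.key g := by
  obtain ⟨j, hj, h₁, h₂⟩ := key_lt_key.1 hfg
  rcases lt_trichotomy j i with h | rfl | h
  · refine le_of_lt (key_lt_key.2 ⟨j, hj, fun p hp => ?_, ?_⟩)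
    · rw [← hagree p (by omega), h₁ p hp]
    · rwa [← hagree j h]
  · obtain ⟨_, p, h₄, h₅, h₆, h₇⟩ := hf.exchange hK hg hj h₁ (by omega)
    have h₈ := hmin p h₄ h₅ h₆ (by omega)
    rcases h₈.lt_or_eq with h₉ | h₉
    · refine le_of_lt (key_lt_key.2 ⟨j, hj, fun p hp => ?_, by omega⟩)
      rw [← hagree p hp, h₁ p hp]
    · refine hf'.key_le_of_ascending hK hg (q := j + 1) (fun p hp => ?_) hasc
      rcases Nat.lt_succ_iff_lt_or_eq.1 hp with hp | rfl
      · rw [← hagree p hp, h₁ p hp]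
      · omega
  · exfalso
    have := hf.key_le_of_descending hK hg (q := i + 1) (fun p hp => h₁ p (by omega)) hdesc
    exact absurd hfg (not_lt.2 this)

theorem finite_good_keys (T : ℕ → ℕ) : {κ | ∃ f, K.Good T f ∧ κ = K.key f}.Finite := by
  have : (Set.univ.pi fun _ : Fin K.M => Set.Iio K.m).Finite :=
    Set.Finite.pi fun _ => Set.finite_Iio _
  refine (this.image toLex).subset ?_
  rintro κ ⟨f, hf, rfl⟩
  exact ⟨_, fun p _ => hf.lt p p.2, rfl⟩

end Core

/-! ## Enumeration of the trees -/

namespace Core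

variable {K : Core}

/-- The starting point of the filling. Since a tree avoids compulsory edges, no edge is fixed both
as a first and as a last exit, and the fixed positions hold at most one copy of each edge. -/
theorem Arb.partial_init (hK : K.Valid) {T A cnt ptr : ℕ → ℕ} (hT : K.Arb T)
    (hprio : ∀ i < K.m, K.pr i ≠ 0 → A (K.st (K.tl i)) = i)
    (hlast : ∀ v, 0 < v → v < K.l → A (K.st (v + 1) - 1) = T v)
    (hcnt : ∀ e < K.m, cnt e + (if K.pr e ≠ 0 then 1 else 0) +
      (if K.tl e ≠ 0 ∧ T (K.tl e) = e then 1 else 0) = K.mu e)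
    (hptr : ∀ v < K.l, ptr v = K.lo v) : K.Partial T A cnt ptr := by
  classical
  have hvac : ∀ p, ¬ K.Vacant ptr p ↔ ¬ K.Free p := fun p => not_congr (hK.vacant_congr hptr p)
  have hbi : ∀ i < K.m, K.blk (K.st (K.tl i)) = K.tl i ∧ K.st (K.tl i) < K.M := fun i hi => by
    have h₁ := hK.outDeg_pos hi
    have hs := hK.st_succ _ (hK.tl_lt i hi)
    have := hK.st_add_outDeg_le (hK.tl_lt i hi)
    exact ⟨hK.blk_eq (hK.tl_lt i hi) le_rfl (by omega), by omega⟩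
  have hbl : ∀ v, 0 < v → v < K.l → K.blk (K.st (v + 1) - 1) = v ∧ K.st (v + 1) - 1 < K.M :=
    fun v h0 hv => by
      have := hK.outDeg_pos' h0 hv
      have hs := hK.st_succ _ hv
      have := hK.st_add_outDeg_le hv
      exact ⟨hK.blk_eq hv (by omega) (by omega), by omega⟩
  have hval : ∀ p < K.M, ¬ K.Free p → A p < K.m ∧ K.tl (A p) = K.blk p := by
    intro p hp h
    rcases hK.not_free hp h with ⟨i, hi, hpr, rfl⟩ | ⟨h₁, h₂⟩
    · rw [hprio i hi hpr]
      exact ⟨hi, (hbi i hi).1.symm⟩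
    · have h₃ := (hK.blk_spec hp).1
      have h₄ := hlast _ h₁ h₃
      rw [← h₂, Nat.add_sub_cancel] at h₄
      rw [h₄]
      exact ⟨hT.lt _ h₁ h₃, hT.tl _ h₁ h₃⟩
  refine ⟨fun v hv => (hptr v hv).ge, fun v hv => hptr v hv ▸ hK.lo_le_hi hv,
    fun p hp h => (hval p hp ((hvac p).1 h)).1, fun p hp h => (hval p hp ((hvac p).1 h)).2,
    hprio, hlast, fun e he => ?_⟩
  have h₁ := hcnt e he
  have hnf : ∀ p, p < K.M → ¬ K.Free p → A p = e →
      (K.pr e ≠ 0 ∧ p = K.st (K.tl e)) ∨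
      (K.tl e ≠ 0 ∧ T (K.tl e) = e ∧ p = K.st (K.tl e + 1) - 1) := by
    intro p hp h hpe
    have hb := (hval p hp h).2
    rcases hK.not_free hp h with ⟨i, hi, hpr, rfl⟩ | ⟨h₃, h₄⟩
    · rw [hprio i hi hpr] at hpe
      subst hpe
      exact .inl ⟨hpr, rfl⟩
    · have h₅ := hlast _ h₃ (hK.blk_spec hp).1
      rw [← h₄, Nat.add_sub_cancel, hpe] at h₅
      rw [hpe] at hb
      rw [← hb] at h₃ h₄ h₅
      exact .inr ⟨by omega, h₅.symm, by omega⟩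
  have hfree_prio : K.pr e ≠ 0 → ¬ K.Free (K.st (K.tl e)) := fun hpr h => by
    obtain ⟨_, h₂, _⟩ := h
    rw [(hbi e he).1] at h₂
    have := prio_lt_lo he hpr
    omega
  have hfree_last : K.tl e ≠ 0 → ¬ K.Free (K.st (K.tl e + 1) - 1) := fun h0 h => by
    obtain ⟨_, _, h₂⟩ := h
    rw [(hbl _ (by omega) (hK.tl_lt e he)).1, hi_eq (by omega)] at h₂
    omega
  have hexcl : K.pr e ≠ 0 → ¬ (K.tl e ≠ 0 ∧ T (K.tl e) = e) := fun hpr h => by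
    have := hT.pr (K.tl e) (by omega) (hK.tl_lt e he)
    rw [h.2] at this
    exact hpr this
  have hcard : {p ∈ Finset.range K.M | ¬ K.Vacant ptr p ∧ A p = e} =
      {p ∈ Finset.range K.M | ¬ K.Free p ∧ A p = e} :=
    Finset.filter_congr fun p _ => and_congr_left fun _ => hvac p
  rw [hcard]
  by_cases hpr : K.pr e ≠ 0
  · rw [if_pos hpr, if_neg (hexcl hpr)] at h₁
    rw [show {p ∈ Finset.range K.M | ¬ K.Free p ∧ A p = e} = {K.st (K.tl e)} by
      ext p
      simp only [Finset.mem_filter, Finset.mem_range, Finset.mem_singleton]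
      constructor
      · rintro ⟨hp, h₂, h₃⟩
        rcases hnf p hp h₂ h₃ with h | h
        · exact h.2
        · exact absurd ⟨h.1, h.2.1⟩ (hexcl hpr)
      · rintro rfl
        exact ⟨(hbi e he).2, hfree_prio hpr, hprio e he hpr⟩]
    simpa using h₁
  · rw [if_neg hpr] at h₁
    by_cases hl : K.tl e ≠ 0 ∧ T (K.tl e) = e
    · rw [if_pos hl] at h₁
      have h0 : 0 < K.tl e := by omega
      rw [show {p ∈ Finset.range K.M | ¬ K.Free p ∧ A p = e} = {K.st (K.tl e + 1) - 1} by
        ext p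
        simp only [Finset.mem_filter, Finset.mem_range, Finset.mem_singleton]
        constructor
        · rintro ⟨hp, h₂, h₃⟩
          rcases hnf p hp h₂ h₃ with h | h
          · exact absurd h.1 hpr
          · exact h.2.2
        · rintro rfl
          exact ⟨(hbl _ h0 (hK.tl_lt e he)).2, hfree_last hl.1,
            (hlast _ h0 (hK.tl_lt e he)).trans hl.2⟩]
      simpa using h₁
    · rw [if_neg hl] at h₁
      rw [show {p ∈ Finset.range K.M | ¬ K.Free p ∧ A p = e} = ∅ by
        refine Finset.filter_eq_empty_iff.2 fun p hp h => ?_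
        rcases hnf p (by simpa using hp) h.1 h.2 with h' | h'
        · exact hpr h'.1
        · exact hl ⟨h'.1, h'.2.1⟩]
      simpa using h₁

/-- The solutions whose last exits are those of `T`. -/
def solsOf (K : Core) (T : ℕ → ℕ) : Set (List ℕ) :=
  {q | K.IsSol q ∧ ∀ u, 0 < u → u < K.l → K.lst q u = T u}

/-- The solutions whose last exits differ from `T` only below `d`, and the last exit of the
greatest node where they differ is not before `i`. -/
def solsFrom (K : Core) (T : ℕ → ℕ) (d i : ℕ) : Set (List ℕ) :=
  {q | K.IsSol q ∧ ∃ v, 0 < v ∧ v < d ∧ (∀ u, v < u → u < K.l → K.lst q u = T u) ∧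
    K.lst q v ≠ T v ∧ i ≤ K.lst q v}

/-- The tree `T` agrees with `t0` below `d`. -/
structure Stage (K : Core) (T : ℕ → ℕ) (d : ℕ) : Prop where
  arb : K.Arb T
  below : ∀ u, 0 < u → u < d → T u = K.t0 u
  pos : 0 < d
  le : d ≤ K.l
  ne : d < K.l → T d ≠ K.t0 d

/-- The edge `i` can replace the edge of `T` at its tail, which is below `d`. -/
structure IsChild (K : Core) (T : ℕ → ℕ) (d i : ℕ) : Prop where
  lt : i < K.m
  pr : K.pr i = 0
  pos : 0 < K.tl i
  tl : K.tl i < d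
  ne : i ≠ K.t0 (K.tl i)
  chain : ¬ K.OnChain T (K.tl i) (K.hd i)

/-- The edges of `t0` lead to smaller nodes, so a path that starts below `d` uses no other edges. -/
theorem Valid.reaches_of_below (hK : K.Valid) {T : ℕ → ℕ} {d : ℕ} (hd : d ≤ K.l)
    (h : ∀ u, 0 < u → u < d → T u = K.t0 u) : ∀ w < d, K.Reaches T w := by
  intro w
  induction w using Nat.strong_induction_on with
  | _ w ih =>
    intro hw
    rcases Nat.eq_zero_or_pos w with rfl | h0
    · exact .root
    · have := hK.t0_hd w h0 (by omega)
      exact .step w (by omega) (by rw [h w h0 hw]; exact ih _ this (by omega))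

theorem Valid.arb_t0 (hK : K.Valid) : K.Arb K.t0 :=
  ⟨hK.t0_lt, hK.t0_tl, hK.t0_pr, hK.reaches_of_below le_rfl fun _ _ _ => rfl⟩

theorem Valid.stage_t0 (hK : K.Valid) : K.Stage K.t0 K.l :=
  ⟨hK.arb_t0, fun _ _ _ => rfl, hK.l_pos, le_rfl, fun h => absurd h (lt_irrefl _)⟩

theorem Reaches.update {T : ℕ → ℕ} {w : ℕ} (h : K.Reaches T w) {v i : ℕ} (hv : v ≠ 0)
    (hi : K.Reaches (Function.update T v i) (K.hd i)) : K.Reaches (Function.update T v i) w := by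
  induction h with
  | root => exact .root
  | step w h0 _ ih =>
    by_cases hw : w = v
    · subst hw
      exact .step w h0 (by rwa [Function.update_self])
    · exact .step w h0 (by rwa [Function.update_of_ne hw])

theorem Reaches.update_of_not_onChain {T : ℕ → ℕ} {w : ℕ} (h : K.Reaches T w) {v i : ℕ}
    (hw : ¬ K.OnChain T v w) : K.Reaches (Function.update T v i) w := by
  induction h with
  | root => exact .root
  | step w h0 _ ih =>
    have hne : w ≠ v := by rintro rfl; exact hw .refl
    exact .step w h0 (by
      rw [Function.update_of_ne hne]
      exact ih fun h => hw (.step w h0 h))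

/-- The path from the head of `i` avoids the tail of `i` and survives the exchange. Any other path
either survives too or comes to the tail of `i` and continues through `i`. -/
theorem IsChild.stage {T : ℕ → ℕ} {d i : ℕ} (hT : K.Stage T d) (hi : K.IsChild T d i)
    (hK : K.Valid) : K.Stage (Function.update T (K.tl i) i) (K.tl i) := by
  refine ⟨⟨fun v h0 hv => ?_, fun v h0 hv => ?_, fun v h0 hv => ?_, fun v hv => ?_⟩,
    fun u h0 hu => ?_, hi.pos, (hK.tl_lt i hi.lt).le, fun _ => ?_⟩
  · by_cases h : v = K.tl i
    · subst h; rw [Function.update_self]; exact hi.lt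
    · rw [Function.update_of_ne h]; exact hT.arb.lt v h0 hv
  · by_cases h : v = K.tl i
    · subst h; rw [Function.update_self]
    · rw [Function.update_of_ne h]; exact hT.arb.tl v h0 hv
  · by_cases h : v = K.tl i
    · subst h; rw [Function.update_self]; exact hi.pr
    · rw [Function.update_of_ne h]; exact hT.arb.pr v h0 hv
  · exact (hT.arb.reaches v hv).update hi.pos.ne'
      ((hT.arb.reaches _ (hK.hd_lt i hi.lt)).update_of_not_onChain hi.chain)
  · rw [Function.update_of_ne hu.ne]
    exact hT.below u h0 (hu.trans hi.tl)
  · rw [Function.update_self]; exact hi.ne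

theorem OnChain.update {T : ℕ → ℕ} {v w i : ℕ} (h : K.OnChain T v w) :
    K.OnChain (Function.update T v i) v w := by
  induction h with
  | refl => exact .refl
  | step w h0 _ ih =>
    by_cases hw : w = v
    · subst hw; exact .refl
    · exact .step w h0 (by rwa [Function.update_of_ne hw])

/-- A path that meets `v` would run round the cycle through `v` and never arrive at the root. -/
theorem Reaches.not_onChain {T : ℕ → ℕ} {v w : ℕ} (h : K.Reaches T w) (hv : v ≠ 0)
    (hcyc : K.OnChain T v (K.hd (T v))) : ¬ K.OnChain T v w := by
  induction h with
  | root =>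
    intro h
    cases h with
    | refl => exact hv rfl
    | step _ h0 _ => exact h0 rfl
  | step w h0 _ ih =>
    intro h
    cases h with
    | refl => exact ih hcyc
    | step _ _ h => exact ih h

/-- The reason why the hierarchy misses no solution: at the greatest node where its tree departs
from `T`, the solution uses an edge that may be exchanged into `T` right away, whatever it does at
smaller nodes. -/
theorem IsSol.isChild (hK : K.Valid) {T : ℕ → ℕ} {d v : ℕ} {q : List ℕ} (hq : K.IsSol q)
    (hT : K.Stage T d) (h0 : 0 < v) (hv : v < d)
    (hagree : ∀ u, v < u → u < K.l → K.lst q u = T u) (hne : K.lst q v ≠ T v) :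
    K.IsChild T d (K.lst q v) ∧ K.tl (K.lst q v) = v := by
  have hA := hq.arb hK
  have hvl : v < K.l := hv.trans_le hT.le
  have htl := hA.tl v h0 hvl
  refine ⟨⟨hA.lt v h0 hvl, hA.pr v h0 hvl, by rwa [htl], by rwa [htl], ?_, ?_⟩, htl⟩
  · rw [htl, ← hT.below v h0 hv]; exact hne
  · rw [htl]
    intro hch
    -- From `v` on this is the tree of `q`, and below `v` it is `t0`. Both parts lead to the root,
    -- so there is no cycle through `v`.
    set T' := Function.update T v (K.lst q v) with hT'
    have hlow : ∀ w < v, K.Reaches T' w := hK.reaches_of_below hvl.le fun u hu huv => by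
      rw [hT', Function.update_of_ne huv.ne]
      exact hT.below u hu (huv.trans hv)
    have hreach : ∀ w, K.Reaches (K.lst q) w → w < K.l → K.Reaches T' w := by
      intro w hw
      induction hw with
      | root => exact fun _ => .root
      | step w hw0 _ ih =>
        intro hwl
        by_cases hwv : w < v
        · exact hlow w hwv
        · refine .step w hw0 ?_
          have : T' w = K.lst q w := by
            by_cases h : w = v
            · subst h; rw [hT', Function.update_self]
            · rw [hT', Function.update_of_ne h, hagree w (by omega) hwl]
          rw [this]
          exact ih (hK.hd_lt _ (hA.lt w (Nat.pos_of_ne_zero hw0) hwl))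
    refine (hreach v (hA.reaches v hvl) hvl).not_onChain h0.ne' ?_ .refl
    rw [hT', Function.update_self]
    exact hch.update

theorem solsFrom_eq_empty (hK : K.Valid) {T : ℕ → ℕ} {d i : ℕ} (hT : K.Stage T d)
    (h : ∀ j, i ≤ j → ¬ K.IsChild T d j) : K.solsFrom T d i = ∅ := by
  refine Set.eq_empty_of_forall_notMem ?_
  rintro q ⟨hq, v, h0, hv, hagree, hne, hi⟩
  exact h _ hi (hq.isChild hK hT h0 hv hagree hne).1

theorem exists_greatest_ne (K : Core) {q : List ℕ} {T : ℕ → ℕ}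
    (h : ∃ u, 0 < u ∧ u < K.l ∧ K.lst q u ≠ T u) :
    ∃ v, 0 < v ∧ v < K.l ∧ K.lst q v ≠ T v ∧ ∀ u, v < u → u < K.l → K.lst q u = T u := by
  obtain ⟨u, h0, hu, hne⟩ := h
  let P : ℕ → Prop := fun u => u < K.l ∧ K.lst q u ≠ T u
  have hP : P (Nat.findGreatest P K.l) := Nat.findGreatest_spec (m := u) hu.le ⟨hu, hne⟩
  have hle : u ≤ Nat.findGreatest P K.l := Nat.le_findGreatest hu.le ⟨hu, hne⟩
  refine ⟨_, by omega, hP.1, hP.2, fun w hw hwl => ?_⟩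
  by_contra hc
  exact Nat.findGreatest_is_greatest hw hwl.le ⟨hwl, hc⟩

theorem isSol_iff (K : Core) (q : List ℕ) :
    K.IsSol q ↔ q ∈ K.solsOf K.t0 ∨ q ∈ K.solsFrom K.t0 K.l 0 := by
  constructor
  · intro hq
    by_cases h : ∃ u, 0 < u ∧ u < K.l ∧ K.lst q u ≠ K.t0 u
    · obtain ⟨v, h0, hv, hne, hagree⟩ := K.exists_greatest_ne h
      exact .inr ⟨hq, v, h0, hv, hagree, hne, Nat.zero_le _⟩
    · push Not at h
      exact .inl ⟨hq, h⟩
  · rintro (h | h) <;> exact h.1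

theorem not_mem_solsFrom_of_mem_solsOf {T : ℕ → ℕ} {d i : ℕ} (hd : d ≤ K.l) {q : List ℕ}
    (h : q ∈ K.solsOf T) : q ∉ K.solsFrom T d i := by
  rintro ⟨_, v, h0, hv, _, hne, _⟩
  exact hne (h.2 v h0 (by omega))

/-- The solutions that come from the first possible replacement `j`, and the others. -/
theorem mem_solsFrom_iff (hK : K.Valid) {T : ℕ → ℕ} {d i j : ℕ} (hT : K.Stage T d)
    (hj : K.IsChild T d j) (hij : i ≤ j) (hmin : ∀ k, i ≤ k → k < j → ¬ K.IsChild T d k)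
    (q : List ℕ) :
    q ∈ K.solsFrom T d i ↔ q ∈ K.solsOf (Function.update T (K.tl j) j) ∨
      q ∈ K.solsFrom (Function.update T (K.tl j) j) (K.tl j) 0 ∨ q ∈ K.solsFrom T d (j + 1) := by
  have hjl := hK.tl_lt j hj.lt
  have hjT : j ≠ T (K.tl j) := by rw [hT.below _ hj.pos hj.tl]; exact hj.ne
  constructor
  · rintro ⟨hq, v, h0, hv, hagree, hne, hi⟩
    obtain ⟨hc, htl⟩ := hq.isChild hK hT h0 hv hagree hne
    rcases lt_trichotomy (K.lst q v) j with h | h | h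
    · exact absurd hc (hmin _ hi h)
    · rw [h] at htl
      have hge : ∀ u, v ≤ u → u < K.l → K.lst q u = Function.update T (K.tl j) j u := by
        intro u hu hul
        rw [htl]
        rcases hu.eq_or_lt with rfl | hu
        · rw [Function.update_self, h]
        · rw [Function.update_of_ne hu.ne', hagree u hu hul]
      by_cases hex : ∃ u, 0 < u ∧ u < K.l ∧ K.lst q u ≠ Function.update T (K.tl j) j u
      · obtain ⟨w, hw0, hw, hwne, hwagree⟩ := K.exists_greatest_ne hex
        refine .inr (.inl ⟨hq, w, hw0, ?_, hwagree, hwne, Nat.zero_le _⟩)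
        by_contra hcon
        exact hwne (hge w (by omega) hw)
      · push Not at hex
        exact .inl ⟨hq, hex⟩
    · exact .inr (.inr ⟨hq, v, h0, hv, hagree, hne, h⟩)
  · have hup : ∀ u, K.tl j < u → Function.update T (K.tl j) j u = T u := fun u hu =>
      Function.update_of_ne hu.ne' ..
    rintro (⟨hq, h⟩ | ⟨hq, v, h0, hv, hagree, hne, -⟩ | ⟨hq, v, h0, hv, hagree, hne, hi⟩)
    · have h₁ : K.lst q (K.tl j) = j := by rw [h _ hj.pos hjl, Function.update_self]
      exact ⟨hq, K.tl j, hj.pos, hj.tl, fun u hu hul => by rw [h u (by omega) hul, hup u hu],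
        by rwa [h₁], by rwa [h₁]⟩
    · have h₁ : K.lst q (K.tl j) = j := by rw [hagree _ hv hjl, Function.update_self]
      exact ⟨hq, K.tl j, hj.pos, hj.tl,
        fun u hu hul => by rw [hagree u (by omega) hul, hup u hu], by rwa [h₁], by rwa [h₁]⟩
    · exact ⟨hq, v, h0, hv, hagree, hne, by omega⟩

/-- Such a solution leaves the tail of `j` last by `j` itself and agrees with `T` at greater nodes.
So its greatest difference from `T` has the value `j`, which is less than `j + 1`. -/
theorem not_mem_solsFrom_succ (hK : K.Valid) {T : ℕ → ℕ} {d j : ℕ} (hT : K.Stage T d)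
    (hj : K.IsChild T d j) {q : List ℕ}
    (hq : q ∈ K.solsOf (Function.update T (K.tl j) j) ∨
      q ∈ K.solsFrom (Function.update T (K.tl j) j) (K.tl j) 0) :
    q ∉ K.solsFrom T d (j + 1) := by
  have hjl := hK.tl_lt j hj.lt
  have hjT : j ≠ T (K.tl j) := by rw [hT.below _ hj.pos hj.tl]; exact hj.ne
  have hge : ∀ u, K.tl j ≤ u → u < K.l → K.lst q u = Function.update T (K.tl j) j u := by
    rcases hq with ⟨_, h⟩ | ⟨_, v, h0, hv, hagree, hne, -⟩
    · exact fun u hu hul => h u (by have := hj.pos; omega) hul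
    · exact fun u hu hul => hagree u (by omega) hul
  have hself := hge _ le_rfl hjl
  rw [Function.update_self] at hself
  rintro ⟨_, w, hw0, hw, hwagree, hwne, hwi⟩
  have hwl : w < K.l := hw.trans_le hT.le
  rcases lt_trichotomy w (K.tl j) with h | rfl | h
  · exact hjT (hself.symm.trans (hwagree _ h hjl))
  · omega
  · exact hwne (by rw [hge w h.le hwl, Function.update_of_ne h.ne'])

/-- The first node below `d` on the path of `T` from `w` to the root is `y`. -/
inductive Entry (K : Core) (T : ℕ → ℕ) (d : ℕ) : ℕ → ℕ → Prop
  | base (w : ℕ) : w < d → Entry K T d w w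
  | step (w y : ℕ) : d ≤ w → Entry K T d (K.hd (T w)) y → Entry K T d w y

theorem Entry.lt {T : ℕ → ℕ} {d w y : ℕ} (h : K.Entry T d w y) : y < d := by
  induction h with
  | base w h => exact h
  | step _ _ _ _ ih => exact ih

theorem onChain_congr_below (hK : K.Valid) {T : ℕ → ℕ} {d : ℕ} (hT : K.Stage T d) (v : ℕ) :
    ∀ w < d, K.OnChain T v w ↔ K.OnChain K.t0 v w := by
  intro w
  induction w using Nat.strong_induction_on with
  | _ w ih =>
    intro hw
    rcases Nat.eq_zero_or_pos w with rfl | h0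
    · constructor
      · intro h
        cases h with
        | refl => exact .refl
        | step _ h _ => exact absurd rfl h
      · intro h
        cases h with
        | refl => exact .refl
        | step _ h _ => exact absurd rfl h
    · have hlt := hK.t0_hd w h0 (hw.trans_le hT.le)
      have := ih _ hlt (hlt.trans hw)
      constructor
      · intro h
        cases h with
        | refl => exact .refl
        | step _ _ h =>
          rw [hT.below w h0 hw, this] at h
          exact .step w h0.ne' h
      · intro h
        cases h with
        | refl => exact .refl
        | step _ _ h =>
          rw [← this, ← hT.below w h0 hw] at h
          exact .step w h0.ne' h

/-- From `d` on the path cannot meet `v`, so only its entry `y` counts. Below `d` the tree is `t0`,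
whose subtrees are intervals. Thus a possible cycle is detected in constant time per edge. -/
theorem Entry.onChain_iff (hK : K.Valid) {T : ℕ → ℕ} {d w y : ℕ} (hT : K.Stage T d)
    (h : K.Entry T d w y) {v : ℕ} (hv : v < d) : K.OnChain T v w ↔ v ≤ y ∧ y < K.en v := by
  rw [← hK.en_spec v (hv.trans_le hT.le) y (h.lt.trans_le hT.le)]
  induction h with
  | base w hw => exact onChain_congr_below hK hT v w hw
  | step w y hw _ ih =>
    rw [← ih]
    constructor
    · intro h
      cases h with
      | refl => omega
      | step _ _ h => exact h
    · exact fun h => .step w (by omega) h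

end Core

/-! ## The programs that enumerate the schedules of a tree -/

namespace Core

variable {K : Core}

/-- The filling level of the node `v` if all positions before `q` are filled. -/
def level (K : Core) (q v : ℕ) : ℕ := max (K.lo v) (min (K.hi v) q)

theorem Valid.vacant_level (hK : K.Valid) (q p : ℕ) :
    K.Vacant (K.level q) p ↔ K.Free p ∧ q ≤ p := by
  unfold Free Vacant level
  constructor
  · rintro ⟨h₁, h₂, h₃⟩
    have := hK.lo_le_hi (hK.blk_spec h₁).1
    exact ⟨⟨h₁, by omega, h₃⟩, by omega⟩
  · rintro ⟨⟨h₁, h₂, h₃⟩, h₄⟩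
    exact ⟨h₁, by omega, h₃⟩

theorem Valid.level_succ (hK : K.Valid) {p v : ℕ} (hv : v < K.l)
    (h : ¬ (K.Free p ∧ v = K.blk p)) : K.level (p + 1) v = K.level p v := by
  have h₁ := hK.lo_le_hi hv
  have h₂ := hK.hi_le hv
  have h₃ : ¬ (K.lo v ≤ p ∧ p < K.hi v) := fun ⟨h₃, h₄⟩ => by
    have hb := hK.ptr_blk hv h₃ h₄
    exact h ⟨⟨by omega, by rwa [hb], by rwa [hb]⟩, hb.symm⟩
  unfold level
  omega

theorem Free.level_self {p : ℕ} (h : K.Free p) : K.level p (K.blk p) = p := by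
  obtain ⟨_, h₂, h₃⟩ := h
  unfold level
  omega

theorem Free.level_succ_self {p : ℕ} (h : K.Free p) : K.level (p + 1) (K.blk p) = p + 1 := by
  obtain ⟨_, h₂, h₃⟩ := h
  unfold level
  omega

theorem Valid.level_M (hK : K.Valid) {v : ℕ} (hv : v < K.l) : K.level K.M v = K.hi v := by
  have h₁ := hK.lo_le_hi hv
  have h₂ := hK.hi_le hv
  unfold level
  omega

theorem Valid.sum_mu (hK : K.Valid) : ∑ i ∈ Finset.range K.m, K.mu i = K.M := by
  have key : ∀ v ≤ K.l, ∑ i ∈ Finset.range K.m with K.tl i < v, K.mu i = K.st v := by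
    intro v
    induction v with
    | zero => simp [hK.st_zero]
    | succ v ih =>
      intro hv
      rw [hK.st_succ v hv, ← ih (by omega), outDeg, ← Finset.sum_union]
      · refine Finset.sum_congr ?_ fun _ _ => rfl
        ext i
        simp only [Finset.mem_filter, Finset.mem_union, Finset.mem_range]
        omega
      · rw [Finset.disjoint_left]
        intro i
        simp only [Finset.mem_filter, Finset.mem_range]
        omega
  rw [← hK.st_last, ← key K.l le_rfl]
  refine (Finset.sum_congr ?_ fun _ _ => rfl)
  ext i
  simp only [Finset.mem_filter, Finset.mem_range]
  exact ⟨fun h => ⟨h, hK.tl_lt i h⟩, fun h => h.1⟩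

theorem Valid.m_le (hK : K.Valid) : K.m ≤ K.M := by
  rw [← hK.sum_mu]
  calc K.m = ∑ i ∈ Finset.range K.m, 1 := by simp
    _ ≤ _ := Finset.sum_le_sum fun i hi => hK.mu_pos i (by simpa using hi)

theorem Partial.sum_cnt_le (hK : K.Valid) {T A cnt ptr : ℕ → ℕ} (h : K.Partial T A cnt ptr) :
    ∑ e ∈ Finset.range K.m, cnt e ≤ K.M := by
  rw [← hK.sum_mu]
  refine Finset.sum_le_sum fun e he => ?_
  have := h.count e (by simpa using he)
  omega

/-- The state of the filling of the positions that are vacant for `ptr₀`, when only edges up to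
`j` have been placed, in ascending order. -/
structure Filling (K : Core) (ptr₀ A₀ : ℕ → ℕ) (j : ℕ) (A ptr : ℕ → ℕ) : Prop where
  agree : ∀ p < K.M, ¬ K.Vacant ptr₀ p → A p = A₀ p
  mono : ∀ v < K.l, ptr₀ v ≤ ptr v
  le : ∀ p, K.Vacant ptr₀ p → ¬ K.Vacant ptr p → A p ≤ j
  asc : ∀ p p', p < p' → K.Vacant ptr₀ p → K.Vacant ptr₀ p' → ¬ K.Vacant ptr p →
    ¬ K.Vacant ptr p' → K.blk p = K.blk p' → A p ≤ A p'

theorem Filling.refl {ptr A : ℕ → ℕ} : K.Filling ptr A 0 A ptr :=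
  ⟨fun _ _ _ => rfl, fun _ _ => le_rfl, fun _ h h' => absurd h h',
    fun _ _ _ h _ h' => absurd h h'⟩

theorem Filling.succ {ptr₀ A₀ A ptr : ℕ → ℕ} {j : ℕ} (h : K.Filling ptr₀ A₀ j A ptr) :
    K.Filling ptr₀ A₀ (j + 1) A ptr :=
  ⟨h.agree, h.mono, fun p h₁ h₂ => (h.le p h₁ h₂).trans (Nat.le_succ j), h.asc⟩

theorem Filling.place (hK : K.Valid) {ptr₀ A₀ A ptr : ℕ → ℕ} {j : ℕ}
    (h : K.Filling ptr₀ A₀ j A ptr) (hj : j < K.m) (hlo : K.lo (K.tl j) ≤ ptr (K.tl j))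
    (hhi : ptr (K.tl j) < K.hi (K.tl j)) :
    K.Filling ptr₀ A₀ j (Function.update A (ptr (K.tl j)) j)
      (Function.update ptr (K.tl j) (ptr (K.tl j) + 1)) := by
  have hv := hK.tl_lt j hj
  have hvac := hK.vacant_update hv hlo hhi
  have hb := hK.ptr_blk hv hlo hhi
  have hM := hK.hi_le hv
  have hm := h.mono _ hv
  set a := ptr (K.tl j) with ha
  have hva : K.Vacant ptr₀ a := ⟨by omega, by rw [hb]; exact hm, by rw [hb]; exact hhi⟩
  have hnv : ∀ p, p ≠ a → ¬ K.Vacant (Function.update ptr (K.tl j) (a + 1)) p →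
      ¬ K.Vacant ptr p := fun p hp h₁ h₂ => by
    rcases (hvac p).1 h₂ with h₃ | h₃
    · exact h₁ h₃
    · exact hp h₃
  refine ⟨fun p hp h₁ => ?_, fun v hvl => ?_, fun p h₁ h₂ => ?_, fun p p' hpp h₁ h₁' h₂ h₂' he => ?_⟩
  · rw [Function.update_of_ne (by rintro rfl; exact h₁ hva), h.agree p hp h₁]
  · by_cases hvj : v = K.tl j
    · subst hvj; rw [Function.update_self]; omega
    · rw [Function.update_of_ne hvj]; exact h.mono v hvl
  · by_cases hp : p = a
    · subst hp; rw [Function.update_self]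
    · rw [Function.update_of_ne hp]; exact h.le p h₁ (hnv p hp h₂)
  · by_cases hp : p = a
    · exfalso
      refine h₂' ⟨h₁'.1, ?_, h₁'.2.2⟩
      rw [← he, hp, hb, Function.update_self]
      omega
    · rw [Function.update_of_ne hp]
      by_cases hp' : p' = a
      · subst hp'; rw [Function.update_self]; exact h.le p h₁ (hnv p hp h₂)
      · rw [Function.update_of_ne hp']
        exact h.asc p p' hpp h₁ h₁' (hnv p hp h₂) (hnv p' hp' h₂') he

end Core

/-! ### Scalar variables and arrays -/

notation "rN" => (100 : ℕ)
notation "rRoot" => (101 : ℕ)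
notation "rEdges" => (102 : ℕ)
notation "rTotal" => (103 : ℕ)
notation "rNodes" => (104 : ℕ)
notation "rI" => (105 : ℕ)
notation "rD" => (106 : ℕ)
notation "rRun" => (107 : ℕ)
notation "rJ" => (108 : ℕ)
notation "rE" => (109 : ℕ)
notation "rU" => (110 : ℕ)
notation "rV" => (111 : ℕ)
notation "rC" => (112 : ℕ)
notation "rP" => (113 : ℕ)
notation "rMore" => (114 : ℕ)
notation "rGo" => (115 : ℕ)
notation "rOk" => (116 : ℕ)
notation "aTail" => (201 : ℕ)
notation "aHead" => (202 : ℕ)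
notation "aMult" => (203 : ℕ)
notation "aFlag" => (204 : ℕ)
notation "aOut" => (205 : ℕ)
notation "aIn" => (206 : ℕ)
notation "aFst" => (207 : ℕ)
notation "aNxt" => (208 : ℕ)
notation "aStk" => (209 : ℕ)
notation "aDisc" => (210 : ℕ)
notation "aRank" => (211 : ℕ)
notation "aTe" => (212 : ℕ)
notation "aNode" => (213 : ℕ)
notation "aTl" => (214 : ℕ)
notation "aHd" => (215 : ℕ)
notation "aPr" => (216 : ℕ)
notation "aSt" => (217 : ℕ)
notation "aTz" => (218 : ℕ)
notation "aEn" => (219 : ℕ)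
notation "aT" => (220 : ℕ)
notation "aA" => (221 : ℕ)
notation "aCnt" => (222 : ℕ)
notation "aPtr" => (223 : ℕ)
notation "aWp" => (224 : ℕ)
notation "aX" => (225 : ℕ)
notation "aMx" => (226 : ℕ)

namespace RAM

open RAM.Expr RAM.Prog

/-- The static data of the core instance are in memory, and `ta`, `ha` are the original names of
the tails and heads of the edges. -/
structure Holds (K : Core) (ta ha : ℕ → ℕ) (s : State) : Prop where
  l : s.reg rNodes = K.l
  m : s.reg rEdges = K.m
  M : s.reg rTotal = K.M
  tl : s.mem aTl = K.tl
  hd : s.mem aHd = K.hd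
  mu : s.mem aMult = K.mu
  pr : s.mem aPr = K.pr
  st : s.mem aSt = K.st
  t0 : s.mem aTz = K.t0
  en : s.mem aEn = K.en
  ta : s.mem aTail = ta
  ha : s.mem aHead = ha

theorem Holds.frame {K : Core} {ta ha : ℕ → ℕ} {s s' : State} (h : Holds K ta ha s) {P : Prog}
    (hf : Frame P s s') (h₁ : ∀ x ∈ [rNodes, rEdges, rTotal], x ∉ P.wreg)
    (h₂ : ∀ a ∈ [aTl, aHd, aMult, aPr, aSt, aTz, aEn, aTail, aHead], a ∉ P.warr) :
    Holds K ta ha s' := by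
  simp only [List.mem_cons, List.not_mem_nil, or_false, forall_eq_or_imp, forall_eq] at h₁ h₂
  obtain ⟨h₁, h₃, h₄⟩ := h₁
  obtain ⟨h₅, h₆, h₇, h₈, h₉, h₁₀, h₁₁, h₁₂, h₁₃⟩ := h₂
  exact ⟨(hf.reg _ h₁).trans h.l, (hf.reg _ h₃).trans h.m, (hf.reg _ h₄).trans h.M,
    (hf.mem _ h₅).trans h.tl, (hf.mem _ h₆).trans h.hd, (hf.mem _ h₇).trans h.mu,
    (hf.mem _ h₈).trans h.pr, (hf.mem _ h₉).trans h.st, (hf.mem _ h₁₀).trans h.t0,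
    (hf.mem _ h₁₁).trans h.en, (hf.mem _ h₁₂).trans h.ta, (hf.mem _ h₁₃).trans h.ha⟩

/-- Words are large enough for the core instance. -/
structure Fits (K : Core) (ta ha : ℕ → ℕ) (W : ℕ) : Prop where
  size : K.l + K.m + K.M + 2 ≤ W
  ta : ∀ i < K.m, ta i < W
  ha : ∀ i < K.m, ha i < W

/-- Placing one copy of the edge `rJ`. -/
def placeProg : Prog :=
  put aA (get aPtr (get aTl (var rJ))) (var rJ) ;;
  put aPtr (get aTl (var rJ)) (add (get aPtr (get aTl (var rJ))) (const 1)) ;;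
  put aCnt (var rJ) (sub (get aCnt (var rJ)) (const 1))

/-- Filling all vacant positions in ascending order. -/
def fillProg : Prog :=
  set rJ (const 0) ;;
  loop (sub (var rEdges) (var rJ))
    (loop (get aCnt (var rJ)) placeProg ;;
    set rJ (add (var rJ) (const 1)))

theorem fill_spec {K : Core} (hK : K.Valid) {ta ha : ℕ → ℕ} {W : ℕ} (hW : Fits K ta ha W)
    {s : State} (hs : Holds K ta ha s) {T : ℕ → ℕ}
    (hp : K.Partial T (s.mem aA) (s.mem aCnt) (s.mem aPtr)) :
    WP W fillProg s fun s' t =>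
      (K.Good T (s'.mem aA) ∧ (∀ e < K.m, s'.mem aCnt e = 0) ∧ (∀ v < K.l, s'.mem aPtr v = K.hi v) ∧
      (∀ p < K.M, ¬ K.Vacant (s.mem aPtr) p → s'.mem aA p = s.mem aA p) ∧
      ∀ p p', p < p' → K.Vacant (s.mem aPtr) p → K.Vacant (s.mem aPtr) p' → K.blk p = K.blk p' →
        s'.mem aA p ≤ s'.mem aA p') ∧ t ≤ 50 * (K.M + 1) := by
  set ptr₀ := s.mem aPtr with hptr₀
  set A₀ := s.mem aA with hA₀
  have hmM := hK.m_le
  have hsz := hW.size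
  let I : State → Prop := fun s₁ => Holds K ta ha s₁ ∧ s₁.reg rJ ≤ K.m ∧
    K.Partial T (s₁.mem aA) (s₁.mem aCnt) (s₁.mem aPtr) ∧
    K.Filling ptr₀ A₀ (s₁.reg rJ) (s₁.mem aA) (s₁.mem aPtr) ∧ ∀ e < s₁.reg rJ, s₁.mem aCnt e = 0
  -- One outer iteration for each edge and one inner iteration for each copy still to be placed.
  -- Both loops use this potential.
  let φ : State → ℕ := fun s₁ =>
    20 * (K.m - s₁.reg rJ) + 25 * ∑ e ∈ Finset.range K.m, s₁.mem aCnt e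
  have hsum := hp.sum_cnt_le hK
  simp only [fillProg, wp_seq, wp_set, Expr.eval, Expr.cost]
  refine ⟨by omega, ?_⟩
  refine WP.loop I φ ?_ ?_ ?_
  · refine ⟨hs.frame (P := .set rJ (.const 0)) (Exec.frame (.set (W := W) s rJ (.const 0)
      (by simp only [Expr.eval]; omega))) (by decide) (by decide), by simp, by simpa using hp, ?_, by simp⟩
    simp only [State.setReg_reg, State.setReg_mem, if_true]
    exact Core.Filling.refl
  · rintro s₁ hf ⟨hh, hj, hpart, hfil, hz⟩ h0
    simp only [Expr.eval, hh.m] at h0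
    simp only [wp_seq]
    refine WP.loop (fun s₂ => I s₂ ∧ s₂.reg rJ = s₁.reg rJ) φ ⟨⟨hh, hj, hpart, hfil, hz⟩, rfl⟩ ?_ ?_
    · rintro s₂ hf₂ ⟨⟨hh, hj, hpart, hfil, hz⟩, hje⟩ h0'
      simp only [Expr.eval] at h0'
      have hjm : s₂.reg rJ < K.m := by omega
      have hlt := hpart.ptr_lt_hi hK hjm (by omega)
      have hv := hK.tl_lt _ hjm
      have hM := hK.hi_le hv
      have hc := hpart.count _ hjm
      have hsc : s₂.mem aCnt (s₂.reg rJ) ≤ ∑ e ∈ Finset.range K.m, s₂.mem aCnt e :=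
        Finset.single_le_sum (f := s₂.mem aCnt) (fun _ _ => Nat.zero_le _) (by simp [hjm])
      have hle := hpart.sum_cnt_le hK
      have hfr : ∀ s₃ t, Exec W placeProg s₂ s₃ t → Holds K ta ha s₃ := fun s₃ t he =>
        hh.frame he.frame (by decide) (by decide)
      suffices WP W placeProg s₂ fun s₃ t => t ≤ 20 ∧ s₃.reg rJ = s₂.reg rJ ∧
          s₃.mem aA = Function.update (s₂.mem aA) (s₂.mem aPtr (K.tl (s₂.reg rJ))) (s₂.reg rJ) ∧
          s₃.mem aCnt = Function.update (s₂.mem aCnt) (s₂.reg rJ) (s₂.mem aCnt (s₂.reg rJ) - 1) ∧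
          s₃.mem aPtr = Function.update (s₂.mem aPtr) (K.tl (s₂.reg rJ))
            (s₂.mem aPtr (K.tl (s₂.reg rJ)) + 1) by
        obtain ⟨s₃, t, he, ht, hj', hA, hC, hP⟩ := this
        refine ⟨s₃, t, he, ⟨⟨hfr s₃ t he, by omega, ?_, ?_, ?_⟩, by omega⟩, ?_⟩
        · rw [hA, hC, hP]
          exact hpart.place hK hjm (by omega)
        · rw [hA, hP, hj']
          exact hfil.place hK hjm (hpart.lo_le _ hv) hlt
        · intro e he'
          rw [hC, Function.update_of_ne (by omega)]
          exact hz e (by omega)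
        · have h₁ : ∑ e ∈ Finset.range K.m, s₃.mem aCnt e + 1 =
              ∑ e ∈ Finset.range K.m, s₂.mem aCnt e := by
            rw [hC, Finset.sum_update_of_mem (by simp [hjm]),
              ← Finset.add_sum_erase (Finset.range K.m) (s₂.mem aCnt)
              (show s₂.reg rJ ∈ Finset.range K.m by simp [hjm]), Finset.sdiff_singleton_eq_erase]
            omega
          simp only [φ, hj', Expr.cost]
          omega
      simp [placeProg, hh.tl]
      omega
    · rintro s₂ t hf₂ ⟨⟨hh₂, hj₂, hpart, hfil, hz⟩, hje⟩ h0' ht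
      simp only [Expr.eval] at h0'
      simp only [Expr.cost, φ] at ht
      simp only [wp_set, Expr.eval, Expr.cost, φ, I, State.setReg_reg, State.setReg_mem, if_true]
      refine ⟨by omega, ⟨⟨hh₂.l, hh₂.m, hh₂.M, hh₂.tl, hh₂.hd, hh₂.mu, hh₂.pr, hh₂.st, hh₂.t0,
        hh₂.en, hh₂.ta, hh₂.ha⟩, by omega, hpart, hfil.succ, fun e he => ?_⟩, by omega⟩
      rcases Nat.lt_succ_iff_lt_or_eq.1 he with h | rfl
      · exact hz e h
      · exact h0'
  · rintro s₁ t hf ⟨hh, hj, hpart, hfil, hz⟩ h0 ht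
    simp only [Expr.eval, hh.m] at h0
    have hjm : s₁.reg rJ = K.m := by omega
    have hc : ∀ e < K.m, s₁.mem aCnt e = 0 := fun e he => hz e (by omega)
    have hgood := hpart.good hK hc
    have hptr : ∀ v < K.l, s₁.mem aPtr v = K.hi v := fun v hv => by
      have h₁ := hpart.sum_cnt hK hv
      rw [Finset.sum_eq_zero fun e he => hc e (by simp at he; exact he.1)] at h₁
      have := hpart.le_hi v hv
      omega
    have hnv : ∀ p, ¬ K.Vacant (s₁.mem aPtr) p := fun p h => by
      rw [hK.vacant_congr hptr] at h
      exact Core.not_vacant_hi h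
    refine ⟨⟨hgood, hc, hptr, hfil.agree, fun p p' h₁ h₂ h₃ h₄ =>
      hfil.asc p p' h₁ h₂ h₃ (hnv p) (hnv p') h₄⟩, ?_⟩
    simp only [φ, Expr.cost, State.setReg_reg, State.setReg_mem, if_true] at ht
    omega

end RAM

/-! ### Output of the solution of a schedule -/

namespace Core

variable {K : Core}

theorem IsSol.length (hK : K.Valid) {q : List ℕ} (hq : K.IsSol q) : q.length = K.M := by
  have h := countP_eq_sum_count (fun _ => True) hq.walk.lt
  simp only [decide_true, List.countP_true, Finset.filter_true] at h
  rw [h, ← hK.sum_mu]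
  exact Finset.sum_congr rfl fun i hi => hq.count i (by simpa using hi)

/-- The presentation of a solution as a sequence of words, with the original names of the nodes. -/
def enc (ta ha : ℕ → ℕ) (q : List ℕ) : List ℕ := q.length :: q.flatMap fun i => [ta i, ha i]

theorem getElem_sched {f : ℕ → ℕ} {v : ℕ} {l₁ l₂ : List ℕ} {i : ℕ}
    (h : l₁ ++ i :: l₂ = K.sched f v) : f (K.st v + l₁.length) = i := by
  have hlen : l₁.length < (K.sched f v).length := by rw [← h]; simp
  have h₁ : (K.sched f v)[l₁.length] = i := by simp [← h]
  rw [← h₁]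
  simp [sched]

end Core

namespace RAM

open RAM.Expr RAM.Prog

/-- Copying the starting positions of all nodes into an array. -/
def resetProg (a : ℕ) : Prog :=
  set rV (const 0) ;;
  loop (sub (var rNodes) (var rV))
    (put a (var rV) (get aSt (var rV)) ;;
    set rV (add (var rV) (const 1)))

theorem reset_spec {K : Core} (hK : K.Valid) {ta ha : ℕ → ℕ} {W : ℕ} (hW : Fits K ta ha W)
    {s : State} (hs : Holds K ta ha s) {a : ℕ} (ha : a ∈ [aPtr, aWp]) :
    WP W (resetProg a) s fun s' t => (∀ v < K.l, s'.mem a v = K.st v) ∧ t ≤ 20 * (K.l + 1) := by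
  have hsz := hW.size
  have haS : aSt ≠ a := by rintro rfl; simp at ha
  simp only [resetProg, wp_seq, wp_set, Expr.eval, Expr.cost]
  refine ⟨by omega, ?_⟩
  refine WP.loop (fun s₁ => s₁.reg rNodes = K.l ∧ s₁.mem aSt = K.st ∧ s₁.reg rV ≤ K.l ∧
    ∀ v < s₁.reg rV, s₁.mem a v = K.st v) (fun s₁ => 15 * (K.l - s₁.reg rV)) ?_ ?_ ?_
  · simp [hs.l, hs.st]
  · rintro s₁ - ⟨h₁, h₂, h₃, h₄⟩ h0
    simp only [Expr.eval, h₁] at h0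
    have h₅ := hK.st_le h₃
    simp only [wp_seq, wp_put, wp_set, Expr.eval, Expr.cost, State.setMem_reg, State.setReg_reg,
      State.setReg_mem, State.setMem_mem, h₁, h₂, if_true]
    refine ⟨by omega, by omega, ⟨by simp, by simp [haS], by omega, fun v hv => ?_⟩, by omega⟩
    by_cases hvv : v = s₁.reg rV
    · subst hvv; rw [Function.update_self]
    · rw [Function.update_of_ne hvv]; exact h₄ v (by omega)
  · rintro s₁ t - ⟨h₁, h₂, h₃, h₄⟩ h0 ht
    simp only [Expr.eval, h₁] at h0
    simp only [Expr.cost] at ht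
    refine ⟨fun v hv => h₄ v (by omega), ?_⟩
    simp only [State.setReg_reg, if_true] at ht
    omega

/-- Output of the solution that belongs to a schedule. -/
def walkProg : Prog :=
  resetProg aWp ;;
  emit (var rTotal) ;;
  set rU (const 0) ;;
  set rC (var rTotal) ;;
  loop (var rC)
    (set rE (get aA (get aWp (var rU))) ;;
    put aWp (var rU) (add (get aWp (var rU)) (const 1)) ;;
    emit (get aTail (var rE)) ;;
    emit (get aHead (var rE)) ;;
    set rU (get aHd (var rE)) ;;
    set rC (sub (var rC) (const 1)))

/-- The pointer of a node has advanced by the number of its exits so far. As the exits of `q` agree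
with the schedule, the entry under the pointer is the next edge of `q`. -/
theorem walk_spec {K : Core} (hK : K.Valid) {ta ha : ℕ → ℕ} {W : ℕ} (hW : Fits K ta ha W)
    {s : State} (hs : Holds K ta ha s) {q : List ℕ} (hq : K.IsSol q)
    (hsch : ∀ v < K.l, K.exits q v = K.sched (s.mem aA) v) :
    WP W walkProg s fun s' t => s'.out = s.out ++ Core.enc ta ha q ∧
      t ≤ 50 * (K.l + K.M + 1) := by
  have hsz := hW.size
  have hlen := hq.length hK
  set A := s.mem aA with hA
  simp only [walkProg]
  rw [wp_seq]
  refine (reset_spec hK hW hs (a := aWp) (by simp)).mono fun s₁ t₁ hf₁ ⟨hwp, ht₁⟩ => ?_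
  have hh₁ := hs.frame hf₁ (by decide) (by decide)
  have hA₁ : s₁.mem aA = A := hf₁.mem _ (by decide)
  have ho₁ : s₁.out = s.out := hf₁.out (by decide)
  simp only [wp_seq, wp_emit, wp_set, Expr.eval, Expr.cost, State.write_reg, State.setReg_reg]
  refine ⟨by rw [hh₁.M]; omega, by omega, by simp [hh₁.M]; omega, ?_⟩
  refine WP.loop (fun s₂ => (s₂.mem aA = A ∧ s₂.mem aTail = ta ∧ s₂.mem aHead = ha ∧
    s₂.mem aHd = K.hd) ∧ ∃ q₁ q₂, q = q₁ ++ q₂ ∧ K.IsWalk (s₂.reg rU) q₂ 0 ∧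
    s₂.reg rC = q₂.length ∧ (∀ v < K.l, s₂.mem aWp v = K.st v + (K.exits q₁ v).length) ∧
    s₂.out = s.out ++ K.M :: q₁.flatMap fun i => [ta i, ha i])
    (fun s₂ => 32 * s₂.reg rC) ?_ ?_ ?_
  · refine ⟨by simp [hA₁, hh₁.ta, hh₁.ha, hh₁.hd], [], q, rfl, ?_, ?_, ?_, ?_⟩
    · simpa using hq.walk
    · simp [hlen, hh₁.M]
    · intro v hv
      simp [Core.exits, hwp v hv]
    · simp [ho₁, hh₁.M]
  · rintro s₂ - ⟨⟨h₁, h₂, h₃, h₄⟩, q₁, q₂, hqq, hwalk, hc, hw, ho⟩ h0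
    simp only [Expr.eval, hc] at h0
    obtain ⟨i, q₂, rfl⟩ := List.exists_cons_of_length_pos (Nat.pos_of_ne_zero h0)
    obtain ⟨him, hit, hwalk⟩ := hwalk
    have hul : s₂.reg rU < K.l := hit ▸ hK.tl_lt i him
    have hval : A (s₂.mem aWp (s₂.reg rU)) = i := by
      rw [hw _ hul]
      refine Core.getElem_sched (l₂ := K.exits q₂ (s₂.reg rU)) ?_
      rw [← hsch _ hul, hqq, Core.exits_append]
      congr 1
      simp [Core.exits, hit]
    have hle : s₂.mem aWp (s₂.reg rU) < K.M := by
      have h₅ : (K.exits q (s₂.reg rU)).length = K.outDeg (s₂.reg rU) := hq.length_exits q _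
      have h₆ := hK.st_add_outDeg_le hul
      rw [hqq, Core.exits_append, List.length_append] at h₅
      have h₇ : (K.exits (i :: q₂) (s₂.reg rU)).length ≠ 0 := by simp [Core.exits, hit]
      rw [hw _ hul]
      omega
    have hti := hW.ta i him
    have hhi := hW.ha i him
    have hhd := hK.hd_lt i him
    have hlen₂ : (i :: q₂).length ≤ K.M := by rw [← hlen, hqq]; simp
    simp only [wp_seq, wp_emit, wp_put, wp_set, Expr.eval, Expr.cost, State.write_reg,
      State.setReg_reg, State.setMem_reg, State.setReg_mem, State.write_mem, State.setMem_mem,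
      State.write_out, State.setReg_out, State.setMem_out, h₁, h₂, h₃, h₄, Nat.reduceEqDiff,
      if_false, if_true, hval, hc]
    simp only [List.length_cons] at hlen₂ ⊢
    refine ⟨by omega, by omega, hti, hhi, by omega, by omega, ⟨⟨trivial, trivial, trivial, trivial⟩, q₁ ++ [i], q₂,
      by simp [hqq], hwalk, by omega, ?_, ?_⟩, by omega⟩
    · intro v hv
      rw [Core.exits_append, List.length_append]
      by_cases hvu : v = s₂.reg rU
      · subst hvu
        rw [Function.update_self, hw _ hv]
        simp [Core.exits, hit]
        omega
      · rw [Function.update_of_ne hvu, hw v hv]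
        simp [Core.exits, hit, Ne.symm hvu]
    · simp [ho]
  · rintro s₂ t - ⟨-, q₁, q₂, hqq, hwalk, hc, hw, ho⟩ h0 ht
    simp only [Expr.eval, hc] at h0
    obtain rfl := List.length_eq_zero_iff.1 h0
    rw [List.append_nil] at hqq
    subst hqq
    refine ⟨by rw [ho, Core.enc, hlen], ?_⟩
    simp only [State.setReg_reg, State.write_reg, if_true, Expr.cost, hh₁.M] at ht
    simp at ht
    omega

/-! ### The lexicographic successor of a schedule -/

/-- Replacing the entry `rE` at the position `rP` of the node `rV` by the next greater one that is
available. -/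
def pivotProg : Prog :=
  set rE (add (var rE) (const 1)) ;;
  loop (add (add (sub (get aTl (var rE)) (var rV)) (sub (var rV) (get aTl (var rE))))
      (sub (const 1) (get aCnt (var rE))))
    (set rE (add (var rE) (const 1))) ;;
  put aA (var rP) (var rE) ;;
  put aCnt (var rE) (sub (get aCnt (var rE)) (const 1)) ;;
  put aPtr (var rV) (add (var rP) (const 1)) ;;
  set rMore (const 1) ;;
  set rP (const 0)

/-- Clearing the array of the greatest removed entries. -/
def clearProg : Prog :=
  set rV (const 0) ;;
  loop (sub (var rNodes) (var rV))
    (put aMx (var rV) (const 0) ;;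
    set rV (add (var rV) (const 1)))

/-- Removing the entry at the position before `rP`, unless it is fixed. -/
def removeProg : Prog :=
  set rP (sub (var rP) (const 1)) ;;
  set rE (get aA (var rP)) ;;
  set rV (get aTl (var rE)) ;;
  ite (get aPr (var rE)) skip
    (ite (add (sub (const 1) (var rV))
        (sub (get aSt (add (var rV) (const 1))) (add (var rP) (const 1))))
      (put aPtr (var rV) (var rP) ;;
      put aCnt (var rE) (add (get aCnt (var rE)) (const 1)) ;;
      ite (sub (get aMx (var rV)) (add (var rE) (const 1)))
        pivotProg
        (put aMx (var rV) (add (var rE) (const 1))))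
      skip)

/-- The first part of the step to the next schedule: entries are removed from the end until one
can be increased. If there is none, `rMore` becomes `0`. -/
def nextProg : Prog :=
  clearProg ;;
  set rMore (const 0) ;;
  set rP (var rTotal) ;;
  loop (var rP) removeProg

theorem clear_spec {K : Core} {ta ha : ℕ → ℕ} {W : ℕ} (hW : Fits K ta ha W)
    {s : State} (hs : Holds K ta ha s) :
    WP W clearProg s fun s' t => (∀ v < K.l, s'.mem aMx v = 0) ∧ t ≤ 20 * (K.l + 1) := by
  have hsz := hW.size
  simp only [clearProg, wp_seq, wp_set, Expr.eval, Expr.cost]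
  refine ⟨by omega, ?_⟩
  refine WP.loop (fun s₁ => s₁.reg rNodes = K.l ∧ s₁.reg rV ≤ K.l ∧
    ∀ v < s₁.reg rV, s₁.mem aMx v = 0) (fun s₁ => 15 * (K.l - s₁.reg rV)) ?_ ?_ ?_
  · simp [hs.l]
  · rintro s₁ - ⟨h₁, h₃, h₄⟩ h0
    simp only [Expr.eval, h₁] at h0
    simp only [wp_seq, wp_put, wp_set, Expr.eval, Expr.cost, State.setMem_reg, State.setReg_reg,
      State.setReg_mem, State.setMem_mem, h₁, if_true]
    refine ⟨by omega, by omega, ⟨by simp, by omega, fun v hv => ?_⟩, by omega⟩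
    by_cases hvv : v = s₁.reg rV
    · subst hvv; rw [Function.update_self]
    · rw [Function.update_of_ne hvv]; exact h₄ v (by omega)
  · rintro s₁ t - ⟨h₁, h₃, h₄⟩ h0 ht
    simp only [Expr.eval, h₁] at h0
    simp only [Expr.cost] at ht
    refine ⟨fun v hv => h₄ v (by omega), ?_⟩
    simp only [State.setReg_reg, if_true] at ht
    omega

/-- The situation when the entries of the schedule `A` from position `q` on have been removed and
none of them could be increased. -/
structure Removed (K : Core) (T A : ℕ → ℕ) (q : ℕ) (cnt ptr mx : ℕ → ℕ) : Prop where
  part : K.Partial T A cnt ptr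
  ptr_eq : ∀ v < K.l, ptr v = K.level q v
  le_mx : ∀ p, q ≤ p → K.Free p → A p + 1 ≤ mx (K.blk p)
  mx_mem : ∀ v < K.l, mx v ≠ 0 → ∃ p, q ≤ p ∧ K.Free p ∧ K.blk p = v ∧ A p + 1 = mx v
  desc : ∀ p p', q ≤ p → p < p' → K.Free p → K.Free p' → K.blk p = K.blk p' → A p' ≤ A p

/-- The situation when the entry at the position `i` of the schedule `A` has been increased and
the entries after it have been removed. -/
structure Increased (K : Core) (T A : ℕ → ℕ) (A' cnt ptr : ℕ → ℕ) (i : ℕ) : Prop where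
  lt : i < K.M
  part : K.Partial T A' cnt ptr
  ptr_eq : ∀ v < K.l, ptr v = K.level (i + 1) v
  agree : ∀ p, p ≠ i → A' p = A p
  inc : A i < A' i
  least : ∀ p, i < p → K.Free p → K.blk p = K.blk i → A i < A p → A' i ≤ A p
  desc : ∀ p p', i + 1 ≤ p → p < p' → K.Free p → K.Free p' → K.blk p = K.blk p' → A p' ≤ A p

theorem pivot_spec {K : Core} (hK : K.Valid) {ta ha : ℕ → ℕ} {W : ℕ} (hW : Fits K ta ha W)
    {s : State} (hs : Holds K ta ha s) {T : ℕ → ℕ} (hA : K.Good T (s.mem aA))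
    (hfree : K.Free (s.reg rP)) (hE : s.reg rE = s.mem aA (s.reg rP))
    (hV : s.reg rV = K.blk (s.reg rP))
    (hp : K.Partial T (s.mem aA) (s.mem aCnt) (s.mem aPtr))
    (hptr : ∀ v < K.l, s.mem aPtr v = K.level (s.reg rP) v)
    (hdesc : ∀ p p', s.reg rP + 1 ≤ p → p < p' → K.Free p → K.Free p' → K.blk p = K.blk p' →
      s.mem aA p' ≤ s.mem aA p)
    (hex : ∃ p, s.reg rP + 1 ≤ p ∧ K.Free p ∧ K.blk p = s.reg rV ∧ s.reg rE < s.mem aA p) :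
    WP W pivotProg s fun s' t =>
      Increased K T (s.mem aA) (s'.mem aA) (s'.mem aCnt) (s'.mem aPtr) (s.reg rP) ∧
      s'.reg rMore = 1 ∧ s'.reg rP = 0 ∧ t ≤ 30 * (K.m + 2) := by
  have hsz := hW.size
  have hPM := hfree.1
  have hv := (hK.blk_spec hPM).1
  have hvac : ∀ p, K.Vacant (s.mem aPtr) p ↔ K.Free p ∧ s.reg rP ≤ p := fun p => by
    rw [hK.vacant_congr hptr, hK.vacant_level]
  obtain ⟨p₀, hp₀, hp₀f, hp₀b, hp₀lt⟩ := hex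
  have hf₀ : s.mem aA p₀ < K.m := hA.lt _ hp₀f.1
  set f₀ := s.mem aA p₀ with hf₀def
  have hf₀t : K.tl f₀ = s.reg rV := by rw [hA.tl _ hp₀f.1, hp₀b]
  have hf₀c : 0 < s.mem aCnt f₀ := (hp.cnt_eq hA hf₀).2 ⟨p₀, (hvac p₀).2 ⟨hp₀f, by omega⟩, rfl⟩
  simp only [pivotProg, wp_seq, wp_set, Expr.eval, Expr.cost]
  refine ⟨by omega, ?_⟩
  -- The search halts at `f₀` at the latest, a removed entry of this node that exceeds the old one.
  -- Everything it passes over is unavailable here, so the edge found is the least possible.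
  refine WP.loop (fun s₁ => s₁.reg rP = s.reg rP ∧ s₁.reg rV = s.reg rV ∧ s₁.mem = s.mem ∧
      s.reg rE < s₁.reg rE ∧ s₁.reg rE ≤ f₀ ∧
      ∀ f, s.reg rE < f → f < s₁.reg rE → ¬ (K.tl f = s.reg rV ∧ 0 < s.mem aCnt f))
    (fun s₁ => 20 * (K.m - s₁.reg rE)) ?_ ?_ ?_
  · simp only [State.setReg_reg, State.setReg_mem, Nat.reduceEqDiff, if_false, if_true]
    refine ⟨trivial, trivial, trivial, by omega, by omega, fun f h₁ h₂ => by omega⟩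
  · rintro s₁ - ⟨h₁, h₂, h₃, h₄, h₅, h₆⟩ h0
    simp only [Expr.eval, h₂, h₃, hs.tl] at h0
    have hne : s₁.reg rE ≠ f₀ := by
      intro h
      rw [h] at h0
      omega
    simp only [wp_set, Expr.eval, Expr.cost, State.setReg_reg, State.setReg_mem, Nat.reduceEqDiff,
      if_false, if_true]
    refine ⟨by omega, ⟨h₁, h₂, h₃, by omega, by omega, fun f h₇ h₈ h₉ => ?_⟩, by omega⟩
    rcases Nat.lt_succ_iff_lt_or_eq.1 h₈ with h | rfl
    · exact h₆ f h₇ h h₉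
    · omega
  · rintro s₁ t - ⟨h₁, h₂, h₃, h₄, h₅, h₆⟩ h0 ht
    simp only [Expr.eval, h₂, h₃, hs.tl] at h0
    simp only [Expr.cost, State.setReg_reg, if_true] at ht
    set f := s₁.reg rE with hf
    have hft : K.tl f = s.reg rV := by omega
    have hfc : 0 < s.mem aCnt f := by omega
    have hfm : f < K.m := by omega
    have hlev : s.mem aPtr (K.tl f) = s.reg rP := by
      rw [hft, hV, hptr _ hv, hfree.level_self]
    have hplace := hp.place hK hfm hfc
    have hcnt := hp.count f hfm
    have hmu : ∀ i < K.m, K.mu i ≤ K.M := fun i hi => by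
      rw [← hK.sum_mu]
      exact Finset.single_le_sum (f := K.mu) (fun _ _ => Nat.zero_le _) (by simp [hi])
    have hmuf := hmu f hfm
    rw [hlev, hft] at hplace
    simp only [wp_put, Expr.eval, Expr.cost, State.setReg_reg, State.setMem_reg,
      State.setReg_mem, State.setMem_mem, Nat.reduceEqDiff, if_false, if_true, h₁, h₂, h₃, ← hf]
    refine ⟨by omega, by omega, by omega, by omega, by omega,
      ⟨hPM, hplace, ?_, fun p hne => Function.update_of_ne hne .., ?_, ?_, hdesc⟩, trivial, trivial,
      by omega⟩
    · intro v hvl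
      by_cases hvb : v = s.reg rV
      · subst hvb
        rw [Function.update_self, hV, hfree.level_succ_self]
      · rw [Function.update_of_ne hvb, hptr v hvl, hK.level_succ hvl]
        rintro ⟨-, h⟩
        exact hvb (h.trans hV.symm)
    · rw [Function.update_self]; omega
    · intro p hp₁ hp₂ hp₃ hp₄
      rw [Function.update_self]
      by_contra hc
      refine h₆ (s.mem aA p) (by omega) (by omega) ⟨by rw [hA.tl _ hp₂.1, hp₃, hV], ?_⟩
      exact (hp.cnt_eq hA (hA.lt _ hp₂.1)).2 ⟨p, (hvac p).2 ⟨hp₂, hp₁.le⟩, rfl⟩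

end RAM

namespace Core

variable {K : Core}

/-- The only copy of a compulsory edge is used up by the first position of its tail. Fixed positions
can thus be recognised by their entries. -/
theorem Good.not_free_of_prio (hK : K.Valid) {T A : ℕ → ℕ} (hA : K.Good T A) {p : ℕ}
    (hp : p < K.M) (hpr : K.pr (A p) ≠ 0) : ¬ K.Free p := by
  intro hf
  have him := hA.lt p hp
  have h₁ := hA.count _ him
  rw [hK.pr_mu _ him hpr, Finset.card_eq_one] at h₁
  obtain ⟨a, ha⟩ := h₁
  have h₂ := hK.outDeg_pos him
  have h₃ := hK.st_add_outDeg_le (hK.tl_lt _ him)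
  have h₄ : p ∈ ({a} : Finset ℕ) := by rw [← ha]; simp [hp]
  have h₅ : K.st (K.tl (A p)) ∈ ({a} : Finset ℕ) := by
    rw [← ha]
    simp only [Finset.mem_filter, Finset.mem_range]
    exact ⟨by omega, hA.prio _ him hpr⟩
  rw [Finset.mem_singleton] at h₄ h₅
  have h₆ := prio_lt_lo him hpr
  have h₇ := hf.2.1
  rw [← hA.tl p hp] at h₇
  omega

/-- The right-hand side is the test carried out by `removeProg`. -/
theorem Good.free_iff (hK : K.Valid) {T A : ℕ → ℕ} (hA : K.Good T A) {p : ℕ} (hp : p < K.M) :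
    K.Free p ↔ K.pr (A p) = 0 ∧ ¬ (K.blk p ≠ 0 ∧ p + 1 = K.st (K.blk p + 1)) := by
  constructor
  · refine fun h => ⟨by_contra fun hpr => hA.not_free_of_prio hK hp hpr h, fun ⟨h₁, h₂⟩ => ?_⟩
    have h₃ := h.2.2
    rw [hi_eq (Nat.pos_of_ne_zero h₁)] at h₃
    omega
  · rintro ⟨h₁, h₂⟩
    by_contra h
    rcases hK.not_free hp h with ⟨i, hi, hpr, rfl⟩ | ⟨h₃, h₄⟩
    · rw [hA.prio i hi hpr] at h₁
      exact hpr h₁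
    · exact h₂ ⟨h₃.ne', h₄⟩

theorem Good.congr_tree {T T' f : ℕ → ℕ} (h : K.Good T f)
    (hT : ∀ v, 0 < v → v < K.l → T v = T' v) : K.Good T' f :=
  ⟨h.lt, h.tl, h.count, h.prio, fun v h0 hv => (h.last v h0 hv).trans (hT v h0 hv)⟩

theorem key_eq_of_sched (hK : K.Valid) {f g : ℕ → ℕ}
    (h : ∀ v < K.l, K.sched f v = K.sched g v) : K.key f = K.key g := by
  rw [key_eq_key]
  intro p hp
  obtain ⟨h₁, h₂, h₃⟩ := hK.blk_spec hp
  have h₄ := h _ h₁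
  simp only [sched, List.map_inj_left, List.mem_range'_1] at h₄
  exact h₄ p ⟨h₂, by omega⟩

theorem sched_eq_of_key (hK : K.Valid) {f g : ℕ → ℕ} (h : K.key f = K.key g) {v : ℕ}
    (hv : v < K.l) : K.sched f v = K.sched g v := by
  rw [key_eq_key] at h
  simp only [sched, List.map_inj_left, List.mem_range'_1]
  intro p hp
  have := hK.st_le (show v + 1 ≤ K.l from hv)
  exact h p (by omega)

theorem mem_solsOf_iff (hK : K.Valid) {T : ℕ → ℕ} (q : List ℕ) :
    q ∈ K.solsOf T ↔ K.IsSol q ∧ ∃ g, K.Good T g ∧ ∀ v < K.l, K.exits q v = K.sched g v := by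
  constructor
  · rintro ⟨hq, h⟩
    obtain ⟨g, hg, he⟩ := hq.exists_good hK
    exact ⟨hq, g, hg.congr_tree h, he⟩
  · rintro ⟨hq, g, hg, he⟩
    refine ⟨hq, fun u h0 hu => ?_⟩
    have h₁ := hK.outDeg_pos' h0 hu
    have h₂ := hK.st_succ u hu
    rw [lst, he u hu, ← hg.last u h0 hu, sched, List.getLastD_eq_getLast?, List.getLast?_map,
      List.getLast?_range', if_neg (by omega)]
    simp only [Option.map_some, Option.getD_some]
    congr 1
    omega

end Core

namespace RAM

open RAM.Expr RAM.Prog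

theorem Removed.skip {K : Core} (hK : K.Valid) {T A cnt ptr mx : ℕ → ℕ} {p : ℕ}
    (h : Removed K T A (p + 1) cnt ptr mx) (hf : ¬ K.Free p) : Removed K T A p cnt ptr mx := by
  have hne : ∀ p', p ≤ p' → K.Free p' → p + 1 ≤ p' := fun p' h₁ h₂ => by
    rcases h₁.eq_or_lt with rfl | h₃
    · exact absurd h₂ hf
    · exact h₃
  refine ⟨h.part, fun v hv => ?_, fun p' h₁ h₂ => h.le_mx p' (hne p' h₁ h₂) h₂, fun v hv h₀ => ?_,
    fun p₁ p₂ h₁ h₂ h₃ => h.desc p₁ p₂ (hne p₁ h₁ h₃) h₂ h₃⟩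
  · rw [h.ptr_eq v hv, hK.level_succ hv fun h => hf h.1]
  · obtain ⟨p', h₁, h₂⟩ := h.mx_mem v hv h₀
    exact ⟨p', by omega, h₂⟩

theorem Removed.init {K : Core} (hK : K.Valid) {T A cnt ptr mx : ℕ → ℕ} (hA : K.Good T A)
    (hc : ∀ e < K.m, cnt e = 0) (hp : ∀ v < K.l, ptr v = K.hi v) (hmx : ∀ v < K.l, mx v = 0) :
    Removed K T A K.M cnt ptr mx := by
  refine ⟨(hA.partial hK).congr hK (fun _ _ => rfl) (fun e he => (hc e he).symm)
    fun v hv => (hp v hv).symm, fun v hv => by rw [hp v hv, hK.level_M hv],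
    fun p h₁ h₂ => absurd h₂.1 (not_lt.2 h₁), fun v hv h => absurd (hmx v hv) h,
    fun p p' h₁ _ h₂ => absurd h₂.1 (not_lt.2 h₁)⟩

/-- The greatest removed entry of the node decides whether the present entry can be increased. If it
cannot, it is at least as great as all removed ones, and the removed entries still descend. -/
theorem remove_spec {K : Core} (hK : K.Valid) {ta ha : ℕ → ℕ} {W : ℕ} (hW : Fits K ta ha W)
    {s : State} (hs : Holds K ta ha s) {T : ℕ → ℕ} (hA : K.Good T (s.mem aA))
    (h0 : s.reg rP ≠ 0) (hle : s.reg rP ≤ K.M)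
    (h : Removed K T (s.mem aA) (s.reg rP) (s.mem aCnt) (s.mem aPtr) (s.mem aMx)) :
    WP W removeProg s fun s' t =>
      (s'.reg rMore = s.reg rMore ∧ s'.reg rP + 1 = s.reg rP ∧ s'.mem aA = s.mem aA ∧
        Removed K T (s'.mem aA) (s'.reg rP) (s'.mem aCnt) (s'.mem aPtr) (s'.mem aMx) ∧ t ≤ 60) ∨
      (s'.reg rMore = 1 ∧ s'.reg rP = 0 ∧
        (∃ i, Increased K T (s.mem aA) (s'.mem aA) (s'.mem aCnt) (s'.mem aPtr) i) ∧
        t ≤ 60 + 30 * (K.m + 2)) := by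
  have hsz := hW.size
  obtain ⟨p, hpe⟩ := Nat.exists_eq_succ_of_ne_zero h0
  rw [Nat.succ_eq_add_one] at hpe
  rw [hpe] at h hle
  have hp : p < K.M := hle
  set A := s.mem aA with hAdef
  have hem := hA.lt p hp
  have htl := hA.tl p hp
  obtain ⟨hv, hst₁, hst₂⟩ := hK.blk_spec hp
  have hfree := hA.free_iff hK hp
  simp only [removeProg, wp_seq, wp_set, wp_ite, wp_skip, Expr.eval, Expr.cost, State.setReg_reg,
    State.setReg_mem, Nat.reduceEqDiff, if_false, if_true, hpe, Nat.add_sub_cancel, ← hAdef, hs.tl,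
    hs.pr, hs.st, htl, ne_eq]
  refine ⟨by omega, by omega, by omega, fun hpr => ?_, fun hpr => ⟨fun hnl => ?_, fun hl => ?_⟩⟩
  · refine .inl ⟨trivial, trivial, trivial, h.skip hK (hA.not_free_of_prio hK hp hpr), by omega⟩
  · have hf : K.Free p := hfree.2 ⟨hpr, by omega⟩
    have hpv : s.mem aPtr (K.blk p) = p + 1 := by rw [h.ptr_eq _ hv, hf.level_succ_self]
    have hpart := h.part.unplace hK hv hf.2.1 hpv
    have hcnt := hpart.count _ hem
    rw [Function.update_self] at hcnt
    have hmu : K.mu (A p) ≤ K.M := by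
      rw [← hK.sum_mu]
      exact Finset.single_le_sum (f := K.mu) (fun _ _ => Nat.zero_le _) (by simp [hem])
    have hptr : ∀ v < K.l, Function.update (s.mem aPtr) (K.blk p) p v = K.level p v := by
      intro v hvl
      by_cases hvb : v = K.blk p
      · subst hvb; rw [Function.update_self, hf.level_self]
      · rw [Function.update_of_ne hvb, h.ptr_eq v hvl, hK.level_succ hvl fun h => hvb h.2]
    simp only [wp_put, Expr.eval, Expr.cost, State.setReg_reg, State.setReg_mem, State.setMem_reg,
      State.setMem_mem, Nat.reduceEqDiff, if_false, if_true, ← hAdef]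
    refine ⟨by omega, by omega, fun hpiv => ?_, fun hnp => ?_⟩
    · refine (pivot_spec hK hW (T := T) ?_ ?_ ?_ ?_ ?_ ?_ ?_ ?_ ?_).mono fun s' t hf' h' => .inr ?_
      · exact ⟨hs.l, hs.m, hs.M, hs.tl, hs.hd, hs.mu, hs.pr, hs.st, hs.t0, hs.en, hs.ta, hs.ha⟩
      · simpa using hA
      · simpa using hf
      · simp [hAdef]
      · simp
      · simpa using hpart
      · simpa using hptr
      · simpa using h.desc
      · obtain ⟨p', h₁, h₂, h₃, h₄⟩ := h.mx_mem _ hv (by omega)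
        refine ⟨p', by simpa using h₁, h₂, by simpa using h₃, ?_⟩
        simp only [State.setMem_mem, State.setMem_reg, State.setReg_mem, State.setReg_reg,
          Nat.reduceEqDiff, if_false, if_true, ← hAdef]
        omega
      · simp only [State.setMem_mem, State.setMem_reg, State.setReg_mem, State.setReg_reg,
          Nat.reduceEqDiff, if_false, if_true, ← hAdef] at h'
        exact ⟨h'.2.1, h'.2.2.1, ⟨_, h'.1⟩, by omega⟩
    · refine ⟨by omega, .inl ⟨trivial, trivial, trivial, ⟨hpart, hptr, ?_, ?_, ?_⟩, by omega⟩⟩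
      · intro p' h₁ h₂
        rcases h₁.eq_or_lt with rfl | h₃
        · rw [Function.update_self]
        · have h₄ := h.le_mx p' h₃ h₂
          by_cases hb : K.blk p' = K.blk p
          · rw [hb, Function.update_self]; rw [hb] at h₄; omega
          · rwa [Function.update_of_ne hb]
      · intro v hvl h₁
        by_cases hb : v = K.blk p
        · subst hb
          exact ⟨p, le_rfl, hf, rfl, by rw [Function.update_self]⟩
        · rw [Function.update_of_ne hb] at h₁ ⊢
          obtain ⟨p', h₂, h₃⟩ := h.mx_mem v hvl h₁
          exact ⟨p', by omega, h₃⟩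
      · intro p₁ p₂ h₁ h₂ h₃ h₄ h₅
        rcases h₁.eq_or_lt with rfl | h₆
        · have := h.le_mx p₂ h₂ h₄
          rw [← h₅] at this
          omega
        · exact h.desc p₁ p₂ h₆ h₂ h₃ h₄ h₅
  · refine .inl ⟨trivial, trivial, trivial, h.skip hK fun hf => (hfree.1 hf).2 ?_, by omega⟩
    omega

theorem next_spec {K : Core} (hK : K.Valid) {ta ha : ℕ → ℕ} {W : ℕ} (hW : Fits K ta ha W)
    {s : State} (hs : Holds K ta ha s) {T : ℕ → ℕ} (hA : K.Good T (s.mem aA))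
    (hc : ∀ e < K.m, s.mem aCnt e = 0) (hp : ∀ v < K.l, s.mem aPtr v = K.hi v) :
    WP W nextProg s fun s' t =>
      ((s'.reg rMore = 0 ∧ ∀ g, K.Good T g → K.key g ≤ K.key (s.mem aA)) ∨
      (s'.reg rMore = 1 ∧
        ∃ i, Increased K T (s.mem aA) (s'.mem aA) (s'.mem aCnt) (s'.mem aPtr) i)) ∧
      t ≤ 120 * (K.l + K.M + 1) := by
  have hsz := hW.size
  have hmM := hK.m_le
  set A := s.mem aA with hAdef
  simp only [nextProg]
  rw [wp_seq]
  refine (clear_spec hW hs).mono fun s₁ t₁ hf₁ ⟨hmx, ht₁⟩ => ?_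
  have hh₁ := hs.frame hf₁ (by decide) (by decide)
  have hA₁ : s₁.mem aA = A := hf₁.mem _ (by decide)
  have hC₁ : s₁.mem aCnt = s.mem aCnt := hf₁.mem _ (by decide)
  have hP₁ : s₁.mem aPtr = s.mem aPtr := hf₁.mem _ (by decide)
  simp only [wp_seq, wp_set, Expr.eval, Expr.cost, State.setReg_reg, Nat.reduceEqDiff, if_false,
    hh₁.M]
  refine ⟨by omega, by omega, ?_⟩
  refine WP.loop (fun s₂ => Holds K ta ha s₂ ∧
    ((s₂.reg rMore = 0 ∧ s₂.reg rP ≤ K.M ∧ s₂.mem aA = A ∧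
      Removed K T A (s₂.reg rP) (s₂.mem aCnt) (s₂.mem aPtr) (s₂.mem aMx)) ∨
    (s₂.reg rMore = 1 ∧ s₂.reg rP = 0 ∧
      ∃ i, Increased K T A (s₂.mem aA) (s₂.mem aCnt) (s₂.mem aPtr) i)))
    -- The second summand pays for the search in `pivotProg`, which is run at most once because it
    -- sets `rMore`.
    (fun s₂ => 70 * s₂.reg rP + (1 - s₂.reg rMore) * (30 * (K.m + 2))) ?_ ?_ ?_
  · refine ⟨⟨hh₁.l, hh₁.m, hh₁.M, hh₁.tl, hh₁.hd, hh₁.mu, hh₁.pr, hh₁.st, hh₁.t0, hh₁.en, hh₁.ta,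
      hh₁.ha⟩, .inl ?_⟩
    simp only [State.setReg_reg, State.setReg_mem, Nat.reduceEqDiff, if_false, if_true, hA₁, hC₁,
      hP₁]
    exact ⟨trivial, le_rfl, trivial, Removed.init hK hA hc hp hmx⟩
  · rintro s₂ - ⟨hh₂, h | h⟩ h0
    · obtain ⟨h₁, h₂, h₃, h₄⟩ := h
      refine (remove_spec hK hW hh₂ (T := T) (by rwa [h₃]) h0 h₂ (by rwa [h₃])).mono
        fun s₃ t₃ hf₃ h => ⟨⟨hh₂.frame hf₃ (by decide) (by decide), ?_⟩, ?_⟩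
      · rcases h with ⟨h₅, h₆, h₇, h₈, -⟩ | ⟨h₅, h₆, h₇, -⟩
        · exact .inl ⟨h₅.trans h₁, by omega, h₇.trans h₃, by rwa [h₇, h₃] at h₈⟩
        · exact .inr ⟨h₅, h₆, by rwa [h₃] at h₇⟩
      · simp only [Expr.cost]
        rcases h with ⟨h₅, h₆, -, -, h₇⟩ | ⟨h₅, h₆, -, h₇⟩
        · rw [h₅, h₁]; omega
        · rw [h₅, h₆, h₁]
          simp only [Expr.eval] at h0
          omega
    · exact absurd h.2.1 h0
  · rintro s₂ t - ⟨hh₂, h⟩ h0 ht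
    simp only [Expr.eval] at h0
    simp only [State.setReg_reg, if_true, Nat.reduceEqDiff, if_false, Expr.cost] at ht
    refine ⟨?_, by omega⟩
    rcases h with ⟨h₁, h₂, h₃, h₄⟩ | ⟨h₁, -, h₂⟩
    · rw [h0] at h₄
      refine .inl ⟨h₁, fun g hg => ?_⟩
      exact hA.key_le_of_descending hK hg (q := 0) (by simp) h₄.desc
    · exact .inr ⟨h₁, h₂⟩

/-- Output of all solutions from a full schedule on. -/
def permLoop : Prog :=
  loop (var rMore)
    (walkProg ;;
    nextProg ;;
    ite (var rMore) fillProg skip)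

theorem permLoop_spec {K : Core} (hK : K.Valid) {ta ha : ℕ → ℕ} {W : ℕ} (hW : Fits K ta ha W)
    {T : ℕ → ℕ} (hT : K.Arb T) {s : State} (hs : Holds K ta ha s) (hmore : s.reg rMore = 1)
    (hA : K.Good T (s.mem aA)) (hc : ∀ e < K.m, s.mem aCnt e = 0)
    (hp : ∀ v < K.l, s.mem aPtr v = K.hi v) :
    WP W permLoop s fun s' t => ∃ Q : List (List ℕ), Q.Nodup ∧ Q ≠ [] ∧
      (∀ q, q ∈ Q ↔ K.IsSol q ∧ ∃ g, K.Good T g ∧ (∀ v < K.l, K.exits q v = K.sched g v) ∧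
        K.key (s.mem aA) ≤ K.key g) ∧
      s'.out = s.out ++ Q.flatMap (Core.enc ta ha) ∧
      t ≤ 250 * (K.l + K.M + 1) * Q.length + 2 := by
  -- Induction on the number of greater schedules for the same tree, which is finite by
  -- `Core.finite_good_keys`.
  suffices H : ∀ N s, {κ | (∃ f, K.Good T f ∧ κ = K.key f) ∧ K.key (s.mem aA) < κ}.ncard ≤ N →
      Holds K ta ha s → s.reg rMore = 1 → K.Good T (s.mem aA) → (∀ e < K.m, s.mem aCnt e = 0) →
      (∀ v < K.l, s.mem aPtr v = K.hi v) →
      WP W permLoop s fun s' t => ∃ Q : List (List ℕ), Q.Nodup ∧ Q ≠ [] ∧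
        (∀ q, q ∈ Q ↔ K.IsSol q ∧ ∃ g, K.Good T g ∧ (∀ v < K.l, K.exits q v = K.sched g v) ∧
          K.key (s.mem aA) ≤ K.key g) ∧
        s'.out = s.out ++ Q.flatMap (Core.enc ta ha) ∧
        t ≤ 250 * (K.l + K.M + 1) * Q.length + 2 from
    H _ s le_rfl hs hmore hA hc hp
  have hmM := hK.m_le
  intro N
  induction N with
  | zero => ?_
  | succ N ih => ?_
  all_goals
    intro s hN hs hmore hA hc hp
    obtain ⟨q, hq, hqs⟩ := hA.exists_sol hK hT
    set A := s.mem aA with hAdef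
    -- Equal schedules give equal sequences of exits, and these determine the cycle.
    have hbase : ∀ q', K.IsSol q' → ∀ g, (∀ v < K.l, K.exits q' v = K.sched g v) →
        K.key g = K.key A → q' = q := fun q' hq' g he hk =>
      hq'.walk.eq_of_exits hq.walk fun i hi => by
        rw [he _ (hK.tl_lt i hi), hqs _ (hK.tl_lt i hi),
          Core.sched_eq_of_key hK hk (hK.tl_lt i hi)]
    refine wp_loop_of_ne_zero (by simp [hmore]) ?_
    rw [wp_seq]
    refine (walk_spec hK hW hs hq hqs).mono fun s₁ t₁ hf₁ ⟨ho₁, ht₁⟩ => ?_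
    have hh₁ := hs.frame hf₁ (by decide) (by decide)
    have hA₁ : s₁.mem aA = A := hf₁.mem _ (by decide)
    have hC₁ : s₁.mem aCnt = s.mem aCnt := hf₁.mem _ (by decide)
    have hP₁ : s₁.mem aPtr = s.mem aPtr := hf₁.mem _ (by decide)
    rw [wp_seq]
    refine (next_spec hK hW hh₁ (T := T) (by rwa [hA₁]) (by rwa [hC₁]) (by rwa [hP₁])).mono
      fun s₂ t₂ hf₂ ⟨h₂, ht₂⟩ => ?_
    have hh₂ := hh₁.frame hf₂ (by decide) (by decide)
    have ho₂ : s₂.out = s₁.out := hf₂.out (by decide)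
    rw [hA₁] at h₂
    rw [wp_ite]
    refine ⟨fun hm => ?_, fun hm => ?_⟩
  case zero.refine_2 | succ.refine_2 =>
    simp only [Expr.eval] at hm
    rw [wp_skip]
    refine wp_loop_of_eq_zero hm ⟨[q], by simp, by simp, fun q' => ?_, by simp [ho₂, ho₁], ?_⟩
    · rw [List.mem_singleton]
      constructor
      · rintro rfl
        exact ⟨hq, A, hA, hqs, le_rfl⟩
      · rintro ⟨hq', g, hg, he, hk⟩
        refine hbase q' hq' g he (le_antisymm ?_ hk)
        rcases h₂ with ⟨-, h₂⟩ | ⟨h₂, -⟩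
        · exact h₂ g hg
        · omega
    · simp only [Expr.cost, List.length_singleton]
      omega
  all_goals
    simp only [Expr.eval] at hm
    rcases h₂ with ⟨h₂, -⟩ | ⟨h₂, i, hinc⟩
    · exact absurd h₂ hm
    have hvac : ∀ p, K.Vacant (s₂.mem aPtr) p ↔ K.Free p ∧ i + 1 ≤ p := fun p => by
      rw [hK.vacant_congr hinc.ptr_eq, hK.vacant_level]
    refine (fill_spec hK hW hh₂ hinc.part).mono fun s₃ t₃ hf₃ ⟨⟨hg₃, hc₃, hp₃, hag, hasc⟩, ht₃⟩ => ?_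
    have hh₃ := hh₂.frame hf₃ (by decide) (by decide)
    have ho₃ : s₃.out = s₂.out := hf₃.out (by decide)
    have hm₃ : s₃.reg rMore = 1 := (hf₃.reg _ (by decide)).trans h₂
    have hi₃ : s₃.mem aA i = s₂.mem aA i := hag i hinc.lt fun h => by
      have := ((hvac i).1 h).2
      omega
    have hbelow : ∀ p < i, A p = s₃.mem aA p := fun p hpi => by
      rw [hag p (hpi.trans hinc.lt) fun h => by have := ((hvac p).1 h).2; omega,
        hinc.agree p hpi.ne]
    have hlt : K.key A < K.key (s₃.mem aA) :=
      Core.key_lt_key.2 ⟨i, hinc.lt, hbelow, by rw [hi₃]; exact hinc.inc⟩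
    have hsucc : ∀ g, K.Good T g → K.key A < K.key g → K.key (s₃.mem aA) ≤ K.key g :=
      fun g hg hAg => hA.key_le_of_succ hK hg₃ hg hinc.lt hbelow (by rw [hi₃]; exact hinc.inc)
        (by rw [hi₃]; exact hinc.least) hinc.desc
        (fun p p' h₁ h₃ h₄ h₅ h₆ => hasc p p' h₃ ((hvac p).2 ⟨h₄, h₁⟩)
          ((hvac p').2 ⟨h₅, by omega⟩) h₆) hAg
    have hcard : {κ | (∃ f, K.Good T f ∧ κ = K.key f) ∧ K.key (s₃.mem aA) < κ}.ncard <
        {κ | (∃ f, K.Good T f ∧ κ = K.key f) ∧ K.key A < κ}.ncard := by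
      refine Set.ncard_lt_ncard ?_ ((Core.finite_good_keys T).subset fun κ h => h.1)
      refine ⟨fun κ h => ⟨h.1, hlt.trans h.2⟩, fun h => ?_⟩
      exact lt_irrefl _ (h ⟨⟨_, hg₃, rfl⟩, hlt⟩ : _ ∧ _).2
  -- The bound says that no greater schedule exists, but one has just been built.
  case zero => omega
  case succ =>
    refine (ih s₃ (by omega) hh₃ hm₃ hg₃ hc₃ hp₃).mono fun s₄ t₄ hf₄ h₄ => ?_
    obtain ⟨Q, hnd, hne, hmem, ho₄, ht₄⟩ := h₄
    refine ⟨q :: Q, ?_, by simp, fun q' => ?_, by simp [ho₄, ho₃, ho₂, ho₁], ?_⟩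
    · refine List.nodup_cons.2 ⟨fun hin => ?_, hnd⟩
      obtain ⟨-, g, hg, he, hk⟩ := (hmem q).1 hin
      have : K.key A = K.key g := Core.key_eq_of_sched hK fun v hv => by
        rw [← hqs v hv, he v hv]
      rw [← this] at hk
      exact absurd hlt (not_lt.2 hk)
    · rw [List.mem_cons, hmem]
      constructor
      · rintro (rfl | ⟨h₁, g, hg, he, hk⟩)
        · exact ⟨hq, A, hA, hqs, le_rfl⟩
        · exact ⟨h₁, g, hg, he, hlt.le.trans hk⟩
      · rintro ⟨hq', g, hg, he, hk⟩
        rcases hk.eq_or_lt with hk | hk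
        · exact .inl (hbase q' hq' g he hk.symm)
        · exact .inr ⟨hq', g, hg, he, hsucc g hg hk⟩
    · simp only [Expr.cost, List.length_cons]
      rw [Nat.mul_succ]
      omega

end RAM

/-! ### All solutions with a given tree -/

namespace RAM

open RAM.Expr RAM.Prog

/-- Placing the compulsory first exits. -/
def prioProg : Prog :=
  set rJ (const 0) ;;
  loop (sub (var rEdges) (var rJ))
    (put aCnt (var rJ) (get aMult (var rJ)) ;;
    ite (get aPr (var rJ))
      (put aA (get aSt (get aTl (var rJ))) (var rJ) ;;
      put aPtr (get aTl (var rJ)) (add (get aPtr (get aTl (var rJ))) (const 1)) ;;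
      put aCnt (var rJ) (sub (get aCnt (var rJ)) (const 1)))
      skip ;;
    set rJ (add (var rJ) (const 1)))

/-- Placing the exits in the tree. -/
def lastProg : Prog :=
  set rV (const 1) ;;
  loop (sub (var rNodes) (var rV))
    (put aA (sub (get aSt (add (var rV) (const 1))) (const 1)) (get aT (var rV)) ;;
    put aCnt (get aT (var rV)) (sub (get aCnt (get aT (var rV))) (const 1)) ;;
    set rV (add (var rV) (const 1)))

/-- Output of all solutions whose last exits are given by the tree in memory. -/
def treeProg : Prog :=
  resetProg aPtr ;;
  prioProg ;;
  lastProg ;;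
  fillProg ;;
  set rMore (const 1) ;;
  permLoop

theorem mu_le {K : Core} (hK : K.Valid) {i : ℕ} (hi : i < K.m) : K.mu i ≤ K.M := by
  rw [← hK.sum_mu]
  exact Finset.single_le_sum (f := K.mu) (fun _ _ => Nat.zero_le _) (by simp [hi])

theorem prio_spec {K : Core} (hK : K.Valid) {ta ha : ℕ → ℕ} {W : ℕ} (hW : Fits K ta ha W)
    {s : State} (hs : Holds K ta ha s) (hptr : ∀ v < K.l, s.mem aPtr v = K.st v) :
    WP W prioProg s fun s' t => (∀ v < K.l, s'.mem aPtr v = K.lo v) ∧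
      (∀ e < K.m, s'.mem aCnt e + (if K.pr e ≠ 0 then 1 else 0) = K.mu e) ∧
      (∀ i < K.m, K.pr i ≠ 0 → s'.mem aA (K.st (K.tl i)) = i) ∧ t ≤ 50 * (K.m + 1) := by
  have hsz := hW.size
  simp only [prioProg, wp_seq, wp_set, Expr.eval, Expr.cost]
  refine ⟨by omega, ?_⟩
  refine WP.loop (fun s₁ => (s₁.reg rEdges = K.m ∧ s₁.mem aTl = K.tl ∧ s₁.mem aMult = K.mu ∧
      s₁.mem aPr = K.pr ∧ s₁.mem aSt = K.st) ∧ s₁.reg rJ ≤ K.m ∧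
      (∀ v < K.l, s₁.mem aPtr v =
        K.st v + {i ∈ Finset.range (s₁.reg rJ) | K.pr i ≠ 0 ∧ K.tl i = v}.card) ∧
      (∀ e < s₁.reg rJ, s₁.mem aCnt e + (if K.pr e ≠ 0 then 1 else 0) = K.mu e) ∧
      ∀ i < s₁.reg rJ, K.pr i ≠ 0 → s₁.mem aA (K.st (K.tl i)) = i)
    (fun s₁ => 40 * (K.m - s₁.reg rJ)) ?_ ?_ ?_
  · simp [hs.m, hs.tl, hs.mu, hs.pr, hs.st]
    exact hptr
  · rintro s₁ - ⟨⟨h₁, h₂, h₃, h₄, h₅⟩, hj, hp, hc, hA⟩ h0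
    simp only [Expr.eval, h₁] at h0
    set j := s₁.reg rJ with hjdef
    have hjm : j < K.m := by omega
    have hv := hK.tl_lt j hjm
    have hmu := mu_le hK hjm
    have hmp := hK.mu_pos j hjm
    have hstM := hK.st_add_outDeg_le hv
    have hod := hK.outDeg_pos hjm
    have hcard : ∀ v, {i ∈ Finset.range (j + 1) | K.pr i ≠ 0 ∧ K.tl i = v}.card =
        {i ∈ Finset.range j | K.pr i ≠ 0 ∧ K.tl i = v}.card +
          (if K.pr j ≠ 0 ∧ K.tl j = v then 1 else 0) := fun v => by
      rw [Finset.range_add_one, Finset.filter_insert]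
      split_ifs with h
      · rw [Finset.card_insert_of_notMem (by simp)]
      · rfl
    have hcle : ∀ v, {i ∈ Finset.range (j + 1) | K.pr i ≠ 0 ∧ K.tl i = v}.card ≤ K.numPrio v :=
      fun v => Finset.card_le_card (Finset.filter_subset_filter _
        (Finset.range_subset_range.2 hjm))
    have hn1 := hK.numPrio_le_one (K.tl j)
    have hptrj := hp _ hv
    have hcj := hcle (K.tl j)
    rw [hcard] at hcj
    simp only [wp_seq, wp_put, wp_set, wp_ite, wp_skip, Expr.eval, Expr.cost, State.setMem_reg,
      State.setReg_reg, State.setReg_mem, State.setMem_mem, Nat.reduceEqDiff, if_false, if_true,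
      h₁, h₂, h₃, h₄, h₅, ← hjdef, Function.update_self]
    refine ⟨⟨by omega, by omega⟩, fun hpr => ?_, fun hpr => ?_⟩
    · rw [if_pos ⟨hpr, rfl⟩] at hcj
      refine ⟨⟨by omega, by omega⟩, ⟨by omega, by omega⟩, ⟨by omega, by omega⟩, by omega,
        ⟨⟨trivial, trivial, trivial, trivial, trivial⟩, by omega, fun v hvl => ?_, fun e he => ?_,
          fun i hi hpi => ?_⟩, by omega⟩
      · rw [hcard]
        by_cases hvj : v = K.tl j
        · subst hvj
          rw [Function.update_self, hptrj, if_pos ⟨hpr, rfl⟩]; omega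
        · rw [Function.update_of_ne hvj, hp v hvl, if_neg fun h => hvj h.2.symm]
          omega
      · by_cases hej : e = j
        · subst hej
          rw [Function.update_self, if_pos hpr]; omega
        · rw [Function.update_of_ne hej, Function.update_of_ne hej]
          exact hc e (by omega)
      · by_cases hij : i = j
        · subst hij; rw [Function.update_self]
        · have him : i < j := by omega
          -- The blocks of two tails are nonempty and start at different positions, so the new entry
          -- does not overwrite that of `i`.
          have hne : K.tl i ≠ K.tl j := fun h =>
            hij (hK.pr_unique i (by omega) j hjm hpi hpr h)
          rw [Function.update_of_ne, hA i him hpi]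
          intro he
          have h₆ := hK.outDeg_pos (i := i) (by omega)
          have h₇ := hK.tl_lt i (by omega)
          have h₈ := hK.st_succ _ h₇
          have h₉ := hK.st_succ _ hv
          have h₁₀ := hK.blk_eq h₇ le_rfl (by omega)
          have h₁₁ := hK.blk_eq hv le_rfl (by omega)
          rw [he] at h₁₀
          exact hne (h₁₀.symm.trans h₁₁)
    · have hpr' : K.pr j = 0 := hpr
      refine ⟨by omega, ⟨⟨trivial, trivial, trivial, trivial, trivial⟩, by omega, fun v hvl => ?_,
        fun e he => ?_, fun i hi hpi => ?_⟩, by omega⟩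
      · rw [hcard, hp v hvl, if_neg fun h => h.1 hpr']; omega
      · by_cases hej : e = j
        · subst hej
          rw [Function.update_self, if_neg fun h => h hpr']; omega
        · rw [Function.update_of_ne hej]
          exact hc e (by omega)
      · refine hA i ?_ hpi
        rcases Nat.lt_succ_iff_lt_or_eq.1 hi with h | rfl
        · exact h
        · exact absurd hpr' hpi
  · rintro s₁ t - ⟨⟨h₁, h₂, h₃, h₄, h₅⟩, hj, hp, hc, hA⟩ h0 ht
    simp only [Expr.eval, h₁] at h0
    have hjm : s₁.reg rJ = K.m := by omega
    rw [hjm] at hp hc hA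
    refine ⟨hp, hc, hA, ?_⟩
    simp only [Expr.cost, State.setReg_reg, if_true] at ht
    omega

theorem last_spec {K : Core} (hK : K.Valid) {ta ha : ℕ → ℕ} {W : ℕ} (hW : Fits K ta ha W)
    {s : State} (hs : Holds K ta ha s) (hT : K.Arb (s.mem aT))
    (hcnt : ∀ e < K.m, s.mem aCnt e + (if K.pr e ≠ 0 then 1 else 0) = K.mu e)
    (hprio : ∀ i < K.m, K.pr i ≠ 0 → s.mem aA (K.st (K.tl i)) = i) :
    WP W lastProg s fun s' t =>
      (∀ i < K.m, K.pr i ≠ 0 → s'.mem aA (K.st (K.tl i)) = i) ∧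
      (∀ v, 0 < v → v < K.l → s'.mem aA (K.st (v + 1) - 1) = s.mem aT v) ∧
      (∀ e < K.m, s'.mem aCnt e + (if K.pr e ≠ 0 then 1 else 0) +
        (if K.tl e ≠ 0 ∧ s.mem aT (K.tl e) = e then 1 else 0) = K.mu e) ∧
      t ≤ 30 * (K.l + 1) := by
  have hsz := hW.size
  have hl := hK.l_pos
  set T := s.mem aT with hTdef
  simp only [lastProg, wp_seq, wp_set, Expr.eval, Expr.cost]
  refine ⟨by omega, ?_⟩
  refine WP.loop (fun s₁ => (s₁.reg rNodes = K.l ∧ s₁.mem aT = T ∧ s₁.mem aSt = K.st) ∧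
      0 < s₁.reg rV ∧ s₁.reg rV ≤ K.l ∧
      (∀ i < K.m, K.pr i ≠ 0 → s₁.mem aA (K.st (K.tl i)) = i) ∧
      (∀ v, 0 < v → v < s₁.reg rV → s₁.mem aA (K.st (v + 1) - 1) = T v) ∧
      (∀ e < K.m, s₁.mem aCnt e + (if K.pr e ≠ 0 then 1 else 0) +
        (if K.tl e ≠ 0 ∧ K.tl e < s₁.reg rV ∧ T (K.tl e) = e then 1 else 0) = K.mu e))
    (fun s₁ => 30 * (K.l - s₁.reg rV)) ?_ ?_ ?_
  · simp only [State.setReg_reg, State.setReg_mem, Nat.reduceEqDiff, if_false, if_true]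
    refine ⟨⟨hs.l, rfl, hs.st⟩, by omega, by omega, hprio, fun v h₁ h₂ => by omega,
      fun e he => ?_⟩
    rw [if_neg (show ¬ (K.tl e ≠ 0 ∧ K.tl e < 1 ∧ T (K.tl e) = e) by omega)]
    exact hcnt e he
  · rintro s₁ - ⟨⟨h₁, h₂, h₃⟩, h0v, hvl, hA, hL, hc⟩ h0
    simp only [Expr.eval, h₁] at h0
    set v := s₁.reg rV with hvdef
    have hv : v < K.l := by omega
    have hTm := hT.lt v h0v hv
    have hTt := hT.tl v h0v hv
    have hTp := hT.pr v h0v hv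
    have hod := hK.outDeg_pos' h0v hv
    have hss := hK.st_succ v hv
    have hsM := hK.st_add_outDeg_le hv
    have hcT := hc _ hTm
    have hmu := mu_le hK hTm
    have hmp := hK.mu_pos _ hTm
    rw [if_neg fun h => h hTp, hTt, if_neg (by omega)] at hcT
    simp only [wp_seq, wp_put, wp_set, Expr.eval, Expr.cost, State.setMem_reg,
      State.setReg_reg, State.setReg_mem, State.setMem_mem, Nat.reduceEqDiff, if_false, if_true,
      h₁, h₂, h₃, ← hvdef]
    refine ⟨by omega, by omega, by omega, ⟨⟨trivial, trivial, trivial⟩, by omega, by omega,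
      fun i hi hpi => ?_, fun u hu0 hu => ?_, fun e he => ?_⟩, by omega⟩
    -- The tree exit does not overwrite a compulsory first exit: blocks of different nodes are
    -- disjoint, and within one block `pr_two` separates first and last position.
    · rw [Function.update_of_ne, hA i hi hpi]
      have hod' := hK.outDeg_pos hi
      have htl := hK.tl_lt i hi
      have hss' := hK.st_succ _ htl
      rcases lt_trichotomy (K.tl i) v with h | h | h
      · have := hK.st_mono (show K.tl i + 1 ≤ v from h) hv.le
        omega
      · have := hK.pr_two i hi hpi (by omega)
        rw [h] at this ⊢
        omega
      · have := hK.st_mono (show v + 1 ≤ K.tl i from h) htl.le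
        omega
    · by_cases huv : u = v
      · subst huv; rw [Function.update_self]
      · rw [Function.update_of_ne, hL u hu0 (by omega)]
        have := hK.st_mono (show u + 1 ≤ v by omega) hv.le
        have := hK.st_succ u (by omega)
        have := hK.outDeg_pos' hu0 (by omega)
        omega
    · have hce := hc e he
      by_cases heT : e = T v
      · subst heT
        rw [Function.update_self, hTt, if_neg fun h => h hTp, if_pos ⟨by omega, by omega, rfl⟩]
        omega
      · rw [Function.update_of_ne heT]
        have hiff : (K.tl e ≠ 0 ∧ K.tl e < v + 1 ∧ T (K.tl e) = e) ↔
            (K.tl e ≠ 0 ∧ K.tl e < v ∧ T (K.tl e) = e) := by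
          refine and_congr_right fun _ => ⟨fun h => ⟨?_, h.2⟩, fun h => ⟨by omega, h.2⟩⟩
          rcases Nat.lt_succ_iff_lt_or_eq.1 h.1 with h' | h'
          · exact h'
          · rw [h'] at h
            exact absurd h.2.symm heT
        rw [if_congr hiff rfl rfl]
        exact hce
  · rintro s₁ t - ⟨⟨h₁, h₂, h₃⟩, h0v, hvl, hA, hL, hc⟩ h0 ht
    simp only [Expr.eval, h₁] at h0
    have hve : s₁.reg rV = K.l := by omega
    rw [hve] at hL hc
    refine ⟨hA, hL, fun e he => ?_, ?_⟩
    · have := hc e he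
      simpa only [hK.tl_lt e he, true_and] using this
    · simp only [Expr.cost, State.setReg_reg, if_true] at ht
      omega

/-- Filling all free positions in ascending order produces the least schedule for the tree, so the
list from there on is complete. -/
theorem tree_spec {K : Core} (hK : K.Valid) {ta ha : ℕ → ℕ} {W : ℕ} (hW : Fits K ta ha W)
    {s : State} (hs : Holds K ta ha s) (hT : K.Arb (s.mem aT)) :
    WP W treeProg s fun s' t => ∃ Q : List (List ℕ), Q.Nodup ∧ Q ≠ [] ∧
      (∀ q, q ∈ Q ↔ q ∈ K.solsOf (s.mem aT)) ∧
      s'.out = s.out ++ Q.flatMap (Core.enc ta ha) ∧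
      t ≤ 500 * ((K.l + K.M + 1) * Q.length) := by
  have hsz := hW.size
  have hmM := hK.m_le
  simp only [treeProg]
  rw [wp_seq]
  refine (reset_spec hK hW hs (a := aPtr) (by simp)).mono fun s₁ t₁ hf₁ ⟨hptr, ht₁⟩ => ?_
  have hh₁ := hs.frame hf₁ (by decide) (by decide)
  rw [wp_seq]
  refine (prio_spec hK hW hh₁ hptr).mono fun s₂ t₂ hf₂ ⟨hptr₂, hcnt₂, hprio₂, ht₂⟩ => ?_
  have hh₂ := hh₁.frame hf₂ (by decide) (by decide)
  have hT₂ : s₂.mem aT = s.mem aT := by rw [hf₂.mem _ (by decide), hf₁.mem _ (by decide)]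
  rw [wp_seq]
  refine (last_spec hK hW hh₂ (by rwa [hT₂]) hcnt₂ hprio₂).mono
    fun s₃ t₃ hf₃ ⟨hprio₃, hlast₃, hcnt₃, ht₃⟩ => ?_
  have hh₃ := hh₂.frame hf₃ (by decide) (by decide)
  rw [hT₂] at hlast₃ hcnt₃
  have hptr₃ : ∀ v < K.l, s₃.mem aPtr v = K.lo v := fun v hv => by
    rw [hf₃.mem _ (by decide), hptr₂ v hv]
  have hpart := hT.partial_init hK hprio₃ hlast₃ hcnt₃ hptr₃
  rw [wp_seq]
  refine (fill_spec hK hW hh₃ hpart).mono fun s₄ t₄ hf₄ ⟨⟨hg, hc, hp, _, hasc⟩, ht₄⟩ => ?_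
  have hh₄ := hh₃.frame hf₄ (by decide) (by decide)
  have ho₄ : s₄.out = s.out := by
    rw [hf₄.out (by decide), hf₃.out (by decide), hf₂.out (by decide), hf₁.out (by decide)]
  rw [wp_seq, wp_set]
  simp only [Expr.eval, Expr.cost]
  refine ⟨by omega, ?_⟩
  refine (permLoop_spec hK hW hT (s := s₄.setReg rMore 1) ⟨hh₄.l, hh₄.m, hh₄.M, hh₄.tl, hh₄.hd,
    hh₄.mu, hh₄.pr, hh₄.st, hh₄.t0, hh₄.en, hh₄.ta, hh₄.ha⟩ (by simp) hg hc hp).mono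
    fun s₅ t₅ _ h => ?_
  obtain ⟨Q, hnd, hne, hmem, ho, ht₅⟩ := h
  refine ⟨Q, hnd, hne, fun q => ?_, by rw [ho, State.setReg_out, ho₄], ?_⟩
  · rw [hmem, Core.mem_solsOf_iff hK]
    refine and_congr_right fun _ => exists_congr fun g => and_congr_right fun hg' =>
      and_iff_left ?_
    refine hg.key_le_of_ascending hK hg' (q := 0) (by simp) fun p p' _ h₁ h₂ h₃ h₄ => ?_
    have hv := hK.vacant_congr hptr₃
    exact hasc p p' h₁ ((hv p).2 h₂) ((hv p').2 h₃) h₄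
  · have hlen : 1 ≤ Q.length := List.length_pos_iff.2 hne
    have := Nat.mul_le_mul_left (K.l + K.M + 1) hlen
    rw [Nat.mul_assoc] at ht₅
    omega

end RAM

/-! ### Distances to marked nodes -/

namespace Core

variable {K : Core}

/-- The path of `T` from `u` reaches a node with nonzero mark after `k` steps. -/
inductive Dist (K : Core) (T X : ℕ → ℕ) : ℕ → ℕ → Prop
  | zero (u : ℕ) : X u ≠ 0 → Dist K T X u 0
  | succ (u k : ℕ) : X u = 0 → Dist K T X (K.hd (T u)) k → Dist K T X u (k + 1)

theorem Reaches.exists_dist {T X : ℕ → ℕ} (h0 : X 0 ≠ 0) {u : ℕ} (h : K.Reaches T u) :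
    ∃ k, K.Dist T X u k := by
  induction h with
  | root => exact ⟨0, .zero 0 h0⟩
  | step u _ _ ih =>
    obtain ⟨k, hk⟩ := ih
    by_cases hu : X u = 0
    · exact ⟨k + 1, .succ u k hu hk⟩
    · exact ⟨0, .zero u hu⟩

theorem Dist.unique {T X : ℕ → ℕ} {u k k' : ℕ} (h : K.Dist T X u k) (h' : K.Dist T X u k') :
    k = k' := by
  induction h generalizing k' with
  | zero u hu =>
    cases h' with
    | zero => rfl
    | succ _ _ h _ => exact absurd h hu
  | succ u k hu _ ih =>
    cases h' with
    | zero _ h => exact absurd hu h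
    | succ _ _ _ h => rw [ih h]

/-- All nodes on the path from `w` to its first mark have distance at most `k`, so `u` is not among
them. -/
theorem Dist.update {T X : ℕ → ℕ} {u w k k' x : ℕ} (h : K.Dist T X w k) (hu : K.Dist T X u k')
    (hk : k < k') : K.Dist T (Function.update X u x) w k := by
  induction h with
  | zero w hw =>
    have hne : w ≠ u := by
      rintro rfl
      have := (Dist.zero w hw).unique hu
      omega
    exact .zero w (by rwa [Function.update_of_ne hne])
  | succ w k hw hd ih =>
    have hne : w ≠ u := by
      rintro rfl
      have := (Dist.succ w k hw hd).unique hu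
      omega
    exact .succ w k (by rwa [Function.update_of_ne hne]) (ih (by omega))

/-- The number of nodes without a mark. -/
def numUnset (K : Core) (X : ℕ → ℕ) : ℕ := {w ∈ Finset.range K.l | X w = 0}.card

theorem numUnset_update {X : ℕ → ℕ} {u x : ℕ} (hu : u < K.l) (h0 : X u = 0) (hx : x ≠ 0) :
    K.numUnset (Function.update X u x) + 1 = K.numUnset X := by
  rw [numUnset, numUnset, ← Finset.card_erase_add_one (s := {w ∈ Finset.range K.l | X w = 0})
    (a := u) (by simp [hu, h0])]
  congr 2
  ext w
  by_cases hw : w = u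
  · subst hw; simp [hx]
  · simp [hw]

theorem numUnset_le (X : ℕ → ℕ) : K.numUnset X ≤ K.l :=
  (Finset.card_filter_le _ _).trans_eq (Finset.card_range _)

theorem Stage.hd_lt (hK : K.Valid) {T : ℕ → ℕ} {d : ℕ} (h : K.Stage T d) {u : ℕ} (hd : d ≤ u)
    (hu : u < K.l) : K.hd (T u) < K.l :=
  hK.hd_lt _ (h.arb.lt u (by have := h.pos; omega) hu)

end Core

/-! ### Entries of all paths into the nodes below `rD` -/

namespace RAM

open RAM.Expr RAM.Prog

/-- Marking the nodes below `rD` by themselves, plus one, and unmarking the others. -/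
def markProg : Prog :=
  set rV (const 0) ;;
  loop (sub (var rNodes) (var rV))
    (ite (sub (var rD) (var rV))
      (put aX (var rV) (add (var rV) (const 1)))
      (put aX (var rV) (const 0)) ;;
    set rV (add (var rV) (const 1)))

/-- Passing on the mark of the first marked node on the path from `rV` to the nodes before it. -/
def passProg : Prog :=
  set rU (var rV) ;;
  loop (sub (const 1) (get aX (var rU)))
    (set rU (get aHd (get aT (var rU)))) ;;
  set rE (get aX (var rU)) ;;
  set rU (var rV) ;;
  loop (sub (const 1) (get aX (var rU)))
    (put aX (var rU) (var rE) ;;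
    set rU (get aHd (get aT (var rU)))) ;;
  set rV (add (var rV) (const 1))

/-- Computing for all nodes the first node below `rD` on the path to the root. -/
def entryProg : Prog :=
  markProg ;;
  set rV (const 0) ;;
  loop (sub (var rNodes) (var rV)) passProg

/-- The situation at the head of the main loop. -/
structure AtHead (K : Core) (ta ha : ℕ → ℕ) (T : ℕ → ℕ) (d i : ℕ) (s : State) : Prop where
  holds : Holds K ta ha s
  tree : s.mem aT = T
  d : s.reg rD = d
  i : s.reg rI = i
  run : s.reg rRun = 1

theorem mark_spec {K : Core} {ta ha : ℕ → ℕ} {W : ℕ} (hW : Fits K ta ha W)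
    {s : State} (hs : Holds K ta ha s) :
    WP W markProg s fun s' t => (∀ v < K.l, s'.mem aX v = if v < s.reg rD then v + 1 else 0) ∧
      t ≤ 20 * (K.l + 1) := by
  have hsz := hW.size
  simp only [markProg, wp_seq, wp_set, Expr.eval, Expr.cost]
  refine ⟨by omega, ?_⟩
  refine WP.loop (fun s₁ => s₁.reg rNodes = K.l ∧ s₁.reg rD = s.reg rD ∧ s₁.reg rV ≤ K.l ∧
    ∀ v < s₁.reg rV, s₁.mem aX v = if v < s.reg rD then v + 1 else 0)
    (fun s₁ => 20 * (K.l - s₁.reg rV)) ?_ ?_ ?_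
  · simp [hs.l]
  · rintro s₁ - ⟨h₁, h₂, h₃, h₄⟩ h0
    simp only [Expr.eval, h₁] at h0
    simp only [wp_seq, wp_put, wp_set, wp_ite, Expr.eval, Expr.cost, State.setMem_reg,
      State.setReg_reg, State.setReg_mem, State.setMem_mem, Nat.reduceEqDiff, if_false, h₁, h₂,
      if_true]
    refine ⟨fun h => ⟨by omega, by omega, ⟨trivial, trivial, by omega, fun v hv => ?_⟩, by omega⟩,
      fun h => ⟨by omega, by omega, ⟨trivial, trivial, by omega, fun v hv => ?_⟩, by omega⟩⟩
    · by_cases hvv : v = s₁.reg rV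
      · subst hvv; rw [Function.update_self, if_pos (by omega)]
      · rw [Function.update_of_ne hvv]; exact h₄ v (by omega)
    · by_cases hvv : v = s₁.reg rV
      · subst hvv; rw [Function.update_self, if_neg (by omega)]
      · rw [Function.update_of_ne hvv]; exact h₄ v (by omega)
  · rintro s₁ t - ⟨h₁, h₂, h₃, h₄⟩ h0 ht
    simp only [Expr.eval, h₁] at h0
    simp only [Expr.cost] at ht
    refine ⟨fun v hv => h₄ v (by omega), ?_⟩
    simp only [State.setReg_reg, if_true] at ht
    omega

/-- All marks are right. -/
structure Marks (K : Core) (T : ℕ → ℕ) (d : ℕ) (X : ℕ → ℕ) : Prop where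
  below : ∀ w < d, X w ≠ 0
  entry : ∀ w < K.l, X w ≠ 0 → ∃ y, X w = y + 1 ∧ K.Entry T d w y

/-- The path is followed twice, once to find the mark and once to copy it. Its `k` unmarked nodes
become marked for good, and the drop of `numUnset` pays for both passes. -/
theorem pass_spec {K : Core} (hK : K.Valid) {ta ha : ℕ → ℕ} {W : ℕ} (hW : Fits K ta ha W)
    {s : State} {T : ℕ → ℕ} {d : ℕ} (hT : K.Stage T d) (hsT : s.mem aT = T)
    (hshd : s.mem aHd = K.hd) (hX : Marks K T d (s.mem aX)) (hv : s.reg rV < K.l) :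
    WP W passProg s fun s' t => Marks K T d (s'.mem aX) ∧
      (∀ w, s.mem aX w ≠ 0 → s'.mem aX w ≠ 0) ∧ s'.mem aX (s.reg rV) ≠ 0 ∧
      s'.reg rV = s.reg rV + 1 ∧
      t + 40 * K.numUnset (s'.mem aX) ≤ 40 * K.numUnset (s.mem aX) + 40 := by
  have hsz := hW.size
  have hdl := hT.le
  obtain ⟨k, hk⟩ := (hT.arb.reaches _ hv).exists_dist (hX.below 0 hT.pos)
  simp only [passProg, wp_seq, wp_set, Expr.eval, Expr.cost]
  refine ⟨by omega, ?_⟩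
  refine WP.loop_pot (fun s₁ N₁ => (s₁.mem = s.mem ∧ s₁.reg rV = s.reg rV) ∧
    s₁.reg rU < K.l ∧ (∀ y, K.Entry T d (s₁.reg rU) y → K.Entry T d (s.reg rV) y) ∧
    ∃ k', K.Dist T (s.mem aX) (s₁.reg rU) k' ∧ N₁ = 15 * k') (15 * k) ?_ ?_ ?_
  · simp only [State.setReg_reg, State.setReg_mem, Nat.reduceEqDiff, if_false, if_true]
    exact ⟨⟨trivial, trivial⟩, hv, fun _ h => h, k, hk, rfl⟩
  · rintro s₁ _ - ⟨⟨h₁, h₂⟩, hu, he, k', hk', rfl⟩ h0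
    simp only [Expr.eval, h₁] at h0
    have hx : s.mem aX (s₁.reg rU) = 0 := by omega
    have hdu : d ≤ s₁.reg rU := by
      by_contra hc
      exact hX.below _ (by omega) hx
    have hh := hT.hd_lt hK hdu hu
    simp only [wp_set, Expr.eval, Expr.cost, State.setReg_reg, State.setReg_mem, h₁, h₂, hsT, hshd,
      if_true, Nat.reduceEqDiff, if_false]
    cases hk' with
    | zero _ h => exact absurd hx h
    | succ _ k' _ hk' =>
      exact ⟨by omega, 15 * k', ⟨⟨trivial, trivial⟩, hh, fun y hy => he y (.step _ y hdu hy),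
        k', hk', rfl⟩, by omega⟩
  · rintro s₁ _ t₁ - ⟨⟨h₁, h₂⟩, hu, he, k', hk', rfl⟩ h0 ht₁
    simp only [Expr.eval, h₁] at h0
    obtain ⟨y, hy, hent⟩ := hX.entry _ hu (by omega : s.mem aX (s₁.reg rU) ≠ 0)
    have hyd := hent.lt
    have hentv := he y hent
    simp only [State.setReg_reg, State.setReg_mem, h₁, h₂, hy,
      if_true, Nat.reduceEqDiff, if_false]
    refine ⟨by omega, by omega, ?_⟩
    -- While marks are set, the distance `k'` to the next mark and the number of unmarked nodes sink
    -- together, from `k` down to `0`. `Dist.update` keeps the remaining distance valid after each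
    -- new mark.
    refine WP.loop_pot (fun s₂ N₂ => (s₂.mem aT = T ∧ s₂.mem aHd = K.hd ∧
      s₂.reg rV = s.reg rV ∧ s₂.reg rE = y + 1) ∧ s₂.reg rU < K.l ∧
      K.Entry T d (s₂.reg rU) y ∧ Marks K T d (s₂.mem aX) ∧
      (∀ w, s.mem aX w ≠ 0 → s₂.mem aX w ≠ 0) ∧
      (s₂.reg rU = s.reg rV ∨ s₂.mem aX (s.reg rV) ≠ 0) ∧
      ∃ k', K.Dist T (s₂.mem aX) (s₂.reg rU) k' ∧ N₂ = 20 * k' ∧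
        K.numUnset (s₂.mem aX) + k = K.numUnset (s.mem aX) + k') (20 * k) ?_ ?_ ?_
    · simp only [State.setReg_reg, State.setReg_mem, Nat.reduceEqDiff, if_false, if_true, h₁, h₂]
      exact ⟨⟨hsT, hshd, trivial, trivial⟩, hv, hentv, hX, fun _ h => h, .inl trivial, k, hk, rfl, rfl⟩
    · rintro s₂ _ - ⟨⟨h₃, h₄, h₅, h₆⟩, hu, hen, hX₂, hmono, hor, k', hk', rfl, hun⟩ h0
      simp only [Expr.eval] at h0
      have hx : s₂.mem aX (s₂.reg rU) = 0 := by omega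
      have hdu : d ≤ s₂.reg rU := by
        by_contra hc
        exact hX₂.below _ (by omega) hx
      have hh := hT.hd_lt hK hdu hu
      have hset : ∀ w, s₂.mem aX w ≠ 0 →
          Function.update (s₂.mem aX) (s₂.reg rU) (y + 1) w ≠ 0 := fun w hw => by
        by_cases hwu : w = s₂.reg rU
        · subst hwu; rw [Function.update_self]; omega
        · rwa [Function.update_of_ne hwu]
      have hun' := K.numUnset_update hu hx (show y + 1 ≠ 0 by omega)
      simp only [wp_seq, wp_put, wp_set, Expr.eval, Expr.cost, State.setMem_reg, State.setMem_mem,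
        State.setReg_reg, State.setReg_mem, h₃, h₄, h₅, h₆, if_true, Nat.reduceEqDiff, if_false]
      cases hk' with
      | zero _ h => exact absurd hx h
      | succ _ k' _ hk' =>
        have hk₂ := hk'.update (x := y + 1) (.succ _ k' hx hk') (Nat.lt_succ_self k')
        refine ⟨by omega, by omega, 20 * k', ⟨⟨trivial, trivial, trivial, trivial⟩, hh, ?_,
          ⟨fun w hw => hset w (hX₂.below w hw), fun w hw hw0 => ?_⟩,
          fun w hw => hset w (hmono w hw), ?_, k', hk₂, rfl, by omega⟩, by omega⟩
        · cases hen with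
          | base _ h => omega
          | step _ _ _ h => exact h
        · by_cases hwu : w = s₂.reg rU
          · subst hwu
            exact ⟨y, by rw [Function.update_self], hen⟩
          · rw [Function.update_of_ne hwu] at hw0 ⊢
            exact hX₂.entry w hw hw0
        · rcases hor with h | h
          · right
            rw [h, Function.update_self]
            omega
          · exact .inr (hset _ h)
    · rintro s₂ _ t₂ - ⟨⟨h₃, h₄, h₅, h₆⟩, hu, hen, hX₂, hmono, hor, k'', hk'', rfl, hun⟩ h0 ht₂
      simp only [Expr.eval] at h0
      simp only [h₅]
      simp only [Expr.cost] at ht₁ ht₂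
      refine ⟨by omega, hX₂, hmono, ?_, trivial, ?_⟩
      · rcases hor with h | h
        · rw [← h]; omega
        · exact h
      · cases hk'' with
        | zero => omega
        | succ _ _ h _ => omega

/-- A single path may be long, but every node is marked only once, so all passes together take
linear time. -/
theorem entry_spec {K : Core} (hK : K.Valid) {ta ha : ℕ → ℕ} {W : ℕ} (hW : Fits K ta ha W)
    {s : State} {T : ℕ → ℕ} {d i : ℕ} (hT : K.Stage T d) (hs : AtHead K ta ha T d i s) :
    WP W entryProg s fun s' t => (∀ w < K.l, ∃ y, s'.mem aX w = y + 1 ∧ K.Entry T d w y) ∧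
      t ≤ 140 * (K.l + 1) := by
  have hsz := hW.size
  simp only [entryProg]
  rw [wp_seq]
  refine (mark_spec hW hs.holds).mono fun s₁ t₁ hf₁ ⟨hX₁, ht₁⟩ => ?_
  have hh₁ := hs.holds.frame hf₁ (by decide) (by decide)
  have hT₁ : s₁.mem aT = T := (hf₁.mem _ (by decide)).trans hs.tree
  rw [hs.d] at hX₁
  simp only [wp_seq, wp_set, Expr.eval, Expr.cost]
  refine ⟨by omega, ?_⟩
  have hle := K.numUnset_le (s₁.mem aX)
  refine WP.loop (fun s₂ => (s₂.reg rNodes = K.l ∧ s₂.mem aT = T ∧ s₂.mem aHd = K.hd) ∧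
    s₂.reg rV ≤ K.l ∧ Marks K T d (s₂.mem aX) ∧ ∀ w < s₂.reg rV, s₂.mem aX w ≠ 0)
    (fun s₂ => 50 * (K.l - s₂.reg rV) + 40 * K.numUnset (s₂.mem aX)) ?_ ?_ ?_
  · simp only [State.setReg_reg, State.setReg_mem, Nat.reduceEqDiff, if_false, if_true]
    refine ⟨⟨hh₁.l, hT₁, hh₁.hd⟩, by omega, ⟨fun w hw => ?_, fun w hw hw0 => ?_⟩,
      fun w hw => by omega⟩
    · rw [hX₁ w (hw.trans_le hT.le), if_pos hw]; omega
    · rw [hX₁ w hw] at hw0 ⊢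
      by_cases h : w < d
      · exact ⟨w, by rw [if_pos h], .base w h⟩
      · rw [if_neg h] at hw0; omega
  · rintro s₂ - ⟨⟨h₁, h₂, h₃⟩, h₄, hX, h₅⟩ h0
    simp only [Expr.eval, h₁] at h0
    refine (pass_spec hK hW hT h₂ h₃ hX (by omega)).mono fun s₃ t₃ hf₃ ⟨h₆, h₇, h₈, h₉, h₁₀⟩ => ?_
    refine ⟨⟨⟨(hf₃.reg _ (by decide)).trans h₁, (hf₃.mem _ (by decide)).trans h₂,
      (hf₃.mem _ (by decide)).trans h₃⟩, by omega, h₆, fun w hw => ?_⟩, ?_⟩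
    · rw [h₉] at hw
      rcases Nat.lt_succ_iff_lt_or_eq.1 hw with h | rfl
      · exact h₇ w (h₅ w h)
      · exact h₈
    · simp only [Expr.cost]
      omega
  · rintro s₂ t - ⟨⟨h₁, h₂, h₃⟩, h₄, hX, h₅⟩ h0 ht
    simp only [Expr.eval, h₁] at h0
    simp only [State.setReg_reg, State.setReg_mem, if_true, Expr.cost] at ht
    exact ⟨fun w hw => hX.entry w hw (h₅ w (by omega)), by omega⟩

/-! ### Traversal of the hierarchy of trees -/

/-- Searching for the next edge that can replace a tree edge. -/
def scanProg : Prog :=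
  set rGo (const 1) ;;
  loop (var rGo)
    (ite (sub (var rEdges) (var rI))
      -- Each summand is nonzero exactly if one condition of `IsChild` fails, so the sum vanishes
      -- for a possible replacement. In the last one `aX` holds the entry `y` plus one: with `v` the
      -- tail, the inner sum is zero iff `v ≤ y` and `y < en v`, that is, iff a cycle would arise.
      (ite (add (add (add (add (get aPr (var rI)) (sub (const 1) (get aTl (var rI))))
          (sub (add (get aTl (var rI)) (const 1)) (var rD)))
          (sub (const 1) (add (sub (var rI) (get aTz (get aTl (var rI))))
            (sub (get aTz (get aTl (var rI))) (var rI)))))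
          (sub (const 1) (add
            (sub (add (get aTl (var rI)) (const 1)) (get aX (get aHd (var rI))))
            (sub (get aX (get aHd (var rI))) (get aEn (get aTl (var rI)))))))
        (set rI (add (var rI) (const 1)))
        (set rGo (const 0)))
      (set rGo (const 0)))

theorem scan_spec {K : Core} (hK : K.Valid) {ta ha : ℕ → ℕ} {W : ℕ} (hW : Fits K ta ha W)
    {s : State} {T : ℕ → ℕ} {d i : ℕ} (hT : K.Stage T d) (hs : AtHead K ta ha T d i s)
    (hi : i ≤ K.m) (hX : ∀ w < K.l, ∃ y, s.mem aX w = y + 1 ∧ K.Entry T d w y) :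
    WP W scanProg s fun s' t => (∃ j, AtHead K ta ha T d j s' ∧ i ≤ j ∧ j ≤ K.m ∧
      (∀ k, i ≤ k → k < j → ¬ K.IsChild T d k) ∧ (j < K.m → K.IsChild T d j)) ∧
      t ≤ 80 * (K.m + 1) := by
  have hsz := hW.size
  simp only [scanProg, wp_seq, wp_set, Expr.eval, Expr.cost]
  refine ⟨by omega, ?_⟩
  refine WP.loop (fun s₁ => ∃ j, AtHead K ta ha T d j s₁ ∧ s₁.mem aX = s.mem aX ∧
    i ≤ j ∧ j ≤ K.m ∧ (∀ k, i ≤ k → k < j → ¬ K.IsChild T d k) ∧ s₁.reg rGo ≤ 1 ∧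
    (s₁.reg rGo = 0 → j < K.m → K.IsChild T d j))
    -- The second summand pays for the final iteration, which clears `rGo` without advancing `rI`.
    (fun s₁ => 60 * (K.m - s₁.reg rI) + 70 * s₁.reg rGo) ?_ ?_ ?_
  · refine ⟨i, ⟨⟨hs.holds.l, hs.holds.m, hs.holds.M, hs.holds.tl, hs.holds.hd, hs.holds.mu,
      hs.holds.pr, hs.holds.st, hs.holds.t0, hs.holds.en, hs.holds.ta, hs.holds.ha⟩, hs.tree, hs.d,
      hs.i, hs.run⟩, rfl, le_rfl, hi, fun k h₁ h₂ => by omega, by simp, by simp⟩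
  · rintro s₁ - ⟨j, hat, h₁, h₂, h₃, h₄, h₅, h₆⟩ h0
    simp only [Expr.eval] at h0
    have hh := hat.holds
    simp only [wp_ite, wp_set, Expr.eval, Expr.cost, State.setReg_reg, State.setReg_mem, hh.m,
      hat.i, hh.pr, hh.tl, hh.hd, hh.t0, hh.en, h₁, hat.d, if_true, Nat.reduceEqDiff, if_false]
    refine ⟨fun hj => ?_, fun hj => ?_⟩
    · have hjm : j < K.m := by omega
      have htl := hK.tl_lt j hjm
      obtain ⟨y, hy, hent⟩ := hX _ (hK.hd_lt j hjm)
      rw [hy]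
      have hdl := hT.le
      have hyd := hent.lt
      have hiff : K.tl j < d → (K.OnChain T (K.tl j) (K.hd j) ↔ K.tl j ≤ y ∧ y < K.en (K.tl j)) :=
        fun h => hent.onChain_iff hK hT h
      have hat' : ∀ j', AtHead K ta ha T d j' (s₁.setReg rI j') := fun j' =>
        ⟨⟨hh.l, hh.m, hh.M, hh.tl, hh.hd, hh.mu, hh.pr, hh.st, hh.t0, hh.en, hh.ta, hh.ha⟩,
          hat.tree, hat.d, by simp, hat.run⟩
      refine ⟨fun hbad => ⟨by omega, ⟨j + 1, hat' _, trivial, by omega, by omega, fun k h₇ h₈ => ?_,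
        h₅, fun h => absurd h h0⟩, by omega⟩, fun hgood => ⟨by omega, ⟨j, ?_, trivial, h₂, h₃, h₄,
        by omega, fun _ _ => ?_⟩, by omega⟩⟩
      · rcases Nat.lt_succ_iff_lt_or_eq.1 h₈ with h | rfl
        · exact h₄ k h₇ h
        · intro hc
          have c₁ := hc.pr
          have c₂ := hc.pos
          have c₃ := hc.tl
          have c₄ := hc.ne
          have c₅ := hc.chain
          rw [hiff c₃] at c₅
          omega
      · exact ⟨⟨hh.l, hh.m, hh.M, hh.tl, hh.hd, hh.mu, hh.pr, hh.st, hh.t0, hh.en, hh.ta, hh.ha⟩,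
          hat.tree, hat.d, hat.i, hat.run⟩
      · refine ⟨hjm, by omega, by omega, by omega, by omega, ?_⟩
        rw [hiff (by omega)]
        omega
    · refine ⟨by omega, ⟨j, ⟨⟨hh.l, hh.m, hh.M, hh.tl, hh.hd, hh.mu, hh.pr, hh.st, hh.t0, hh.en,
        hh.ta, hh.ha⟩, hat.tree, hat.d, hat.i, hat.run⟩, trivial, h₂, h₃, h₄, by omega,
        fun _ h => by omega⟩, by omega⟩
  · rintro s₁ t - ⟨j, hat, h₁, h₂, h₃, h₄, h₅, h₆⟩ h0 ht
    simp only [Expr.eval] at h0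
    refine ⟨⟨j, hat, h₂, h₃, h₄, h₆ h0⟩, ?_⟩
    simp only [State.setReg_reg, if_true, Expr.cost, Nat.reduceEqDiff,
      if_false, hs.i] at ht
    omega

/-- Replacing a tree edge by the edge `rI`. -/
def childProg : Prog :=
  put aT (get aTl (var rI)) (var rI) ;;
  set rD (get aTl (var rI)) ;;
  treeProg ;;
  set rI (const 0)

/-- Undoing the last replacement of a tree edge. -/
def popProg : Prog :=
  ite (sub (var rNodes) (var rD))
    -- The tree serves as the stack. The edge to be undone tells where the scan for the parent has
    -- to resume, and the next node that deviates from `t0` is the value of `rD` for the parent.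
    (set rI (add (get aT (var rD)) (const 1)) ;;
    put aT (var rD) (get aTz (var rD)) ;;
    set rD (add (var rD) (const 1)) ;;
    loop (sub (const 1) (add (sub (const 1) (sub (var rNodes) (var rD)))
        (add (sub (get aT (var rD)) (get aTz (var rD)))
          (sub (get aTz (var rD)) (get aT (var rD))))))
      (set rD (add (var rD) (const 1))))
    (set rRun (const 0))

/-- The body of the main loop. -/
def stepProg : Prog :=
  entryProg ;;
  scanProg ;;
  ite (sub (var rEdges) (var rI)) childProg popProg

/-- Enumeration of all solutions of the core instance. -/
def coreProg : Prog :=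
  set rD (var rNodes) ;;
  treeProg ;;
  set rI (const 0) ;;
  set rRun (const 1) ;;
  loop (var rRun) stepProg

/-- The situation after all replacements of edges of `T` below `d` have been tried. -/
def AfterPop (K : Core) (ta ha : ℕ → ℕ) (T : ℕ → ℕ) (d : ℕ) (s : State) : Prop :=
  if d < K.l then
    ∃ d', d < d' ∧ d' ≤ K.l ∧ (∀ u, d < u → u < d' → T u = K.t0 u) ∧
      (d' < K.l → T d' ≠ K.t0 d') ∧
      AtHead K ta ha (Function.update T d (K.t0 d)) d' (T d + 1) s
  else Holds K ta ha s ∧ s.reg rRun = 0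

theorem pop_spec {K : Core} (hK : K.Valid) {ta ha : ℕ → ℕ} {W : ℕ} (hW : Fits K ta ha W)
    {s : State} {T : ℕ → ℕ} {d i : ℕ} (hT : K.Stage T d) (hs : AtHead K ta ha T d i s) :
    WP W popProg s fun s' t => AfterPop K ta ha T d s' ∧ t ≤ 40 * (K.l + 1) := by
  have hsz := hW.size
  have hh := hs.holds
  simp only [popProg, wp_ite, wp_seq, wp_set, wp_put, Expr.eval, Expr.cost, State.setReg_reg,
    State.setReg_mem, State.setMem_reg, hh.l, hs.d, hs.tree, hh.t0,
    Nat.reduceEqDiff, if_false]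
  refine ⟨fun hd => ?_, fun hd => ?_⟩
  · have hdl : d < K.l := by omega
    have h₁ := hT.arb.lt d hT.pos hdl
    have h₂ := hK.t0_lt d hT.pos hdl
    refine ⟨by omega, by omega, by omega, ?_⟩
    refine WP.loop (fun s₁ => d < s₁.reg rD ∧ s₁.reg rD ≤ K.l ∧
      (∀ u, d < u → u < s₁.reg rD → T u = K.t0 u) ∧
      AtHead K ta ha (Function.update T d (K.t0 d)) (s₁.reg rD) (T d + 1) s₁)
      (fun s₁ => 25 * (K.l - s₁.reg rD)) ?_ ?_ ?_
    · simp only [State.setReg_reg, if_true]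
      refine ⟨by omega, by omega, fun u h₃ h₄ => by omega, ⟨hh.l, hh.m, hh.M, hh.tl, hh.hd, hh.mu,
        hh.pr, hh.st, hh.t0, hh.en, hh.ta, hh.ha⟩, ?_, by simp, by simp, ?_⟩
      · simp [hs.tree]
      · simp [hs.run]
    · rintro s₁ - ⟨h₃, h₄, h₅, h₆⟩ h0
      have hh' := h₆.holds
      simp only [Expr.eval, hh'.l, h₆.tree, hh'.t0] at h0
      rw [Function.update_of_ne (by omega)] at h0
      simp only [wp_set, Expr.eval, Expr.cost, State.setReg_reg, if_true]
      refine ⟨by omega, ⟨by omega, by omega, fun u h₇ h₈ => ?_, ⟨⟨hh'.l, hh'.m, hh'.M, hh'.tl,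
        hh'.hd, hh'.mu, hh'.pr, hh'.st, hh'.t0, hh'.en, hh'.ta, hh'.ha⟩, h₆.tree, by simp, h₆.i,
        h₆.run⟩⟩, by omega⟩
      rcases Nat.lt_succ_iff_lt_or_eq.1 h₈ with h | rfl
      · exact h₅ u h₇ h
      · omega
    · rintro s₁ t - ⟨h₃, h₄, h₅, h₆⟩ h0 ht
      have hh' := h₆.holds
      simp only [Expr.eval, hh'.l, h₆.tree, hh'.t0] at h0
      rw [Function.update_of_ne (by omega)] at h0
      rw [AfterPop, if_pos hdl]
      refine ⟨⟨_, h₃, h₄, h₅, fun h => by omega, h₆⟩, ?_⟩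
      simp only [State.setReg_reg, if_true, Expr.cost] at ht
      omega
  · refine ⟨by omega, ?_, by omega⟩
    have := hT.le
    rw [AfterPop, if_neg (by omega)]
    exact ⟨⟨hh.l, hh.m, hh.M, hh.tl, hh.hd, hh.mu, hh.pr, hh.st, hh.t0, hh.en, hh.ta, hh.ha⟩,
      by simp⟩

theorem child_spec {K : Core} (hK : K.Valid) {ta ha : ℕ → ℕ} {W : ℕ} (hW : Fits K ta ha W)
    {s : State} {T : ℕ → ℕ} {d j : ℕ} (hT : K.Stage T d) (hs : AtHead K ta ha T d j s)
    (hj : K.IsChild T d j) :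
    WP W childProg s fun s' t => ∃ Q : List (List ℕ), Q.Nodup ∧ Q ≠ [] ∧
      (∀ q, q ∈ Q ↔ q ∈ K.solsOf (Function.update T (K.tl j) j)) ∧
      AtHead K ta ha (Function.update T (K.tl j) j) (K.tl j) 0 s' ∧
      s'.out = s.out ++ Q.flatMap (Core.enc ta ha) ∧
      t ≤ 500 * ((K.l + K.M + 1) * Q.length) + 20 := by
  have hsz := hW.size
  have hh := hs.holds
  have htl := hK.tl_lt j hj.lt
  have hjm := hj.lt
  have hst := (hj.stage hT hK).arb
  simp only [childProg, wp_seq, wp_set, wp_put, Expr.eval, Expr.cost, State.setMem_mem,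
    State.setMem_reg, hh.tl, hs.i, Nat.reduceEqDiff, if_false, hs.tree]
  refine ⟨by omega, by omega, ?_⟩
  refine (tree_spec hK hW (s := (s.setMem aT (K.tl j) j).setReg rD (K.tl j)) ⟨hh.l, hh.m, hh.M, hh.tl, hh.hd, hh.mu, hh.pr, hh.st, hh.t0, hh.en, hh.ta,
    hh.ha⟩ (by simpa [hs.tree] using hst)).mono fun s₁ t₁ hf₁ h => ?_
  obtain ⟨Q, hnd, hne, hmem, ho, ht⟩ := h
  refine ⟨by omega, Q, hnd, hne, fun q => ?_, ⟨?_, ?_, ?_, by simp, ?_⟩, ?_, by omega⟩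
  · rw [hmem]
    simp [hs.tree]
  · have h₁ : Holds K ta ha s₁ := Holds.frame (s := (s.setMem aT (K.tl j) j).setReg rD (K.tl j)) ⟨hh.l, hh.m, hh.M, hh.tl, hh.hd, hh.mu, hh.pr, hh.st,
      hh.t0, hh.en, hh.ta, hh.ha⟩ hf₁ (by decide) (by decide)
    exact ⟨h₁.l, h₁.m, h₁.M, h₁.tl, h₁.hd, h₁.mu, h₁.pr, h₁.st, h₁.t0, h₁.en, h₁.ta, h₁.ha⟩
  · rw [State.setReg_mem, hf₁.mem _ (by decide)]
    simp [hs.tree]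
  · rw [State.setReg_reg, if_neg (by decide), hf₁.reg _ (by decide)]
    simp
  · rw [State.setReg_reg, if_neg (by decide), hf₁.reg _ (by decide)]
    simp [hs.run]
  · rw [State.setReg_out, ho]
    simp

/-- Every execution of the main loop from `s₁` gives rise to one from `s`, with `t` more steps. -/
def Leads (W : ℕ) (s s₁ : State) (t : ℕ) : Prop :=
  ∀ s₂ t₂, Exec W (loop (var rRun) stepProg) s₁ s₂ t₂ →
    Exec W (loop (var rRun) stepProg) s s₂ (t + t₂)

theorem Leads.trans {W : ℕ} {s s₁ s₂ : State} {t t' : ℕ} (h : Leads W s s₁ t)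
    (h' : Leads W s₁ s₂ t') : Leads W s s₂ (t + t') := fun s₃ t₃ h₃ => by
  rw [Nat.add_assoc]
  exact h _ _ (h' _ _ h₃)

theorem leads_of_wp {W : ℕ} {s : State} {Q : State → ℕ → Prop} (h0 : s.reg rRun = 1)
    (h : WP W stepProg s Q) : ∃ s₁ t₁, Leads W s s₁ (t₁ + 2) ∧ Q s₁ t₁ := by
  obtain ⟨s₁, t₁, he, hq⟩ := h
  refine ⟨s₁, t₁, fun s₂ t₂ h₂ => ?_, hq⟩
  have := Exec.loop_true (e := .var rRun) (by simp [h0]) he h₂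
  rw [show t₁ + 2 + t₂ = Expr.cost (.var rRun) + 1 + t₁ + t₂ by simp only [Expr.cost]; omega]
  exact this

theorem step_spec {K : Core} (hK : K.Valid) {ta ha : ℕ → ℕ} {W : ℕ} (hW : Fits K ta ha W)
    {s : State} {T : ℕ → ℕ} {d i : ℕ} (hT : K.Stage T d) (hs : AtHead K ta ha T d i s)
    (hi : i ≤ K.m) :
    WP W stepProg s fun s' t =>
      ((∀ k, i ≤ k → ¬ K.IsChild T d k) ∧ AfterPop K ta ha T d s' ∧ s'.out = s.out ∧
        t + 2 ≤ 400 * (K.l + K.M + 1)) ∨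
      ∃ j, i ≤ j ∧ K.IsChild T d j ∧ (∀ k, i ≤ k → k < j → ¬ K.IsChild T d k) ∧
        ∃ Q : List (List ℕ), Q.Nodup ∧ Q ≠ [] ∧
          (∀ q, q ∈ Q ↔ q ∈ K.solsOf (Function.update T (K.tl j) j)) ∧
          AtHead K ta ha (Function.update T (K.tl j) j) (K.tl j) 0 s' ∧
          s'.out = s.out ++ Q.flatMap (Core.enc ta ha) ∧
          t + 2 ≤ 500 * ((K.l + K.M + 1) * Q.length) + 400 * (K.l + K.M + 1) := by
  have hmM := hK.m_le
  simp only [stepProg]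
  rw [wp_seq]
  refine (entry_spec hK hW hT hs).mono fun s₁ t₁ hf₁ ⟨hX, ht₁⟩ => ?_
  have hs₁ : AtHead K ta ha T d i s₁ := ⟨hs.holds.frame hf₁ (by decide) (by decide),
    (hf₁.mem _ (by decide)).trans hs.tree, (hf₁.reg _ (by decide)).trans hs.d,
    (hf₁.reg _ (by decide)).trans hs.i, (hf₁.reg _ (by decide)).trans hs.run⟩
  have ho₁ : s₁.out = s.out := hf₁.out (by decide)
  rw [wp_seq]
  refine (scan_spec hK hW hT hs₁ hi hX).mono fun s₂ t₂ hf₂ ⟨⟨j, hs₂, hij, hjm, hno, hyes⟩, ht₂⟩ => ?_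
  have ho₂ : s₂.out = s₁.out := hf₂.out (by decide)
  rw [wp_ite]
  simp only [Expr.eval, Expr.cost, hs₂.holds.m, hs₂.i]
  refine ⟨fun hlt => ?_, fun hge => ?_⟩
  · have hc := hyes (by omega)
    refine (child_spec hK hW hT hs₂ hc).mono fun s₃ t₃ _ h => ?_
    obtain ⟨Q, hnd, hne, hmem, hat, ho, ht⟩ := h
    exact .inr ⟨j, hij, hc, hno, Q, hnd, hne, hmem, hat, by rw [ho, ho₂, ho₁], by omega⟩
  · refine (pop_spec hK hW hT hs₂).mono fun s₃ t₃ hf₃ ⟨h, ht₃⟩ => ?_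
    refine .inl ⟨fun k hk hc => ?_, h, by rw [hf₃.out (by decide), ho₂, ho₁], by omega⟩
    exact hno k hk (by have := hc.lt; omega) hc

/-- A recursive traversal recovered from one loop, with `Leads` composing stretches of its run. The
induction on `d` covers the child, whose changes happen at smaller nodes; the induction on `n`
covers the edges still to be scanned. Every child takes one iteration to enter and one to leave, and
one more leaves `T` itself, whence `2 * Q.length + 1`. -/
theorem enumerate_spec {K : Core} (hK : K.Valid) {ta ha : ℕ → ℕ} {W : ℕ} (hW : Fits K ta ha W)
    (d : ℕ) : ∀ (T : ℕ → ℕ) (n i : ℕ) (s : State), K.m - i ≤ n → i ≤ K.m → K.Stage T d →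
      AtHead K ta ha T d i s →
      ∃ (Q : List (List ℕ)) (s₁ : State) (t₁ : ℕ), Q.Nodup ∧
        (∀ q, q ∈ Q ↔ q ∈ K.solsFrom T d i) ∧ Leads W s s₁ t₁ ∧ AfterPop K ta ha T d s₁ ∧
        s₁.out = s.out ++ Q.flatMap (Core.enc ta ha) ∧
        t₁ ≤ 1000 * ((K.l + K.M + 1) * (2 * Q.length + 1)) := by
  induction d using Nat.strong_induction_on with
  | _ d ihd =>
    intro T n
    induction n with
    | zero => ?_
    | succ n ihn => ?_
    all_goals
      intro i s hn hi hT hs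
      obtain ⟨s₁, t₁, hl₁, h⟩ := leads_of_wp hs.run (step_spec hK hW hT hs hi)
      rcases h with ⟨hno, hpop, ho, ht⟩ | ⟨j, hij, hj, hmin, Q₁, hnd₁, hne₁, hmem₁, hat₁, ho₁, ht₁⟩
      · refine ⟨[], s₁, t₁ + 2, by simp, fun q => ?_, hl₁, hpop, by simp [ho], by simp; omega⟩
        rw [Core.solsFrom_eq_empty hK hT hno]
        simp
      have hjm := hj.lt
    case h.zero.inr => omega
    case h.succ.inr =>
      obtain ⟨Q₂, s₂, t₂, hnd₂, hmem₂, hl₂, hpop₂, ho₂, ht₂⟩ :=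
        ihd _ hj.tl _ K.m 0 s₁ (by omega) (by omega) (hj.stage hT hK) hat₁
      have htl := hK.tl_lt j hjm
      rw [AfterPop, if_pos htl] at hpop₂
      obtain ⟨d', hd₁, hd₂, hd₃, hd₄, hat₂⟩ := hpop₂
      have hTv := hT.below _ hj.pos hj.tl
      -- The first deviation from `t0` after the tail of `j` is `d`: there is none before `d`, and
      -- at `d` there is one unless `d = K.l`.
      have hd' : d' = d := by
        rcases lt_trichotomy d' d with h | h | h
        · refine absurd ?_ (hd₄ (h.trans_le hT.le))
          rw [Function.update_of_ne hd₁.ne']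
          exact hT.below d' (by omega) h
        · exact h
        · refine absurd ?_ (hT.ne (h.trans_le hd₂))
          rw [← hd₃ d hj.tl h, Function.update_of_ne hj.tl.ne']
      -- Putting back the edge of `t0` restores `T`, and the scan continues with `j + 1`.
      rw [Function.update_idem, ← hTv, Function.update_eq_self, Function.update_self, hd'] at hat₂
      obtain ⟨Q₃, s₃, t₃, hnd₃, hmem₃, hl₃, hpop₃, ho₃, ht₃⟩ :=
        ihn (j + 1) s₂ (by omega) (by omega) hT hat₂
      refine ⟨Q₁ ++ (Q₂ ++ Q₃), s₃, t₁ + 2 + t₂ + t₃, ?_, fun q => ?_, (hl₁.trans hl₂).trans hl₃,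
        hpop₃, by simp [ho₃, ho₂, ho₁], ?_⟩
      · refine hnd₁.append (hnd₂.append hnd₃ ?_) ?_
        · intro q h₂ h₃
          exact Core.not_mem_solsFrom_succ hK hT hj (.inr ((hmem₂ q).1 h₂)) ((hmem₃ q).1 h₃)
        · intro q h₁ h₂₃
          rw [List.mem_append] at h₂₃
          rcases h₂₃ with h₂ | h₃
          · exact Core.not_mem_solsFrom_of_mem_solsOf htl.le ((hmem₁ q).1 h₁) ((hmem₂ q).1 h₂)
          · exact Core.not_mem_solsFrom_succ hK hT hj (.inl ((hmem₁ q).1 h₁)) ((hmem₃ q).1 h₃)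
      · rw [List.mem_append, List.mem_append, hmem₁, hmem₂, hmem₃,
          Core.mem_solsFrom_iff hK hT hj hij hmin]
      -- The new tree has at least one solution. It pays for the step to this tree and for the
      -- additional summand `1` of the second recursive bound.
      · have hlen : 1 ≤ Q₁.length := List.length_pos_iff.2 hne₁
        have := Nat.mul_le_mul_left (K.l + K.M + 1) hlen
        simp only [List.length_append, Nat.mul_add, Nat.mul_left_comm _ 2] at *
        omega

theorem core_spec {K : Core} (hK : K.Valid) {ta ha : ℕ → ℕ} {W : ℕ} (hW : Fits K ta ha W)
    {s : State} (hs : Holds K ta ha s) (hT : s.mem aT = K.t0) :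
    WP W coreProg s fun s' t => ∃ Q : List (List ℕ), Q.Nodup ∧ Q ≠ [] ∧
      (∀ q, q ∈ Q ↔ K.IsSol q) ∧ s'.out = s.out ++ Q.flatMap (Core.enc ta ha) ∧
      t ≤ 4000 * ((K.l + K.M + 1) * Q.length) := by
  have hsz := hW.size
  simp only [coreProg, wp_seq, wp_set, Expr.eval, Expr.cost]
  refine ⟨by rw [hs.l]; omega, ?_⟩
  refine (tree_spec hK hW (s := s.setReg rD (s.reg rNodes)) ⟨hs.l, hs.m, hs.M, hs.tl, hs.hd, hs.mu, hs.pr, hs.st, hs.t0, hs.en, hs.ta,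
    hs.ha⟩ (by simpa [hT] using hK.arb_t0)).mono fun s₁ t₁ hf₁ h => ?_
  obtain ⟨Q₁, hnd₁, hne₁, hmem₁, ho₁, ht₁⟩ := h
  have h₁ : Holds K ta ha s₁ := Holds.frame (s := s.setReg rD (s.reg rNodes)) ⟨hs.l, hs.m, hs.M, hs.tl, hs.hd, hs.mu, hs.pr, hs.st,
    hs.t0, hs.en, hs.ta, hs.ha⟩ hf₁ (by decide) (by decide)
  refine ⟨by omega, by omega, ?_⟩
  have hat : AtHead K ta ha K.t0 K.l 0 ((s₁.setReg rI 0).setReg rRun 1) := by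
    refine ⟨⟨h₁.l, h₁.m, h₁.M, h₁.tl, h₁.hd, h₁.mu, h₁.pr, h₁.st, h₁.t0, h₁.en, h₁.ta, h₁.ha⟩,
      ?_, ?_, by simp, by simp⟩
    · simp only [State.setReg_mem]
      rw [hf₁.mem _ (by decide)]
      simpa using hT
    · simp only [State.setReg_reg, Nat.reduceEqDiff, if_false]
      rw [hf₁.reg _ (by decide)]
      simpa using hs.l
  obtain ⟨Q₂, s₂, t₂, hnd₂, hmem₂, hl₂, hpop₂, ho₂, ht₂⟩ :=
    enumerate_spec hK hW K.l K.t0 K.m 0 _ (by omega) (by omega) hK.stage_t0 hat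
  rw [AfterPop, if_neg (lt_irrefl _)] at hpop₂
  refine ⟨s₂, _, hl₂ _ _ (Exec.loop_false (by simpa using hpop₂.2)), Q₁ ++ Q₂, ?_, by simp [hne₁],
    fun q => ?_, ?_, ?_⟩
  · refine hnd₁.append hnd₂ fun q h h' => ?_
    rw [hmem₁, State.setReg_mem, hT] at h
    exact Core.not_mem_solsFrom_of_mem_solsOf le_rfl h ((hmem₂ q).1 h')
  · rw [List.mem_append, hmem₁, hmem₂, State.setReg_mem, hT, ← Core.isSol_iff]
  · simp [ho₂, ho₁]
  · have hlen : 1 ≤ Q₁.length := List.length_pos_iff.2 hne₁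
    have := Nat.mul_le_mul_left (K.l + K.M + 1) hlen
    simp only [List.length_append, Nat.mul_add, Nat.mul_left_comm _ 2, Expr.cost] at *
    omega

end RAM

/-! ## The search for a spanning tree -/

/-- An instance as it is read from the input: `n` nodes, the root `r`, and `m` edges with tails,
heads, multiplicities and priority flags. -/
structure Inst where
  n : ℕ
  r : ℕ
  m : ℕ
  tl : ℕ → ℕ
  hd : ℕ → ℕ
  mu : ℕ → ℕ
  fl : ℕ → ℕ

namespace Inst

/-- The number of edges, with multiplicity, leaving `v`. -/
def outDeg (I : Inst) (v : ℕ) : ℕ := ∑ i ∈ Finset.range I.m with I.tl i = v, I.mu i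

/-- The number of edges, with multiplicity, entering `v`. -/
def inDeg (I : Inst) (v : ℕ) : ℕ := ∑ i ∈ Finset.range I.m with I.hd i = v, I.mu i

/-- The number of edges, with multiplicity. -/
def total (I : Inst) : ℕ := ∑ i ∈ Finset.range I.m, I.mu i

structure Valid (I : Inst) : Prop where
  r_lt : I.r < I.n
  tl_lt : ∀ i < I.m, I.tl i < I.n
  hd_lt : ∀ i < I.m, I.hd i < I.n
  mu_pos : ∀ i < I.m, 0 < I.mu i
  fl_le : ∀ i < I.m, I.fl i ≤ 1
  fl_mu : ∀ i < I.m, I.fl i ≠ 0 → I.mu i = 1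
  fl_unique : ∀ i < I.m, ∀ j < I.m, I.fl i ≠ 0 → I.fl j ≠ 0 → I.tl i = I.tl j → i = j

/-- The priority edge `i` is not the only exit of a node other than the root. -/
def Compulsory (I : Inst) (i : ℕ) : Prop :=
  I.fl i ≠ 0 ∧ (I.tl i = I.r ∨ 2 ≤ I.outDeg (I.tl i))

/-- The edge `i` can be the last exit of a node other than the root. -/
def Usable (I : Inst) (i : ℕ) : Prop :=
  I.tl i ≠ I.r ∧ (I.fl i = 0 ∨ I.outDeg (I.tl i) < 2)

instance (I : Inst) : DecidablePred I.Usable := fun _ => inferInstanceAs (Decidable (_ ∧ _))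

variable {I : Inst}

theorem Usable.not_compulsory {i : ℕ} (h : I.Usable i) : ¬ I.Compulsory i := by
  rintro ⟨h₁, h₂⟩
  obtain ⟨h₃, h₄⟩ := h
  omega

/-- The last usable edge before `k` that enters `v`, plus one; `0` if there is none. -/
def lastUsable (I : Inst) : ℕ → ℕ → ℕ
  | 0, _ => 0
  | k + 1, v => if I.Usable k ∧ I.hd k = v then k + 1 else I.lastUsable k v

/-- The number of usable edges before `k` that enter `v`. -/
def numUsable (I : Inst) (k v : ℕ) : ℕ := {i ∈ Finset.range k | I.Usable i ∧ I.hd i = v}.card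

theorem lastUsable_le (k v : ℕ) : I.lastUsable k v ≤ k := by
  induction k with
  | zero => exact le_rfl
  | succ k ih =>
    rw [lastUsable]
    split_ifs <;> omega

theorem lastUsable_eq_zero {k v : ℕ} (h : I.lastUsable k v = 0) {i : ℕ} (hi : i < k) :
    ¬ (I.Usable i ∧ I.hd i = v) := by
  induction k with
  | zero => omega
  | succ k ih =>
    rw [lastUsable] at h
    split_ifs at h with hc
    rcases Nat.lt_succ_iff_lt_or_eq.1 hi with h' | rfl
    · exact ih h h'
    · exact hc

theorem lastUsable_eq_succ {k v e : ℕ} (h : I.lastUsable k v = e + 1) :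
    e < k ∧ I.Usable e ∧ I.hd e = v ∧ ∀ i, e < i → i < k → ¬ (I.Usable i ∧ I.hd i = v) := by
  induction k with
  | zero => simp [lastUsable] at h
  | succ k ih =>
    rw [lastUsable] at h
    split_ifs at h with hc
    · obtain rfl : k = e := by omega
      exact ⟨by omega, hc.1, hc.2, fun i h₁ h₂ => by omega⟩
    · obtain ⟨h₁, h₂, h₃, h₄⟩ := ih h
      refine ⟨by omega, h₂, h₃, fun i h₅ h₆ => ?_⟩
      rcases Nat.lt_succ_iff_lt_or_eq.1 h₆ with h' | rfl
      · exact h₄ i h₅ h'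
      · exact hc

theorem numUsable_lt {k v e : ℕ} (he : e < k) (hu : I.Usable e) (hv : I.hd e = v) :
    I.numUsable e v + 1 ≤ I.numUsable k v := by
  refine Finset.card_lt_card (Finset.ssubset_iff.2 ⟨e, by simp, ?_⟩)
  intro i hi
  simp only [Finset.mem_insert, Finset.mem_filter, Finset.mem_range] at hi ⊢
  rcases hi with rfl | ⟨h₁, h₂⟩
  · exact ⟨he, hu, hv⟩
  · exact ⟨by omega, h₂⟩

theorem sum_numUsable_le {node : ℕ → ℕ} {k : ℕ}
    (h : ∀ j < k, ∀ j' < k, node j = node j' → j = j') :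
    ∑ j ∈ Finset.range k, I.numUsable I.m (node j) ≤ I.m := by
  simp only [numUsable]
  rw [← Finset.card_biUnion]
  · refine (Finset.card_le_card (t := Finset.range I.m) ?_).trans_eq (Finset.card_range _)
    intro i
    simp only [Finset.mem_biUnion, Finset.mem_filter]
    rintro ⟨_, _, h, _⟩
    exact h
  · intro j hj j' hj' hne
    refine Finset.disjoint_left.2 fun i h₁ h₂ => ?_
    simp only [Finset.mem_filter] at h₁ h₂
    exact hne (h j (by simpa using hj) j' (by simpa using hj') (h₁.2.2.symm.trans h₂.2.2))

theorem sum_outDeg_le {node : ℕ → ℕ} {k : ℕ}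
    (h : ∀ j < k, ∀ j' < k, node j = node j' → j = j') :
    ∑ j ∈ Finset.range k, I.outDeg (node j) ≤ I.total := by
  simp only [outDeg]
  rw [← Finset.sum_biUnion]
  · refine Finset.sum_le_sum_of_subset fun i => ?_
    simp only [Finset.mem_biUnion, Finset.mem_filter]
    rintro ⟨_, _, h, _⟩
    exact h
  · intro j hj j' hj' hne
    refine Finset.disjoint_left.2 fun i h₁ h₂ => ?_
    simp only [Finset.mem_filter] at h₁ h₂
    exact hne (h j (by simpa using hj) j' (by simpa using hj') (h₁.2.symm.trans h₂.2))

theorem le_of_injective_lt {f : ℕ → ℕ} {k n : ℕ} (hf : ∀ j < k, f j < n)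
    (h : ∀ j < k, ∀ j' < k, f j = f j' → j = j') : k ≤ n := by
  have := Finset.card_le_card_of_injOn (s := Finset.range k) (t := Finset.range n) f
    (fun j hj => by simpa using hf j (by simpa using hj))
    (fun j hj j' hj' he => h j (by simpa using hj) j' (by simpa using hj') he)
  simpa using this

/-- The state of the search against the direction of the edges: `node j` for `j < k` are the
nodes that have left the stack, in their order, `rank` is the inverse of `node`, and `stk q` for
`q < p` are the nodes on the stack. The discovered node `u` has been found through the edge
`te u`, whose head has the rank `px u`; for the node of rank `j` these data are `tz j` and
`par j`. The nodes of rank less than `j` have `st j` exits. -/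
structure Search where
  k : ℕ
  p : ℕ
  node : ℕ → ℕ
  rank : ℕ → ℕ
  disc : ℕ → ℕ
  te : ℕ → ℕ
  px : ℕ → ℕ
  par : ℕ → ℕ
  tz : ℕ → ℕ
  st : ℕ → ℕ
  stk : ℕ → ℕ

/-- The search begins with the root on the stack. -/
def start (I : Inst) : Search where
  k := 0
  p := 1
  node := 0
  rank := 0
  disc := Function.update 0 I.r 1
  te := 0
  px := 0
  par := 0
  tz := 0
  st := 0
  stk := Function.update 0 0 I.r

/-- Moving the node on top of the stack to the nodes that have left the stack. -/
def Search.pop (S : Search) (I : Inst) : Search :=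
  { S with
    k := S.k + 1
    p := S.p - 1
    node := Function.update S.node S.k (S.stk (S.p - 1))
    rank := Function.update S.rank (S.stk (S.p - 1)) S.k
    par := Function.update S.par S.k (S.px (S.stk (S.p - 1)))
    tz := Function.update S.tz S.k (S.te (S.stk (S.p - 1)))
    st := Function.update S.st (S.k + 1) (S.st S.k + I.outDeg (S.stk (S.p - 1))) }

/-- Discovery of the tail of the edge `i`. -/
def Search.push (S : Search) (I : Inst) (i : ℕ) : Search :=
  { S with
    p := S.p + 1
    disc := Function.update S.disc (I.tl i) 1
    te := Function.update S.te (I.tl i) i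
    px := Function.update S.px (I.tl i) (S.k - 1)
    stk := Function.update S.stk S.p (I.tl i) }

namespace Search

/-- A node gets its rank when it leaves the stack, and because the stack is last-in first-out the
ranks form a preorder of the search tree. `noncrossing` expresses this by parents alone. It is
maintained through `stk_par`, which says that no waiting node will violate it, and `stk_mono`, by
which nodes higher on the stack have later parents. The root has no tree edge; `root` fixes the
values stored for it. -/
structure Inv (I : Inst) (S : Search) : Prop where
  node_lt : ∀ j < S.k, S.node j < I.n
  node_rank : ∀ j < S.k, S.rank (S.node j) = j
  rank_le : ∀ v, S.rank v ≤ S.k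
  node_disc : ∀ j < S.k, S.disc (S.node j) ≠ 0
  stk_lt : ∀ q < S.p, S.stk q < I.n
  stk_disc : ∀ q < S.p, S.disc (S.stk q) ≠ 0
  stk_inj : ∀ q < S.p, ∀ q' < S.p, S.stk q = S.stk q' → q = q'
  stk_new : ∀ q < S.p, ∀ j < S.k, S.node j ≠ S.stk q
  of_disc : ∀ u < I.n, S.disc u ≠ 0 → (∃ j < S.k, S.node j = u) ∨ ∃ q < S.p, S.stk q = u
  disc_r : S.disc I.r ≠ 0
  root : S.te I.r = 0 ∧ S.px I.r = 0
  start : S.k = 0 → S.p = 1 ∧ S.stk 0 = I.r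
  node_zero : 0 < S.k → S.node 0 = I.r
  te : ∀ u < I.n, S.disc u ≠ 0 → u ≠ I.r → S.te u < I.m ∧ I.tl (S.te u) = u ∧
    I.Usable (S.te u) ∧ S.px u < S.k ∧ S.node (S.px u) = I.hd (S.te u)
  par : ∀ j, 0 < j → j < S.k → S.par j = S.px (S.node j) ∧ S.par j < j ∧
    S.tz j = S.te (S.node j)
  noncrossing : ∀ j w, 0 < j → j < w → w < S.k → S.par w ≤ S.par j ∨ j ≤ S.par w
  stk_par : ∀ q < S.p, ∀ j, 0 < j → j < S.k → S.px (S.stk q) ≤ S.par j ∨ j ≤ S.px (S.stk q)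
  stk_mono : ∀ q q', q < q' → q' < S.p → S.px (S.stk q) ≤ S.px (S.stk q')
  st_zero : S.st 0 = 0
  st_succ : ∀ j < S.k, S.st (j + 1) = S.st j + I.outDeg (S.node j)

variable {S : Search}

theorem Inv.node_inj (h : S.Inv I) {j j' : ℕ} (hj : j < S.k) (hj' : j' < S.k)
    (he : S.node j = S.node j') : j = j' := by
  rw [← h.node_rank j hj, ← h.node_rank j' hj', he]

theorem Inv.k_le (h : S.Inv I) : S.k ≤ I.n :=
  le_of_injective_lt h.node_lt fun _ hj _ hj' he => h.node_inj hj hj' he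

theorem Inv.p_le (h : S.Inv I) : S.p ≤ I.n := le_of_injective_lt h.stk_lt h.stk_inj

theorem Inv.st_eq (h : S.Inv I) {j : ℕ} (hj : j ≤ S.k) :
    S.st j = ∑ i ∈ Finset.range j, I.outDeg (S.node i) := by
  induction j with
  | zero => simp [h.st_zero]
  | succ j ih => rw [Finset.sum_range_succ, h.st_succ j hj, ih (by omega)]

theorem Inv.st_le (h : S.Inv I) {j : ℕ} (hj : j ≤ S.k) : S.st j ≤ I.total := by
  rw [h.st_eq hj]
  exact sum_outDeg_le fun i hi i' hi' he => h.node_inj (by omega) (by omega) he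

theorem Inv.te_lt (h : S.Inv I) {u : ℕ} (hu : u < I.n) (hd : S.disc u ≠ 0) :
    S.te u ≤ I.m ∧ S.px u ≤ S.k := by
  by_cases hr : u = I.r
  · subst hr
    rw [h.root.1, h.root.2]
    omega
  · obtain ⟨h₁, _, _, h₂, _⟩ := h.te u hu hd hr
    omega

theorem inv_start (hI : I.Valid) : I.start.Inv I where
  node_lt _ h := absurd h (Nat.not_lt_zero _)
  node_rank _ h := absurd h (Nat.not_lt_zero _)
  rank_le _ := le_rfl
  node_disc _ h := absurd h (Nat.not_lt_zero _)
  stk_lt q hq := by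
    obtain rfl : q = 0 := Nat.lt_one_iff.1 hq
    simpa [Inst.start] using hI.r_lt
  stk_disc q hq := by
    obtain rfl : q = 0 := Nat.lt_one_iff.1 hq
    simp [Inst.start]
  stk_inj q hq q' hq' _ := (Nat.lt_one_iff.1 hq).trans (Nat.lt_one_iff.1 hq').symm
  stk_new _ _ _ h := absurd h (Nat.not_lt_zero _)
  of_disc u _ hd := by
    refine .inr ⟨0, Nat.one_pos, ?_⟩
    by_contra hc
    refine hd ?_
    simp only [Inst.start, Function.update_self] at hc
    simp [Inst.start, Function.update_of_ne (Ne.symm hc)]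
  disc_r := by simp [Inst.start]
  root := ⟨rfl, rfl⟩
  start _ := by simp [Inst.start]
  node_zero h := absurd h (Nat.not_lt_zero _)
  te u _ hd hr := absurd (by simp [Inst.start, Function.update_of_ne hr]) hd
  par _ _ h := absurd h (Nat.not_lt_zero _)
  noncrossing _ _ _ _ h := absurd h (Nat.not_lt_zero _)
  stk_par _ _ _ _ h := absurd h (Nat.not_lt_zero _)
  stk_mono q q' h h' := by
    have : q' < 1 := h'
    omega
  st_zero := rfl
  st_succ _ h := absurd h (Nat.not_lt_zero _)

/-- For the node that receives the next rank, `stk_par` becomes `noncrossing`. For those that stay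
on the stack, `stk_mono` gives `stk_par` with respect to the new node. -/
theorem Inv.pop (h : S.Inv I) (hp : 0 < S.p) : (S.pop I).Inv I := by
  have hp' : S.p - 1 < S.p := by omega
  have hv := h.stk_lt _ hp'
  have hvd := h.stk_disc _ hp'
  have hnew := h.stk_new _ hp'
  have hvr : 0 < S.k → S.stk (S.p - 1) ≠ I.r := fun hk he =>
    hnew 0 hk ((h.node_zero hk).trans he.symm)
  have hpx : 0 < S.k → S.px (S.stk (S.p - 1)) < S.k := fun hk => (h.te _ hv hvd (hvr hk)).2.2.2.1
  have hnode : ∀ j < S.k, Function.update S.node S.k (S.stk (S.p - 1)) j = S.node j :=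
    fun j hj => Function.update_of_ne hj.ne _ _
  have hpar : ∀ j < S.k, Function.update S.par S.k (S.px (S.stk (S.p - 1))) j = S.par j :=
    fun j hj => Function.update_of_ne hj.ne _ _
  constructor <;> simp only [Search.pop]
  · intro j hj
    rcases Nat.lt_succ_iff_lt_or_eq.1 hj with hj | rfl
    · rw [hnode j hj]; exact h.node_lt j hj
    · rwa [Function.update_self]
  · intro j hj
    rcases Nat.lt_succ_iff_lt_or_eq.1 hj with hj | rfl
    · rw [hnode j hj, Function.update_of_ne (hnew j hj)]; exact h.node_rank j hj
    · simp
  · intro v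
    by_cases hvs : v = S.stk (S.p - 1)
    · rw [hvs, Function.update_self]; omega
    · rw [Function.update_of_ne hvs]; exact (h.rank_le v).trans (Nat.le_succ _)
  · intro j hj
    rcases Nat.lt_succ_iff_lt_or_eq.1 hj with hj | rfl
    · rw [hnode j hj]; exact h.node_disc j hj
    · rwa [Function.update_self]
  · exact fun q hq => h.stk_lt q (by omega)
  · exact fun q hq => h.stk_disc q (by omega)
  · exact fun q hq q' hq' => h.stk_inj q (by omega) q' (by omega)
  · intro q hq j hj
    rcases Nat.lt_succ_iff_lt_or_eq.1 hj with hj | rfl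
    · rw [hnode j hj]; exact h.stk_new q (by omega) j hj
    · rw [Function.update_self]
      intro he
      have := h.stk_inj _ hp' q (by omega) he
      omega
  · intro u hu hd
    rcases h.of_disc u hu hd with ⟨j, hj, rfl⟩ | ⟨q, hq, rfl⟩
    · exact .inl ⟨j, by omega, hnode j hj⟩
    · by_cases hqp : q = S.p - 1
      · subst hqp
        exact .inl ⟨S.k, by omega, Function.update_self ..⟩
      · exact .inr ⟨q, by omega, rfl⟩
  · exact h.disc_r
  · exact h.root
  · omega
  · intro _
    by_cases hk : S.k = 0
    · obtain ⟨h₁, h₂⟩ := h.start hk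
      rw [hk, Function.update_self, h₁]
      exact h₂
    · rw [hnode 0 (by omega)]
      exact h.node_zero (by omega)
  · intro u hu hd hr
    obtain ⟨h₁, h₂, h₃, h₄, h₅⟩ := h.te u hu hd hr
    exact ⟨h₁, h₂, h₃, by omega, by rwa [hnode _ h₄]⟩
  · intro j hj0 hj
    rcases Nat.lt_succ_iff_lt_or_eq.1 hj with hj | rfl
    · rw [hnode j hj, hpar j hj, Function.update_of_ne hj.ne]
      exact h.par j hj0 hj
    · rw [Function.update_self, Function.update_self, Function.update_self]
      exact ⟨rfl, hpx hj0, rfl⟩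
  · intro j w hj hjw hw
    rcases Nat.lt_succ_iff_lt_or_eq.1 hw with hw | rfl
    · rw [hpar w hw, hpar j (by omega)]
      exact h.noncrossing j w hj hjw hw
    · rw [Function.update_self, hpar j hjw]
      exact h.stk_par _ hp' j hj hjw
  · intro q hq j hj0 hj
    rcases Nat.lt_succ_iff_lt_or_eq.1 hj with hj | rfl
    · rw [hpar j hj]
      exact h.stk_par q (by omega) j hj0 hj
    · rw [Function.update_self]
      exact .inl (h.stk_mono _ _ hq hp')
  · exact fun q q' hq hq' => h.stk_mono q q' hq (by omega)
  · rw [Function.update_of_ne (by omega)]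
    exact h.st_zero
  · intro j hj
    rw [Function.update_of_ne hj.ne]
    rcases Nat.lt_succ_iff_lt_or_eq.1 hj with hj | rfl
    · rw [hnode j hj, Function.update_of_ne (by omega)]
      exact h.st_succ j hj
    · rw [Function.update_self, Function.update_self]

/-- The parent of the new node is the node ranked last. So its `px` is at least every rank given so
far, and both conditions on the stack hold trivially for it. -/
theorem Inv.push (hI : I.Valid) (h : S.Inv I) (hk : 0 < S.k) {i : ℕ} (hi : i < I.m)
    (hu : I.Usable i) (hh : I.hd i = S.node (S.k - 1)) (hd : S.disc (I.tl i) = 0) :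
    (S.push I i).Inv I := by
  have hul := hI.tl_lt i hi
  have hnode : ∀ j < S.k, S.node j ≠ I.tl i := fun j hj he => h.node_disc j hj (he ▸ hd)
  have hstk : ∀ q < S.p, S.stk q ≠ I.tl i := fun q hq he => h.stk_disc q hq (he ▸ hd)
  have hdisc : ∀ u, S.disc u ≠ 0 → Function.update S.disc (I.tl i) 1 u ≠ 0 := fun u hu => by
    rw [Function.update_of_ne]
    · exact hu
    · rintro rfl; exact hu hd
  have hupd : ∀ q < S.p, Function.update S.stk S.p (I.tl i) q = S.stk q :=
    fun q hq => Function.update_of_ne hq.ne _ _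
  have hpx : ∀ q < S.p, Function.update S.px (I.tl i) (S.k - 1) (S.stk q) = S.px (S.stk q) :=
    fun q hq => Function.update_of_ne (hstk q hq) _ _
  have hroot : ∀ u, u ≠ I.r → S.disc u ≠ 0 → u < I.n → S.px u < S.k := fun u h₁ h₂ h₃ =>
    (h.te u h₃ h₂ h₁).2.2.2.1
  constructor <;> simp only [Search.push]
  · exact h.node_lt
  · exact h.node_rank
  · exact h.rank_le
  · exact fun j hj => hdisc _ (h.node_disc j hj)
  · intro q hq
    rcases Nat.lt_succ_iff_lt_or_eq.1 hq with hq | rfl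
    · rw [hupd q hq]; exact h.stk_lt q hq
    · rwa [Function.update_self]
  · intro q hq
    rcases Nat.lt_succ_iff_lt_or_eq.1 hq with hq | rfl
    · rw [hupd q hq]; exact hdisc _ (h.stk_disc q hq)
    · simp
  · intro q hq q' hq'
    rcases Nat.lt_succ_iff_lt_or_eq.1 hq with hq | rfl <;>
      rcases Nat.lt_succ_iff_lt_or_eq.1 hq' with hq' | rfl
    · rw [hupd q hq, hupd q' hq']; exact h.stk_inj q hq q' hq'
    · rw [hupd q hq, Function.update_self]; exact fun he => absurd he (hstk q hq)
    · rw [hupd q' hq', Function.update_self]; exact fun he => absurd he.symm (hstk q' hq')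
    · exact fun _ => rfl
  · intro q hq j hj
    rcases Nat.lt_succ_iff_lt_or_eq.1 hq with hq | rfl
    · rw [hupd q hq]; exact h.stk_new q hq j hj
    · rw [Function.update_self]; exact hnode j hj
  · intro u hul hud
    by_cases hui : u = I.tl i
    · subst hui
      exact .inr ⟨S.p, by omega, Function.update_self ..⟩
    · rw [Function.update_of_ne hui] at hud
      rcases h.of_disc u hul hud with hc | ⟨q, hq, hc⟩
      · exact .inl hc
      · exact .inr ⟨q, by omega, by rwa [hupd q hq]⟩
  · exact hdisc _ h.disc_r
  · rw [Function.update_of_ne hu.1.symm, Function.update_of_ne hu.1.symm]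
    exact h.root
  · omega
  · exact h.node_zero
  · intro u hul hud hr
    by_cases hui : u = I.tl i
    · subst hui
      simp only [Function.update_self]
      exact ⟨hi, trivial, hu, by omega, hh.symm⟩
    · rw [Function.update_of_ne hui] at hud
      rw [Function.update_of_ne hui, Function.update_of_ne hui]
      exact h.te u hul hud hr
  · intro j hj0 hj
    rw [Function.update_of_ne (hnode j hj), Function.update_of_ne (hnode j hj)]
    exact h.par j hj0 hj
  · exact h.noncrossing
  · intro q hq j hj0 hj
    rcases Nat.lt_succ_iff_lt_or_eq.1 hq with hq | rfl
    · rw [hupd q hq, hpx q hq]; exact h.stk_par q hq j hj0 hj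
    · rw [Function.update_self, Function.update_self]; omega
  · intro q q' hq hq'
    rcases Nat.lt_succ_iff_lt_or_eq.1 hq' with hq' | rfl
    · rw [hupd q (by omega), hupd q' hq', hpx q (by omega), hpx q' hq']
      exact h.stk_mono q q' hq hq'
    · rw [Function.update_self, Function.update_self, hupd q hq, hpx q hq]
      have := hroot _ (fun he => h.stk_new q hq 0 hk ((h.node_zero hk).trans he.symm))
        (h.stk_disc q hq) (h.stk_lt q hq)
      omega
  · exact h.st_zero
  · exact h.st_succ

/-- All tails of usable edges entering `v` have been discovered. -/
def ClosedAt (S : Search) (I : Inst) (v : ℕ) : Prop :=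
  ∀ i < I.m, I.Usable i → I.hd i = v → S.disc (I.tl i) ≠ 0

theorem push_disc {i u : ℕ} (h : S.disc u ≠ 0) : (S.push I i).disc u ≠ 0 := by
  by_cases hu : u = I.tl i
  · simp [Search.push, hu]
  · simpa [Search.push, Function.update_of_ne hu] using h

end Search

/-- `e` bounds the subtree of `v` in a tree with parent function `par`. -/
structure SubtreeEnd (par : ℕ → ℕ) (l v e : ℕ) : Prop where
  lt : v < e
  le : e ≤ l
  inner : ∀ w, v < w → w < e → v ≤ par w
  outer : e < l → par e < v

theorem SubtreeEnd.leaf {par : ℕ → ℕ} {l v : ℕ} (hv : v < l)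
    (hpar : ∀ j, 0 < j → j < l → par j < j) (h : ∀ c, v < c → c < l → par c ≠ v) :
    SubtreeEnd par l v (v + 1) := by
  refine ⟨by omega, hv, fun w h₁ h₂ => by omega, fun h₁ => ?_⟩
  have := hpar (v + 1) (by omega) h₁
  have := h (v + 1) (by omega) h₁
  omega

/-- The nodes between `par c` and `c` belong to earlier branches at `par c`, since otherwise they
would cross `c`. The node `e` has its parent before `c`, hence by `hnc` at most at `par c`, and not
there because `c` is the last child. -/
theorem SubtreeEnd.parent {par : ℕ → ℕ} {l c e : ℕ} (h : SubtreeEnd par l c e) (hc0 : 0 < c)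
    (hpar : ∀ j, 0 < j → j < l → par j < j)
    (hnc : ∀ j w, 0 < j → j < w → w < l → par w ≤ par j ∨ j ≤ par w)
    (hlast : ∀ c', c < c' → c' < l → par c' ≠ par c) : SubtreeEnd par l (par c) e := by
  have h₁ := h.lt
  have h₂ := h.le
  have h₃ := hpar c hc0 (by omega)
  refine ⟨by omega, h₂, fun w h₄ h₅ => ?_, fun h₄ => ?_⟩
  · rcases lt_trichotomy w c with h₆ | rfl | h₆
    · have := hnc w c (by omega) h₆ (by omega)
      omega
    · exact le_rfl
    · have := h.inner w h₆ h₅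
      omega
  · have := h.outer h₄
    have := hnc c e hc0 h₁ h₄
    have := hlast e h₁ h₄
    omega

end Inst

/-- A node after `e` with its parent between `v` and `e` would cross `e`, whose own parent lies
before `v`. So no path from beyond the interval enters it. -/
theorem Core.onChain_iff_of_subtreeEnd {K : Core} {T par : ℕ → ℕ} {v e : ℕ}
    (hT : ∀ w, 0 < w → w < K.l → K.hd (T w) = par w)
    (hpar : ∀ j, 0 < j → j < K.l → par j < j)
    (hnc : ∀ j w, 0 < j → j < w → w < K.l → par w ≤ par j ∨ j ≤ par w)
    (h : Inst.SubtreeEnd par K.l v e) {w : ℕ} (hw : w < K.l) :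
    K.OnChain T v w ↔ v ≤ w ∧ w < e := by
  have h₁ := h.lt
  have h₂ := h.le
  induction w using Nat.strong_induction_on with
  | _ w ih =>
    constructor
    · intro hc
      cases hc with
      | refl => exact ⟨le_rfl, h₁⟩
      | step _ hw0 hc =>
        rw [hT w (by omega) hw] at hc
        have h₃ := hpar w (by omega) hw
        have h₄ := (ih _ h₃ (by omega)).1 hc
        refine ⟨by omega, ?_⟩
        by_contra hwe
        have h₅ := h.outer (by omega)
        rcases Nat.lt_or_ge e w with h₆ | h₆
        · have := hnc e w (by omega) h₆ hw
          omega
        · obtain rfl : w = e := by omega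
          omega
    · rintro ⟨h₃, h₄⟩
      rcases h₃.lt_or_eq with h₃ | rfl
      · have h₅ := hpar w (by omega) hw
        refine .step w (by omega) ?_
        rw [hT w (by omega) hw]
        exact (ih _ h₅ (by omega)).2 ⟨h.inner w h₃ h₄, by omega⟩
      · exact .refl

/-! ## The program that prepares the core instance -/

notation "aPx" => (227 : ℕ)
notation "aPar" => (228 : ℕ)

namespace RAM

open RAM.Expr RAM.Prog

/-- The instance `I` as the contents `f` of an array. -/
structure Input (I : Inst) (f : ℕ → ℕ) : Prop where
  n : f 0 = I.n
  r : f 1 = I.r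
  m : f 2 = I.m
  tl : ∀ i < I.m, f (i + i + (i + i) + 3) = I.tl i
  hd : ∀ i < I.m, f (i + i + (i + i) + 4) = I.hd i
  mu : ∀ i < I.m, f (i + i + (i + i) + 5) = I.mu i
  fl : ∀ i < I.m, f (i + i + (i + i) + 6) = I.fl i

/-- The instance and the degrees of its nodes are in memory. -/
structure Known (I : Inst) (s : State) : Prop where
  n : s.reg rN = I.n
  r : s.reg rRoot = I.r
  m : s.reg rEdges = I.m
  M : s.reg rTotal = I.total
  tl : ∀ i < I.m, s.mem aTail i = I.tl i
  hd : ∀ i < I.m, s.mem aHead i = I.hd i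
  mu : ∀ i < I.m, s.mem aMult i = I.mu i
  fl : ∀ i < I.m, s.mem aFlag i = I.fl i
  out : s.mem aOut = I.outDeg
  inn : s.mem aIn = I.inDeg

theorem Known.frame {I : Inst} {s s' : State} (h : Known I s) {P : Prog} (hf : Frame P s s')
    (h₁ : ∀ x ∈ [rN, rRoot, rEdges, rTotal], x ∉ P.wreg)
    (h₂ : ∀ a ∈ [aTail, aHead, aMult, aFlag, aOut, aIn], a ∉ P.warr) : Known I s' := by
  simp only [List.mem_cons, List.not_mem_nil, or_false, forall_eq_or_imp, forall_eq] at h₁ h₂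
  obtain ⟨h₁, h₃, h₄, h₅⟩ := h₁
  obtain ⟨h₆, h₇, h₈, h₉, h₁₀, h₁₁⟩ := h₂
  have e₁ := hf.mem _ h₆
  have e₂ := hf.mem _ h₇
  have e₃ := hf.mem _ h₈
  have e₄ := hf.mem _ h₉
  exact ⟨(hf.reg _ h₁).trans h.n, (hf.reg _ h₃).trans h.r, (hf.reg _ h₄).trans h.m,
    (hf.reg _ h₅).trans h.M, fun i hi => e₁ ▸ h.tl i hi, fun i hi => e₂ ▸ h.hd i hi,
    fun i hi => e₃ ▸ h.mu i hi, fun i hi => e₄ ▸ h.fl i hi, (hf.mem _ h₁₀).trans h.out,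
    (hf.mem _ h₁₁).trans h.inn⟩

/-- Entry `j` of the record of the edge `rI` in the input. -/
def field (j : ℕ) : Expr :=
  get 0 (add (add (add (var rI) (var rI)) (add (var rI) (var rI))) (const j))

def readEdgeProg : Prog :=
  put aTail (var rI) (field 3) ;;
  put aHead (var rI) (field 4) ;;
  put aMult (var rI) (field 5) ;;
  put aFlag (var rI) (field 6) ;;
  put aOut (get aTail (var rI)) (add (get aOut (get aTail (var rI))) (get aMult (var rI))) ;;
  put aIn (get aHead (var rI)) (add (get aIn (get aHead (var rI))) (get aMult (var rI))) ;;
  set rTotal (add (var rTotal) (get aMult (var rI))) ;;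
  set rI (add (var rI) (const 1))

/-- Reading the input. -/
def readProg : Prog :=
  set rN (get 0 (const 0)) ;;
  set rRoot (get 0 (const 1)) ;;
  set rEdges (get 0 (const 2)) ;;
  loop (sub (var rEdges) (var rI)) readEdgeProg

theorem update_sum_filter_range (f g : ℕ → ℕ) (k : ℕ) :
    Function.update (fun v => ∑ i ∈ Finset.range k with f i = v, g i) (f k)
      (∑ i ∈ Finset.range k with f i = f k, g i + g k) =
    fun v => ∑ i ∈ Finset.range (k + 1) with f i = v, g i := by
  funext v
  rw [Finset.range_add_one, Finset.filter_insert]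
  by_cases hv : f k = v
  · subst hv
    rw [Function.update_self, if_pos rfl, Finset.sum_insert (by simp), Nat.add_comm]
  · rw [Function.update_of_ne (Ne.symm hv), if_neg hv]

theorem sum_filter_add_le {f g : ℕ → ℕ} {k m : ℕ} (hk : k < m) (v : ℕ) :
    ∑ i ∈ Finset.range k with f i = v, g i + g k ≤ ∑ i ∈ Finset.range m, g i := by
  calc ∑ i ∈ Finset.range k with f i = v, g i + g k
      ≤ ∑ i ∈ Finset.range k, g i + g k :=
        Nat.add_le_add_right (Finset.sum_le_sum_of_subset (Finset.filter_subset _ _)) _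
    _ = ∑ i ∈ Finset.range (k + 1), g i := (Finset.sum_range_succ _ _).symm
    _ ≤ _ := Finset.sum_le_sum_of_subset (Finset.range_subset_range.2 hk)

theorem sum_range_add_le {g : ℕ → ℕ} {k m : ℕ} (hk : k < m) :
    ∑ i ∈ Finset.range k, g i + g k ≤ ∑ i ∈ Finset.range m, g i := by
  rw [← Finset.sum_range_succ]
  exact Finset.sum_le_sum_of_subset (Finset.range_subset_range.2 hk)

theorem read_spec {I : Inst} (hI : I.Valid) {W : ℕ} (hW : I.n + I.m + I.total + 2 ≤ W)
    {s : State} (hs : Input I (s.mem 0)) (hi : s.reg rI = 0) (hM : s.reg rTotal = 0)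
    (ho : s.mem aOut = 0) (hin : s.mem aIn = 0) :
    WP W readProg s fun s' t => Known I s' ∧ t ≤ 120 * (I.m + 1) := by
  have hr := hI.r_lt
  simp only [readProg, wp_seq, wp_set, Expr.eval, Expr.cost, State.setReg_mem, hs.n, hs.r, hs.m]
  refine ⟨by omega, by omega, by omega, ?_⟩
  refine WP.loop (fun s₁ => s₁.mem 0 = s.mem 0 ∧ s₁.reg rN = I.n ∧ s₁.reg rRoot = I.r ∧
    s₁.reg rEdges = I.m ∧ s₁.reg rI ≤ I.m ∧
    s₁.reg rTotal = ∑ i ∈ Finset.range (s₁.reg rI), I.mu i ∧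
    (∀ i < s₁.reg rI, s₁.mem aTail i = I.tl i ∧ s₁.mem aHead i = I.hd i ∧
      s₁.mem aMult i = I.mu i ∧ s₁.mem aFlag i = I.fl i) ∧
    s₁.mem aOut = (fun v => ∑ i ∈ Finset.range (s₁.reg rI) with I.tl i = v, I.mu i) ∧
    s₁.mem aIn = fun v => ∑ i ∈ Finset.range (s₁.reg rI) with I.hd i = v, I.mu i)
    (fun s₁ => 100 * (I.m - s₁.reg rI)) ?_ ?_ ?_
  · simp only [State.setReg_reg, State.setReg_mem, Nat.reduceEqDiff, if_false, if_true, hi, hM, ho,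
      hin, Finset.range_zero, Finset.filter_empty, Finset.sum_empty]
    exact ⟨trivial, trivial, trivial, trivial, Nat.zero_le _, trivial, fun i hi => by omega, rfl, rfl⟩
  · rintro s₁ - ⟨h₁, h₂, h₃, h₄, h₅, h₆, h₇, h₈, h₉⟩ h0
    simp only [Expr.eval, h₄] at h0
    have hk : s₁.reg rI < I.m := by omega
    set k := s₁.reg rI with hkdef
    have e₁ := hs.tl k hk
    have e₂ := hs.hd k hk
    have e₃ := hs.mu k hk
    have e₄ := hs.fl k hk
    have b₁ := hI.tl_lt k hk
    have b₂ := hI.hd_lt k hk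
    have b₃ := sum_range_add_le (g := I.mu) hk
    have b₄ := sum_filter_add_le (f := I.tl) (g := I.mu) hk (I.tl k)
    have b₅ := sum_filter_add_le (f := I.hd) (g := I.mu) hk (I.hd k)
    have b₆ := hI.fl_le k hk
    have u₁ := update_sum_filter_range I.tl I.mu k
    have u₂ := update_sum_filter_range I.hd I.mu k
    have hT : I.total = ∑ i ∈ Finset.range I.m, I.mu i := rfl
    simp only [readEdgeProg, field, wp_seq, wp_put, wp_set, Expr.eval, Expr.cost, State.setMem_reg,
      State.setReg_reg, State.setReg_mem, State.setMem_mem, Nat.reduceEqDiff, if_false, if_true,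
      ← hkdef, h₁, e₁, e₂, e₃, e₄, Function.update_self, h₈, h₉, h₆, h₂, h₃, h₄, u₁, u₂,
      ← Finset.sum_range_succ, OfNat.zero_ne_ofNat]
    rw [← Finset.sum_range_succ] at b₃
    refine ⟨by omega, by omega, by omega, by omega, by omega, by omega, by omega, by omega,
      ⟨trivial, trivial, trivial, trivial, hk, trivial, fun i hi => ?_, trivial, trivial⟩, by omega⟩
    rcases Nat.lt_succ_iff_lt_or_eq.1 hi with hi | rfl
    · simp only [Function.update_of_ne hi.ne]
      exact h₇ i hi
    · simp only [Function.update_self]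
      exact ⟨trivial, trivial, trivial, trivial⟩
  · rintro s₁ t - ⟨h₁, h₂, h₃, h₄, h₅, h₆, h₇, h₈, h₉⟩ h0 ht
    simp only [Expr.eval, h₄] at h0
    have hk : s₁.reg rI = I.m := by omega
    rw [hk] at h₆ h₇ h₈ h₉
    simp only [State.setReg_reg, Nat.reduceEqDiff, if_false, hi, Expr.cost] at ht
    exact ⟨⟨h₂, h₃, h₄, h₆, fun i hi => (h₇ i hi).1, fun i hi => (h₇ i hi).2.1,
      fun i hi => (h₇ i hi).2.2.1, fun i hi => (h₇ i hi).2.2.2, h₈, h₉⟩, by omega⟩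

/-- Testing whether every node is left as often as it is entered. -/
def balanceProg : Prog :=
  set rOk (const 1) ;;
  set rV (const 0) ;;
  loop (sub (var rN) (var rV))
    (ite (add (sub (get aOut (var rV)) (get aIn (var rV)))
        (sub (get aIn (var rV)) (get aOut (var rV))))
      (set rOk (const 0)) skip ;;
    set rV (add (var rV) (const 1)))

theorem balance_spec {I : Inst} {W : ℕ} (hW : I.n + I.m + I.total + 2 ≤ W)
    {s : State} (hs : Known I s) :
    WP W balanceProg s fun s' t => (s'.reg rOk ≠ 0 ↔ ∀ v < I.n, I.outDeg v = I.inDeg v) ∧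
      t ≤ 40 * (I.n + 1) := by
  simp only [balanceProg, wp_seq, wp_set, Expr.eval, Expr.cost]
  refine ⟨by omega, by omega, ?_⟩
  refine WP.loop (fun s₁ => s₁.reg rN = I.n ∧ s₁.mem aOut = I.outDeg ∧ s₁.mem aIn = I.inDeg ∧
    s₁.reg rV ≤ I.n ∧ (s₁.reg rOk ≠ 0 ↔ ∀ v < s₁.reg rV, I.outDeg v = I.inDeg v))
    (fun s₁ => 30 * (I.n - s₁.reg rV)) ?_ ?_ ?_
  · simp [hs.n, hs.out, hs.inn]
  · rintro s₁ - ⟨h₁, h₂, h₃, h₄, h₅⟩ h0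
    simp only [Expr.eval, h₁] at h0
    have hstep : (∀ v < s₁.reg rV + 1, I.outDeg v = I.inDeg v) ↔
        (∀ v < s₁.reg rV, I.outDeg v = I.inDeg v) ∧
          I.outDeg (s₁.reg rV) = I.inDeg (s₁.reg rV) := Nat.forall_lt_succ_right
    simp only [wp_seq, wp_ite, wp_set, wp_skip, Expr.eval, Expr.cost, State.setReg_reg,
      State.setReg_mem, Nat.reduceEqDiff, if_false, if_true, h₁, h₂, h₃, hstep, h₅]
    refine ⟨fun h => ⟨by omega, by omega, ⟨trivial, trivial, trivial, by omega, by simp; omega⟩,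
      by omega⟩, fun h => ⟨by omega, ⟨trivial, trivial, trivial, by omega, by simp; omega⟩,
      by omega⟩⟩
  · rintro s₁ t - ⟨h₁, h₂, h₃, h₄, h₅⟩ h0 ht
    simp only [Expr.eval, h₁] at h0
    simp only [State.setReg_reg, if_true, Expr.cost] at ht
    rw [show s₁.reg rV = I.n by omega] at h₅
    exact ⟨h₅, by omega⟩

/-- Marking the compulsory edges, and linking the usable ones into lists according to their
heads. -/
def linkProg : Prog :=
  set rI (const 0) ;;
  loop (sub (var rEdges) (var rI))
    (ite (add (sub (get aTail (var rI)) (var rRoot)) (sub (var rRoot) (get aTail (var rI))))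
      (ite (sub (const 2) (get aOut (get aTail (var rI))))
        (set rC (const 0)) (set rC (get aFlag (var rI))))
      (set rC (const 1)) ;;
    ite (var rC)
      (put aPr (var rI) (get aFlag (var rI)))
      (put aNxt (var rI) (get aFst (get aHead (var rI))) ;;
      put aFst (get aHead (var rI)) (add (var rI) (const 1))) ;;
    set rI (add (var rI) (const 1)))

/-- The first `k` edges have been classified. -/
structure Linked (I : Inst) (k : ℕ) (pr nxt fst : ℕ → ℕ) : Prop where
  pr : ∀ i < I.m, pr i ≠ 0 ↔ i < k ∧ I.Compulsory i
  nxt : ∀ i < k, I.Usable i → nxt i = I.lastUsable i (I.hd i)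
  fst : ∀ v, fst v = I.lastUsable k v

theorem link_spec {I : Inst} (hI : I.Valid) {W : ℕ} (hW : I.n + I.m + I.total + 2 ≤ W)
    {s : State} (hs : Known I s) (hpr : s.mem aPr = 0) (hfst : s.mem aFst = 0) :
    WP W linkProg s fun s' t => Linked I I.m (s'.mem aPr) (s'.mem aNxt) (s'.mem aFst) ∧
      t ≤ 80 * (I.m + 1) := by
  simp only [linkProg, wp_seq, wp_set, Expr.eval, Expr.cost]
  refine ⟨by omega, ?_⟩
  refine WP.loop (fun s₁ => Known I s₁ ∧ s₁.reg rI ≤ I.m ∧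
    Linked I (s₁.reg rI) (s₁.mem aPr) (s₁.mem aNxt) (s₁.mem aFst))
    (fun s₁ => 70 * (I.m - s₁.reg rI)) ?_ ?_ ?_
  · refine ⟨⟨hs.n, hs.r, hs.m, hs.M, hs.tl, hs.hd, hs.mu, hs.fl, hs.out, hs.inn⟩, by simp, ?_⟩
    simp only [State.setReg_reg, State.setReg_mem, if_true, hpr, hfst]
    exact ⟨fun i _ => by simp, fun i hi => by omega, fun v => rfl⟩
  · rintro s₁ - ⟨hk, h₁, h₂⟩ h0
    simp only [Expr.eval, hk.m] at h0
    have hlt : s₁.reg rI < I.m := by omega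
    have e₁ := hk.tl _ hlt
    have e₂ := hk.hd _ hlt
    have e₃ := hk.fl _ hlt
    have b₁ := hI.hd_lt _ hlt
    have b₂ := hI.fl_le _ hlt
    have b₃ := I.lastUsable_le (s₁.reg rI) (I.hd (s₁.reg rI))
    set k := s₁.reg rI with hkdef
    rw [wp_seq]
    have hclass : WP W (ite (add (sub (get aTail (var rI)) (var rRoot))
        (sub (var rRoot) (get aTail (var rI))))
        (ite (sub (const 2) (get aOut (get aTail (var rI))))
          (set rC (const 0)) (set rC (get aFlag (var rI))))
        (set rC (const 1))) s₁ fun s₂ t => (∃ c, s₂ = s₁.setReg rC c ∧ (c = 0 ↔ I.Usable k)) ∧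
          t ≤ 25 := by
      simp only [wp_ite, wp_set, Expr.eval, Expr.cost, ← hkdef, e₁, e₃, hk.r, hk.out]
      exact ⟨fun h₃ => ⟨fun h₄ => ⟨by omega, ⟨_, rfl, by unfold Inst.Usable; omega⟩, by omega⟩,
        fun h₄ => ⟨by omega, ⟨_, rfl, by unfold Inst.Usable; omega⟩, by omega⟩⟩,
        fun h₃ => ⟨by omega, ⟨_, rfl, by unfold Inst.Usable; omega⟩, by omega⟩⟩
    refine hclass.mono fun s₂ t₂ _ ⟨⟨c, h₃, h₄⟩, ht₂⟩ => ?_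
    subst h₃
    simp only [wp_seq, wp_ite, wp_put, wp_set, Expr.eval, Expr.cost, State.setReg_reg,
      State.setMem_reg, State.setReg_mem, State.setMem_mem, Nat.reduceEqDiff, if_false, if_true,
      ← hkdef, e₂, e₃]
    have hnew : ∀ v, I.lastUsable (k + 1) v =
        if I.Usable k ∧ I.hd k = v then k + 1 else I.lastUsable k v := fun _ => rfl
    refine ⟨fun hc => ?_, fun hc => ?_⟩
    · have hu : ¬ I.Usable k := fun h => hc (h₄.2 h)
      refine ⟨by omega, by omega, ⟨⟨hk.n, hk.r, hk.m, hk.M, hk.tl, hk.hd, hk.mu, hk.fl, hk.out,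
        hk.inn⟩, hlt, fun i hi => ?_, fun i hi hui => ?_, fun v => ?_⟩, by omega⟩
      · by_cases hik : i = k
        · subst hik
          rw [Function.update_self]
          unfold Inst.Compulsory
          unfold Inst.Usable at hu
          omega
        · rw [Function.update_of_ne hik, h₂.pr i hi]
          exact and_congr_left fun _ => by omega
      · rcases Nat.lt_succ_iff_lt_or_eq.1 hi with hi | rfl
        · exact h₂.nxt i hi hui
        · exact absurd hui hu
      · rw [hnew, if_neg (fun h => hu h.1)]
        exact h₂.fst v
    · have hu : I.Usable k := h₄.1 hc
      have b₄ := h₂.fst (I.hd k)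
      refine ⟨by omega, by omega, by omega, ⟨⟨hk.n, hk.r, hk.m, hk.M, hk.tl, hk.hd, hk.mu, hk.fl,
        hk.out, hk.inn⟩, hlt, fun i hi => ?_, fun i hi hui => ?_, fun v => ?_⟩, by omega⟩
      · rw [h₂.pr i hi]
        constructor
        · exact fun ⟨h₅, h₆⟩ => ⟨by omega, h₆⟩
        · rintro ⟨h₅, h₆⟩
          refine ⟨?_, h₆⟩
          by_contra h₇
          obtain rfl : i = k := by omega
          exact hu.not_compulsory h₆
      · rcases Nat.lt_succ_iff_lt_or_eq.1 hi with hi | rfl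
        · rw [Function.update_of_ne hi.ne]
          exact h₂.nxt i hi hui
        · rw [Function.update_self]
          exact b₄
      · rw [hnew]
        by_cases hv : I.hd k = v
        · subst hv
          rw [Function.update_self, if_pos ⟨hu, rfl⟩]
        · rw [Function.update_of_ne (Ne.symm hv), if_neg (fun h => hv h.2)]
          exact h₂.fst v
  · rintro s₁ t - ⟨hk, h₁, h₂⟩ h0 ht
    simp only [Expr.eval, hk.m] at h0
    rw [show s₁.reg rI = I.m by omega] at h₂
    simp only [State.setReg_reg, if_true, Expr.cost] at ht
    exact ⟨h₂, by omega⟩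

/-- The state of the search is in memory. -/
structure AtSearch (S : Inst.Search) (s : State) : Prop where
  k : s.reg rNodes = S.k
  p : s.reg rP = S.p
  node : s.mem aNode = S.node
  rank : s.mem aRank = S.rank
  disc : s.mem aDisc = S.disc
  te : s.mem aTe = S.te
  px : s.mem aPx = S.px
  par : s.mem aPar = S.par
  tz : s.mem aTz = S.tz
  st : s.mem aSt = S.st
  stk : s.mem aStk = S.stk
  t : s.mem aT = S.tz

def visitProg : Prog :=
  set rP (sub (var rP) (const 1)) ;;
  set rV (get aStk (var rP)) ;;
  put aNode (var rNodes) (var rV) ;;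
  put aRank (var rV) (var rNodes) ;;
  put aPar (var rNodes) (get aPx (var rV)) ;;
  put aTz (var rNodes) (get aTe (var rV)) ;;
  put aT (var rNodes) (get aTe (var rV)) ;;
  put aSt (add (var rNodes) (const 1)) (add (get aSt (var rNodes)) (get aOut (var rV))) ;;
  set rNodes (add (var rNodes) (const 1)) ;;
  set rE (get aFst (var rV))

def discoverProg : Prog :=
  set rE (sub (var rE) (const 1)) ;;
  set rU (get aTail (var rE)) ;;
  ite (get aDisc (var rU)) skip
    (put aDisc (var rU) (const 1) ;;
    put aTe (var rU) (var rE) ;;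
    put aPx (var rU) (sub (var rNodes) (const 1)) ;;
    put aStk (var rP) (var rU) ;;
    set rP (add (var rP) (const 1))) ;;
  set rE (get aNxt (var rE))

/-- Search from the root, against the direction of the usable edges. -/
def searchProg : Prog :=
  put aStk (const 0) (var rRoot) ;;
  put aDisc (var rRoot) (const 1) ;;
  set rP (const 1) ;;
  set rNodes (const 0) ;;
  loop (var rP)
    (visitProg ;;
    loop (var rE) discoverProg)

theorem visit_spec {I : Inst} {W : ℕ} (hW : I.n + I.m + I.total + 2 ≤ W) {S : Inst.Search}
    (hS : S.Inv I) {s : State} (hs : Known I s) (ha : AtSearch S s) (hp : 0 < S.p)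
    (hfst : ∀ v, s.mem aFst v ≤ I.m) :
    WP W visitProg s fun s' t => AtSearch (S.pop I) s' ∧
      s'.reg rE = s.mem aFst (S.stk (S.p - 1)) ∧ t ≤ 60 := by
  have h₁ := hS.stk_lt (S.p - 1) (by omega)
  have h₂ := hS.te_lt h₁ (hS.stk_disc _ (by omega))
  have h₃ := hS.k_le
  have h₄ := hS.p_le
  have h₅ := (hS.pop hp).st_le (j := S.k + 1) le_rfl
  have h₆ := hfst (S.stk (S.p - 1))
  simp only [Inst.Search.pop, Function.update_self] at h₅
  simp only [visitProg, wp_seq, wp_put, wp_set, Expr.eval, Expr.cost, State.setMem_reg,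
    State.setReg_reg, State.setReg_mem, State.setMem_mem, Nat.reduceEqDiff, if_false, if_true,
    ha.k, ha.p, ha.stk, ha.px, ha.te, ha.st, hs.out]
  refine ⟨by omega, by omega, by omega, by omega, by omega, by omega, by omega, by omega, by omega,
    by omega, ⟨?_, ?_, ?_, ?_, ?_, ?_, ?_, ?_, ?_, ?_, ?_, ?_⟩, trivial, by omega⟩ <;>
    simp [Inst.Search.pop, ha.node, ha.rank, ha.disc, ha.te, ha.px, ha.par, ha.tz, ha.st,
      ha.stk, ha.t]

theorem discover_spec {I : Inst} (hI : I.Valid) {W : ℕ} (hW : I.n + I.m + I.total + 2 ≤ W)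
    {S : Inst.Search} (hS : S.Inv I) {s : State} (hs : Known I s) (ha : AtSearch S s)
    (hk : 0 < S.k) {e : ℕ} (he : s.reg rE = e + 1) (hem : e < I.m) (hu : I.Usable e)
    (hh : I.hd e = S.node (S.k - 1)) (hnxt : s.mem aNxt e ≤ I.m) :
    WP W discoverProg s fun s' t => (∃ S' : Inst.Search, S'.Inv I ∧ AtSearch S' s' ∧
      S'.k = S.k ∧ S'.node = S.node ∧ (∀ u, S.disc u ≠ 0 → S'.disc u ≠ 0) ∧
      S'.disc (I.tl e) ≠ 0) ∧ s'.reg rE = s.mem aNxt e ∧ t ≤ 36 := by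
  have h₁ := hS.k_le
  have h₂ := hS.p_le
  have h₃ := hI.tl_lt e hem
  have h₄ := hs.tl e hem
  simp only [discoverProg, wp_seq, wp_ite, wp_put, wp_set, wp_skip, Expr.eval, Expr.cost,
    State.setMem_reg, State.setReg_reg, State.setReg_mem, State.setMem_mem, Nat.reduceEqDiff,
    if_false, if_true, ha.k, ha.p, ha.disc, he, Nat.add_sub_cancel, h₄]
  refine ⟨by omega, by omega, fun hd => ⟨by omega, ⟨S, hS, ?_, rfl, rfl, fun _ h => h, hd⟩,
    trivial, by omega⟩, fun hd => ⟨by omega, by omega, by omega, by omega, by omega, by omega,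
    ⟨S.push I e, hS.push hI hk hem hu hh hd, ?_, rfl, rfl, fun _ => Inst.Search.push_disc,
      by simp [Inst.Search.push]⟩, trivial, by omega⟩⟩
  · constructor <;> simp [ha.k, ha.p, ha.node, ha.rank, ha.disc, ha.te, ha.px, ha.par, ha.tz,
      ha.st, ha.stk, ha.t]
  · constructor <;> simp [Inst.Search.push, ha.k, ha.node, ha.rank, ha.disc, ha.te, ha.px,
      ha.par, ha.tz, ha.st, ha.stk, ha.t]

theorem search_spec {I : Inst} (hI : I.Valid) {W : ℕ} (hW : I.n + I.m + I.total + 2 ≤ W)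
    {s : State} (hs : Known I s)
    (hl : Linked I I.m (s.mem aPr) (s.mem aNxt) (s.mem aFst))
    (hz : ∀ a ∈ [aNode, aRank, aDisc, aTe, aPx, aPar, aTz, aSt, aStk, aT], s.mem a = 0) :
    WP W searchProg s fun s' t => (∃ S : Inst.Search, S.Inv I ∧ AtSearch S s' ∧ S.p = 0 ∧
      ∀ j < S.k, S.ClosedAt I (S.node j)) ∧ t ≤ 200 * (I.n + I.m + 1) := by
  have hr := hI.r_lt
  simp only [List.mem_cons, List.not_mem_nil, or_false, forall_eq_or_imp, forall_eq] at hz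
  obtain ⟨z₁, z₂, z₃, z₄, z₅, z₆, z₇, z₈, z₉, z₁₀⟩ := hz
  simp only [searchProg, wp_seq, wp_put, wp_set, Expr.eval, Expr.cost, State.setMem_reg, hs.r]
  refine ⟨by omega, by omega, by omega, by omega, ?_⟩
  -- A visit is paid for by the node, and a step through its list by a usable edge that enters it.
  -- No node is visited twice, so these edges are counted once.
  refine WP.loop_pot (fun s₁ N₁ => Known I s₁ ∧ s₁.mem aNxt = s.mem aNxt ∧
    s₁.mem aFst = s.mem aFst ∧ ∃ S : Inst.Search, S.Inv I ∧ AtSearch S s₁ ∧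
      (∀ j < S.k, S.ClosedAt I (S.node j)) ∧ N₁ = 80 * (I.n - S.k) +
        40 * (I.m - ∑ j ∈ Finset.range S.k, I.numUsable I.m (S.node j)))
    (80 * I.n + 40 * I.m) ?_ ?_ ?_
  · refine ⟨⟨hs.n, hs.r, hs.m, hs.M, hs.tl, hs.hd, hs.mu, hs.fl, hs.out, hs.inn⟩, by simp, by simp,
      I.start, Inst.Search.inv_start hI, ?_, fun j hj => absurd hj (Nat.not_lt_zero j), by
        simp [Inst.start]⟩
    constructor <;> simp [Inst.start, z₁, z₂, z₃, z₄, z₅, z₆, z₇, z₈, z₉, z₁₀]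
  · rintro s₁ _ - ⟨hk, h₁, h₂, S, hS, ha, hcl, rfl⟩ h0
    simp only [Expr.eval, ha.p] at h0
    have hp : 0 < S.p := by omega
    have hlu : ∀ v, s.mem aFst v ≤ I.m := fun v => (hl.fst v).trans_le (I.lastUsable_le _ _)
    rw [wp_seq]
    refine (visit_spec hW hS hk ha hp (by rwa [h₂])).mono fun s₂ t₂ hf₂ ⟨ha₂, hE, ht₂⟩ => ?_
    have hS₂ := hS.pop hp
    have hk₂ := hk.frame hf₂ (by decide) (by decide)
    have h₁' : s₂.mem aNxt = s.mem aNxt := (hf₂.mem _ (by decide)).trans h₁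
    have h₂' : s₂.mem aFst = s.mem aFst := (hf₂.mem _ (by decide)).trans h₂
    have hsum := Inst.sum_numUsable_le (I := I) fun j hj j' hj' he => hS₂.node_inj hj hj' he
    have hkle := hS₂.k_le
    have hnode : ∀ j < S.k, (S.pop I).node j = S.node j :=
      fun j hj => Function.update_of_ne hj.ne _ _
    have hlast : (S.pop I).node S.k = S.stk (S.p - 1) := Function.update_self ..
    have hkpop : (S.pop I).k = S.k + 1 := rfl
    rw [hkpop, Finset.sum_range_succ, Finset.sum_congr rfl fun j hj => by
      rw [hnode j (by simpa using hj)]] at hsum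
    rw [h₂, hl.fst, ← hlast] at hE
    refine WP.loop_pot (fun s₃ N₃ => Known I s₃ ∧ s₃.mem aNxt = s.mem aNxt ∧
      s₃.mem aFst = s.mem aFst ∧ ∃ S₃ : Inst.Search, S₃.Inv I ∧ AtSearch S₃ s₃ ∧
        S₃.k = S.k + 1 ∧ S₃.node = (S.pop I).node ∧ (∀ j < S.k, S₃.ClosedAt I (S.node j)) ∧
        -- The list runs from greater to smaller edge numbers. Here the edges from `x` on have been
        -- dealt with.
        ∃ x ≤ I.m, s₃.reg rE = I.lastUsable x ((S.pop I).node S.k) ∧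
          (∀ i, x ≤ i → i < I.m → I.Usable i → I.hd i = (S.pop I).node S.k →
            S₃.disc (I.tl i) ≠ 0) ∧ N₃ = 40 * I.numUsable x ((S.pop I).node S.k))
      (40 * I.numUsable I.m ((S.pop I).node S.k)) ?_ ?_ ?_
    · exact ⟨hk₂, h₁', h₂', S.pop I, hS₂, ha₂, rfl, rfl, hcl, I.m, le_rfl, hE,
        fun i h₃ h₄ => by omega, rfl⟩
    · rintro s₃ _ - ⟨hk₃, h₃, h₄, S₃, hS₃, ha₃, h₅, h₆, h₇, x, hx, h₈, h₉, rfl⟩ h0'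
      obtain ⟨e, he⟩ : ∃ e, s₃.reg rE = e + 1 := ⟨s₃.reg rE - 1, by
        simp only [Expr.eval] at h0'; omega⟩
      obtain ⟨g₁, g₂, g₃, g₄⟩ := Inst.lastUsable_eq_succ (h₈.symm.trans he)
      have hn := hl.nxt e (by omega) g₂
      refine (discover_spec hI hW hS₃ hk₃ ha₃ (by omega) he (by omega) g₂
        (by rw [h₅, h₆, Nat.add_sub_cancel, g₃]) (by
          rw [h₃, hn]; exact (I.lastUsable_le _ _).trans (by omega))).mono
        fun s₄ t₄ hf₄ ⟨⟨S₄, hS₄, ha₄, h₁₀, h₁₁, h₁₂, h₁₃⟩, hE₄, ht₄⟩ => ?_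
      have hnum := Inst.numUsable_lt g₁ g₂ g₃
      refine ⟨_, ⟨hk₃.frame hf₄ (by decide) (by decide), (hf₄.mem _ (by decide)).trans h₃,
        (hf₄.mem _ (by decide)).trans h₄, S₄, hS₄, ha₄, h₁₀.trans h₅, h₁₁.trans h₆,
        fun j hj i hi hu hh => h₁₂ _ (h₇ j hj i hi hu hh), e, by omega, ?_, ?_, rfl⟩, ?_⟩
      · rw [hE₄, h₃, hn, g₃]
      · intro i hei hi hu hh
        rcases hei.lt_or_eq with h | rfl
        · rcases Nat.lt_or_ge i x with h' | h'
          · exact absurd ⟨hu, hh⟩ (g₄ i h h')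
          · exact h₁₂ _ (h₉ i h' hi hu hh)
        · exact h₁₃
      · simp only [Expr.cost]
        omega
    · rintro s₃ _ t₃ - ⟨hk₃, h₃, h₄, S₃, hS₃, ha₃, h₅, h₆, h₇, x, hx, h₈, h₉, rfl⟩ h0' ht₃
      simp only [Expr.eval] at h0'
      simp only [Expr.cost] at ht₃ ⊢
      refine ⟨_, ⟨hk₃, h₃, h₄, S₃, hS₃, ha₃, ?_, rfl⟩, ?_⟩
      · intro j hj
        rw [h₆]
        rw [h₅] at hj
        rcases Nat.lt_succ_iff_lt_or_eq.1 hj with hj | rfl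
        · rw [hnode j hj]; exact h₇ j hj
        · intro i hi hu hh
          rcases Nat.lt_or_ge i x with h' | h'
          · exact absurd ⟨hu, hh⟩ (Inst.lastUsable_eq_zero (h₈.symm.trans h0') h')
          · exact h₉ i h' hi hu hh
      · rw [h₅, h₆, Finset.sum_range_succ, Finset.sum_congr rfl fun j hj => by
          rw [hnode j (by simpa using hj)]]
        omega
  · rintro s₁ _ t₁ - ⟨hk, h₁, h₂, S, hS, ha, hcl, rfl⟩ h0 ht
    simp only [Expr.eval, ha.p] at h0
    simp only [Expr.cost] at ht
    exact ⟨⟨S, hS, ha, h0, hcl⟩, by omega⟩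

/-- Testing whether all tails have been discovered, and renaming the ends of the edges. -/
def renameProg : Prog :=
  set rI (const 0) ;;
  loop (sub (var rEdges) (var rI))
    (ite (get aDisc (get aTail (var rI))) skip (set rOk (const 0)) ;;
    put aTl (var rI) (get aRank (get aTail (var rI))) ;;
    put aHd (var rI) (get aRank (get aHead (var rI))) ;;
    set rI (add (var rI) (const 1)))

theorem rename_spec {I : Inst} (hI : I.Valid) {W : ℕ} (hW : I.n + I.m + I.total + 2 ≤ W)
    {s : State} (hs : Known I s) (hrank : ∀ v < I.n, s.mem aRank v < W) :
    WP W renameProg s fun s' t =>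
      (s'.reg rOk ≠ 0 ↔ s.reg rOk ≠ 0 ∧ ∀ i < I.m, s.mem aDisc (I.tl i) ≠ 0) ∧
      (∀ i < I.m, s'.mem aTl i = s.mem aRank (I.tl i)) ∧
      (∀ i < I.m, s'.mem aHd i = s.mem aRank (I.hd i)) ∧ t ≤ 50 * (I.m + 1) := by
  simp only [renameProg, wp_seq, wp_set, Expr.eval, Expr.cost]
  refine ⟨by omega, ?_⟩
  refine WP.loop (fun s₁ => Known I s₁ ∧ s₁.mem aRank = s.mem aRank ∧
    s₁.mem aDisc = s.mem aDisc ∧ s₁.reg rI ≤ I.m ∧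
    (s₁.reg rOk ≠ 0 ↔ s.reg rOk ≠ 0 ∧ ∀ i < s₁.reg rI, s.mem aDisc (I.tl i) ≠ 0) ∧
    (∀ i < s₁.reg rI, s₁.mem aTl i = s.mem aRank (I.tl i)) ∧
    (∀ i < s₁.reg rI, s₁.mem aHd i = s.mem aRank (I.hd i)))
    (fun s₁ => 40 * (I.m - s₁.reg rI)) ?_ ?_ ?_
  · refine ⟨⟨hs.n, hs.r, hs.m, hs.M, hs.tl, hs.hd, hs.mu, hs.fl, hs.out, hs.inn⟩, ?_⟩
    simp
  · rintro s₁ - ⟨hk, h₁, h₂, h₃, h₄, h₅, h₆⟩ h0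
    simp only [Expr.eval, hk.m] at h0
    have hlt : s₁.reg rI < I.m := by omega
    have e₁ := hk.tl _ hlt
    have e₂ := hk.hd _ hlt
    have b₁ := hrank _ (hI.tl_lt _ hlt)
    have b₂ := hrank _ (hI.hd_lt _ hlt)
    have hstep : (∀ i < s₁.reg rI + 1, s.mem aDisc (I.tl i) ≠ 0) ↔
        (∀ i < s₁.reg rI, s.mem aDisc (I.tl i) ≠ 0) ∧ s.mem aDisc (I.tl (s₁.reg rI)) ≠ 0 :=
      Nat.forall_lt_succ_right
    simp only [wp_seq, wp_ite, wp_put, wp_set, wp_skip, Expr.eval, Expr.cost, State.setMem_reg,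
      State.setMem_mem, State.setReg_reg, State.setReg_mem, Nat.reduceEqDiff, if_false, if_true,
      e₁, e₂, h₁, h₂, hstep]
    have hupd : ∀ (f g : ℕ → ℕ), (∀ i < s₁.reg rI, f i = g i) →
        ∀ i < s₁.reg rI + 1, Function.update f (s₁.reg rI) (g (s₁.reg rI)) i = g i := by
      intro f g hfg i hi
      rcases Nat.lt_succ_iff_lt_or_eq.1 hi with hi | rfl
      · rw [Function.update_of_ne hi.ne]; exact hfg i hi
      · rw [Function.update_self]
    refine ⟨fun hd => ⟨by omega, by omega, by omega, ⟨⟨hk.n, hk.r, hk.m, hk.M, hk.tl, hk.hd, hk.mu,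
      hk.fl, hk.out, hk.inn⟩, trivial, trivial, hlt, ?_, ?_, ?_⟩, by omega⟩,
      fun hd => ⟨by omega, by omega, by omega, by omega, ⟨⟨hk.n, hk.r, hk.m, hk.M, hk.tl, hk.hd,
      hk.mu, hk.fl, hk.out, hk.inn⟩, trivial, trivial, hlt, ?_, ?_, ?_⟩, by omega⟩⟩
    · rw [h₄]; tauto
    · exact hupd _ (fun i => s.mem aRank (I.tl i)) h₅
    · exact hupd _ (fun i => s.mem aRank (I.hd i)) h₆
    · simp [hd]
    · exact hupd _ (fun i => s.mem aRank (I.tl i)) h₅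
    · exact hupd _ (fun i => s.mem aRank (I.hd i)) h₆
  · rintro s₁ t - ⟨hk, h₁, h₂, h₃, h₄, h₅, h₆⟩ h0 ht
    simp only [Expr.eval, hk.m] at h0
    rw [show s₁.reg rI = I.m by omega] at h₄ h₅ h₆
    simp only [State.setReg_reg, if_true, Expr.cost] at ht
    exact ⟨h₄, h₅, h₆, by omega⟩

/-- Computing the ends of the subtrees. -/
def endsProg : Prog :=
  set rJ (var rNodes) ;;
  loop (var rJ)
    (set rJ (sub (var rJ) (const 1)) ;;
    ite (get aEn (var rJ)) skip (put aEn (var rJ) (add (var rJ) (const 1))) ;;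
    ite (var rJ)
      (ite (get aEn (get aPar (var rJ))) skip
        (put aEn (get aPar (var rJ)) (get aEn (var rJ))))
      skip)

/-- Nodes are treated from the greatest down, so all children come before their parent. A node whose
end is still unset has no children. The first child to pass on its end is the last child of its
parent, and the two subtrees end together. Ends are positive, so `0` can stand for an unset one. -/
theorem ends_spec {W l : ℕ} (hW : l + 2 ≤ W) {s : State} (hl : s.reg rNodes = l)
    (hpar : ∀ j, 0 < j → j < l → s.mem aPar j < j)
    (hnc : ∀ j w, 0 < j → j < w → w < l → s.mem aPar w ≤ s.mem aPar j ∨ j ≤ s.mem aPar w)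
    (hE : s.mem aEn = 0) :
    WP W endsProg s fun s' t =>
      (∀ v < l, Inst.SubtreeEnd (s.mem aPar) l v (s'.mem aEn v)) ∧ t ≤ 60 * (l + 1) := by
  simp only [endsProg, wp_seq, wp_set, Expr.eval, Expr.cost, hl]
  refine ⟨by omega, ?_⟩
  refine WP.loop (fun s₁ => s₁.mem aPar = s.mem aPar ∧ s₁.reg rJ ≤ l ∧
    (∀ v < l, s₁.reg rJ ≤ v → s₁.mem aEn v ≠ 0) ∧
    (∀ v < l, s₁.mem aEn v ≠ 0 → Inst.SubtreeEnd (s.mem aPar) l v (s₁.mem aEn v)) ∧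
    ∀ v < l, s₁.mem aEn v = 0 → ∀ c, s₁.reg rJ ≤ c → c < l → s.mem aPar c ≠ v)
    (fun s₁ => 50 * s₁.reg rJ) ?_ ?_ ?_
  · simp only [State.setReg_reg, State.setReg_mem, if_true, hE]
    exact ⟨trivial, le_rfl, fun v h₁ h₂ => by omega, fun v _ h => absurd rfl h,
      fun v _ _ c h₁ h₂ => by omega⟩
  · rintro s₁ - ⟨h₁, h₂, h₃, h₄, h₅⟩ h0
    simp only [Expr.eval] at h0
    obtain ⟨j, hj⟩ : ∃ j, s₁.reg rJ = j + 1 := ⟨s₁.reg rJ - 1, by omega⟩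
    rw [hj] at h₂ h₃ h₅
    rw [wp_seq, wp_set]
    simp only [Expr.eval, Expr.cost, hj, Nat.add_sub_cancel]
    refine ⟨by omega, ?_⟩
    rw [wp_seq]
    have hself : WP W (ite (get aEn (var rJ)) skip (put aEn (var rJ) (add (var rJ) (const 1))))
        (s₁.setReg rJ j) fun s₂ t => s₂.reg rJ = j ∧ s₂.mem aPar = s.mem aPar ∧
          (∀ v < l, j ≤ v → s₂.mem aEn v ≠ 0) ∧
          (∀ v < l, s₂.mem aEn v ≠ 0 → Inst.SubtreeEnd (s.mem aPar) l v (s₂.mem aEn v)) ∧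
          (∀ v < l, s₂.mem aEn v = 0 → ∀ c, j + 1 ≤ c → c < l → s.mem aPar c ≠ v) ∧ t ≤ 10 := by
      simp only [wp_ite, wp_put, wp_skip, Expr.eval, Expr.cost, State.setMem_reg, State.setMem_mem,
        State.setReg_reg, State.setReg_mem, Nat.reduceEqDiff, if_false, if_true]
      refine ⟨fun hj0 => ⟨trivial, h₁, fun v hv hjv => ?_, h₄, h₅, by omega⟩, fun hj0 =>
        ⟨⟨by omega, by omega⟩, trivial, h₁, fun v hv hjv => ?_, fun v hv hv0 => ?_,
          fun v hv hv0 => ?_, by omega⟩⟩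
      · rcases hjv.lt_or_eq with h | rfl
        · exact h₃ v hv h
        · exact hj0
      · by_cases hvj : v = j
        · subst hvj; simp
        · rw [Function.update_of_ne hvj]; exact h₃ v hv (by omega)
      · by_cases hvj : v = j
        · subst hvj
          rw [Function.update_self]
          exact .leaf hv hpar (h₅ v hv hj0)
        · rw [Function.update_of_ne hvj] at hv0 ⊢
          exact h₄ v hv hv0
      · by_cases hvj : v = j
        · subst hvj; simp at hv0
        · rw [Function.update_of_ne hvj] at hv0
          exact h₅ v hv hv0
    refine hself.mono fun s₂ t₂ _ ⟨g₁, g₂, g₃, g₄, g₅, ht₂⟩ => ?_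
    simp only [wp_ite, wp_put, wp_skip, Expr.eval, Expr.cost, State.setMem_reg, State.setMem_mem,
      Nat.reduceEqDiff, if_false, if_true, g₁, g₂]
    have hjl : j < l := by omega
    have hjE := g₄ j hjl (g₃ j hjl le_rfl)
    have hle := hjE.le
    refine ⟨fun hj0 => ?_, fun hj0 => ⟨⟨trivial, by omega, g₃, g₄, fun v hv hv0 c hc hcl => ?_⟩,
      by omega⟩⟩
    · have hp := hpar j (by omega) hjl
      refine ⟨fun hp0 => ⟨⟨trivial, by omega, g₃, g₄, fun v hv hv0 c hc hcl => ?_⟩, by omega⟩,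
        fun hp0 => ⟨⟨by omega, by omega⟩, ⟨trivial, by omega, fun v hv hjv => ?_,
          fun v hv hv0 => ?_, fun v hv hv0 c hc hcl => ?_⟩, by omega⟩⟩
      · rcases hc.lt_or_eq with h | rfl
        · exact g₅ v hv hv0 c h hcl
        · rintro rfl; exact hp0 hv0
      · rw [Function.update_of_ne (by omega)]; exact g₃ v hv hjv
      · by_cases hvp : v = s.mem aPar j
        · subst hvp
          rw [Function.update_self]
          exact hjE.parent (by omega) hpar hnc (g₅ _ hv hp0)
        · rw [Function.update_of_ne hvp] at hv0 ⊢
          exact g₄ v hv hv0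
      · by_cases hvp : v = s.mem aPar j
        · subst hvp
          rw [Function.update_self] at hv0
          exact absurd hv0 (g₃ j hjl le_rfl)
        · rw [Function.update_of_ne hvp] at hv0
          rcases hc.lt_or_eq with h | rfl
          · exact g₅ v hv hv0 c h hcl
          · exact Ne.symm hvp
    · subst hj0
      exact absurd hv0 (g₃ v hv (Nat.zero_le v))
  · rintro s₁ t - ⟨h₁, h₂, h₃, h₄, h₅⟩ h0 ht
    simp only [Expr.eval] at h0
    simp only [State.setReg_reg, if_true, Expr.cost] at ht
    exact ⟨fun v hv => h₄ v hv (h₃ v hv (by omega)), by omega⟩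

end RAM

/-! ### From the search to a valid core instance -/

namespace Inst

/-- The core instance `K` is the instance `I` with the nodes in `D` renamed by `rank`. -/
structure Represents (K : Core) (I : Inst) (D : ℕ → Prop) (rank : ℕ → ℕ) : Prop where
  m : K.m = I.m
  tl : ∀ i < I.m, K.tl i = rank (I.tl i)
  hd : ∀ i < I.m, K.hd i = rank (I.hd i)
  mu : ∀ i < I.m, K.mu i = I.mu i
  pr : ∀ i < I.m, K.pr i ≠ 0 ↔ I.Compulsory i
  r : rank I.r = 0
  inj : ∀ u v, D u → D v → rank u = rank v → u = v
  dr : D I.r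
  dtl : ∀ i < I.m, D (I.tl i)
  dhd : ∀ i < I.m, D (I.hd i)

/-- No Eulerian cycle is possible: either some node is not entered as often as left, or some
edges do not leave nodes from which usable edges lead to the root. -/
def Infeasible (I : Inst) : Prop :=
  (∃ v, v < I.n ∧ I.outDeg v ≠ I.inDeg v) ∨
    ∃ D : ℕ → Prop, D I.r ∧ (∀ i < I.m, I.Usable i → D (I.hd i) → D (I.tl i)) ∧
      ∃ i < I.m, ¬ D (I.tl i)

namespace Search

variable {I : Inst} {S : Search}

theorem Inv.rank_spec (h : S.Inv I) (hp : S.p = 0) {v : ℕ} (hv : v < I.n) (hd : S.disc v ≠ 0) :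
    S.rank v < S.k ∧ S.node (S.rank v) = v := by
  rcases h.of_disc v hv hd with ⟨j, hj, rfl⟩ | ⟨q, hq, _⟩
  · rw [h.node_rank j hj]
    exact ⟨hj, rfl⟩
  · omega

theorem Inv.rank_eq_iff (h : S.Inv I) (hp : S.p = 0) {v j : ℕ} (hv : v < I.n)
    (hd : S.disc v ≠ 0) (hj : j < S.k) : S.rank v = j ↔ v = S.node j := by
  constructor
  · rintro rfl
    exact (h.rank_spec hp hv hd).2.symm
  · rintro rfl
    exact h.node_rank j hj

theorem Inv.k_pos (h : S.Inv I) (hp : S.p = 0) : 0 < S.k := by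
  by_contra hk
  have := (h.start (by omega)).1
  omega

/-- When all tails have been discovered, the out-degrees of the ranked nodes account for every edge.
-/
theorem Inv.st_last (h : S.Inv I) (hI : I.Valid) (hp : S.p = 0)
    (hd : ∀ i < I.m, S.disc (I.tl i) ≠ 0) : S.st S.k = I.total := by
  refine (h.st_le le_rfl).antisymm ?_
  rw [h.st_eq le_rfl]
  have hfib : ∀ i ∈ Finset.range I.m, S.rank (I.tl i) ∈ Finset.range S.k := fun i hi => by
    have hi := Finset.mem_range.1 hi
    exact Finset.mem_range.2 (h.rank_spec hp (hI.tl_lt i hi) (hd i hi)).1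
  rw [total, ← Finset.sum_fiberwise_of_maps_to hfib]
  refine Finset.sum_le_sum fun j hj => Finset.sum_le_sum_of_subset fun i hi => ?_
  simp only [Finset.mem_filter, Finset.mem_range] at hi hj ⊢
  exact ⟨hi.1, (h.rank_eq_iff hp (hI.tl_lt i hi.1) (hd i hi.1) hj).1 hi.2⟩

theorem Inv.node_pos (h : S.Inv I) {j : ℕ} (hj0 : 0 < j) (hj : j < S.k) : S.node j ≠ I.r := by
  intro he
  have := h.node_inj (by omega) hj ((h.node_zero (by omega)).trans he.symm)
  omega

theorem Inv.infeasible (h : S.Inv I) (hI : I.Valid) (hp : S.p = 0)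
    (hcl : ∀ j < S.k, S.ClosedAt I (S.node j))
    (hno : ¬ ((∀ v < I.n, I.outDeg v = I.inDeg v) ∧ ∀ i < I.m, S.disc (I.tl i) ≠ 0)) :
    I.Infeasible := by
  by_cases hb : ∀ v < I.n, I.outDeg v = I.inDeg v
  · have hd : ¬ ∀ i < I.m, S.disc (I.tl i) ≠ 0 := fun hd => hno ⟨hb, hd⟩
    push Not at hd
    obtain ⟨i, hi, hd⟩ := hd
    refine .inr ⟨fun v => S.disc v ≠ 0, h.disc_r, fun j hj hu hdj => ?_, i, hi, fun h => h hd⟩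
    obtain ⟨h₁, h₂⟩ := h.rank_spec hp (hI.hd_lt j hj) hdj
    exact hcl _ h₁ j hj hu h₂.symm
  · push Not at hb
    exact .inl hb

end Search

theorem core_valid {I : Inst} (hI : I.Valid) {S : Search} (hS : S.Inv I) (hp : S.p = 0)
    (hb : ∀ v < I.n, I.outDeg v = I.inDeg v) (hdt : ∀ i < I.m, S.disc (I.tl i) ≠ 0)
    {tl hd mu pr en : ℕ → ℕ} (htl : ∀ i < I.m, tl i = S.rank (I.tl i))
    (hhd : ∀ i < I.m, hd i = S.rank (I.hd i)) (hmu : ∀ i < I.m, mu i = I.mu i)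
    (hpr : ∀ i < I.m, pr i ≠ 0 ↔ I.Compulsory i)
    (hen : ∀ v < S.k, SubtreeEnd S.par S.k v (en v)) :
    (⟨S.k, I.m, I.total, tl, hd, mu, pr, S.st, S.tz, en⟩ : Core).Valid ∧
    Represents ⟨S.k, I.m, I.total, tl, hd, mu, pr, S.st, S.tz, en⟩ I
      (fun v => v < I.n ∧ S.disc v ≠ 0) S.rank := by
  -- By balance every node that is entered is also left, so each head is the tail of some edge and
  -- has been discovered.
  have hdh : ∀ i < I.m, S.disc (I.hd i) ≠ 0 := fun i hi => by
    have h₁ : I.mu i ≤ I.inDeg (I.hd i) :=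
      Finset.single_le_sum (f := I.mu) (fun _ _ => Nat.zero_le _) (by simp [hi])
    rw [← hb _ (hI.hd_lt i hi)] at h₁
    have h₂ := hI.mu_pos i hi
    obtain ⟨j, hj, -⟩ := Finset.exists_ne_zero_of_sum_ne_zero
      (show ∑ j ∈ Finset.range I.m with I.tl j = I.hd i, I.mu j ≠ 0 by
        change I.outDeg _ ≠ 0; omega)
    simp only [Finset.mem_filter, Finset.mem_range] at hj
    rw [← hj.2]
    exact hdt j hj.1
  set K : Core := ⟨S.k, I.m, I.total, tl, hd, mu, pr, S.st, S.tz, en⟩ with hK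
  have hout : ∀ v < S.k, K.outDeg v = I.outDeg (S.node v) := fun v hv => by
    refine Finset.sum_congr (Finset.filter_congr fun i hi => ?_) fun i hi => hmu i ?_
    · have hi := Finset.mem_range.1 hi
      rw [show K.tl i = S.rank (I.tl i) from htl i hi]
      exact hS.rank_eq_iff hp (hI.tl_lt i hi) (hdt i hi) hv
    · simp only [Finset.mem_filter, Finset.mem_range] at hi
      exact hi.1
  have hin : ∀ v < S.k, K.inDeg v = I.inDeg (S.node v) := fun v hv => by
    refine Finset.sum_congr (Finset.filter_congr fun i hi => ?_) fun i hi => hmu i ?_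
    · have hi := Finset.mem_range.1 hi
      rw [show K.hd i = S.rank (I.hd i) from hhd i hi]
      exact hS.rank_eq_iff hp (hI.hd_lt i hi) (hdh i hi) hv
    · simp only [Finset.mem_filter, Finset.mem_range] at hi
      exact hi.1
  have htree : ∀ v, 0 < v → v < S.k → S.tz v < I.m ∧ I.tl (S.tz v) = S.node v ∧
      I.Usable (S.tz v) ∧ S.rank (I.hd (S.tz v)) = S.par v ∧ S.par v < v := fun v hv hvk => by
    obtain ⟨h₁, h₂, h₃⟩ := hS.par v hv hvk
    obtain ⟨h₄, h₅, h₆, h₇, h₈⟩ := hS.te _ (hS.node_lt v hvk) (hS.node_disc v hvk)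
      (hS.node_pos hv hvk)
    rw [h₃]
    exact ⟨h₄, h₅, h₆, by rw [← h₈, hS.node_rank _ h₇, h₁], h₂⟩
  have hrank_tl : ∀ i < I.m, S.rank (I.tl i) < S.k ∧ S.node (S.rank (I.tl i)) = I.tl i :=
    fun i hi => hS.rank_spec hp (hI.tl_lt i hi) (hdt i hi)
  have hr0 : S.rank I.r = 0 :=
    (hS.rank_eq_iff hp hI.r_lt hS.disc_r (hS.k_pos hp)).2 (hS.node_zero (hS.k_pos hp)).symm
  constructor
  · exact {
      l_pos := hS.k_pos hp
      tl_lt := fun i hi => by rw [show K.tl i = _ from htl i hi]; exact (hrank_tl i hi).1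
      hd_lt := fun i hi => by
        rw [show K.hd i = _ from hhd i hi]
        exact (hS.rank_spec hp (hI.hd_lt i hi) (hdh i hi)).1
      mu_pos := fun i hi => by rw [show K.mu i = _ from hmu i hi]; exact hI.mu_pos i hi
      st_zero := hS.st_zero
      st_succ := fun v hv => by rw [hout v hv]; exact hS.st_succ v hv
      st_last := hS.st_last hI hp hdt
      balance := fun v hv => by rw [hout v hv, hin v hv]; exact hb _ (hS.node_lt v hv)
      pr_mu := fun i hi h => by
        rw [show K.mu i = _ from hmu i hi]
        exact hI.fl_mu i hi ((hpr i hi).1 h).1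
      pr_unique := fun i hi j hj h h' he => by
        rw [show K.tl i = _ from htl i hi, show K.tl j = _ from htl j hj] at he
        refine hI.fl_unique i hi j hj ((hpr i hi).1 h).1 ((hpr j hj).1 h').1 ?_
        rw [← (hrank_tl i hi).2, he, (hrank_tl j hj).2]
      pr_two := fun i hi h h0 => by
        rw [show K.tl i = _ from htl i hi] at h0 ⊢
        rw [hout _ (hrank_tl i hi).1, (hrank_tl i hi).2]
        refine ((hpr i hi).1 h).2.resolve_left fun he => h0 ?_
        rw [he, hr0]
      t0_lt := fun v hv hvl => (htree v hv hvl).1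
      t0_tl := fun v hv hvl => by
        obtain ⟨h₁, h₂, -⟩ := htree v hv hvl
        change tl (S.tz v) = v
        rw [htl _ h₁, h₂, hS.node_rank v hvl]
      t0_pr := fun v hv hvl => by
        obtain ⟨h₁, -, h₂, -⟩ := htree v hv hvl
        by_contra h
        exact h₂.not_compulsory ((hpr _ h₁).1 h)
      t0_hd := fun v hv hvl => by
        obtain ⟨h₁, -, -, h₂, h₃⟩ := htree v hv hvl
        change hd (S.tz v) < v
        rwa [hhd _ h₁, h₂]
      en_spec := fun v hv w hw => by
        refine Core.onChain_iff_of_subtreeEnd (K := K) (par := S.par) (fun w h₁ h₂ => ?_)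
          (fun j h₁ h₂ => (htree j h₁ h₂).2.2.2.2) hS.noncrossing (hen v hv) hw
        obtain ⟨h₃, -, -, h₄, -⟩ := htree w h₁ h₂
        exact (hhd _ h₃).trans h₄ }
  · exact ⟨rfl, htl, hhd, hmu, hpr, hr0, fun u v hu hv he => by
      rw [← (hS.rank_spec hp hu.1 hu.2).2, he, (hS.rank_spec hp hv.1 hv.2).2],
      ⟨hI.r_lt, hS.disc_r⟩, fun i hi => ⟨hI.tl_lt i hi, hdt i hi⟩,
      fun i hi => ⟨hI.hd_lt i hi, hdh i hi⟩⟩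

end Inst

/-! ### The complete program -/

namespace RAM

open RAM.Expr RAM.Prog

theorem AtSearch.frame {S : Inst.Search} {s s' : State} (h : AtSearch S s) {P : Prog}
    (hf : Frame P s s') (h₁ : ∀ x ∈ [rNodes, rP], x ∉ P.wreg)
    (h₂ : ∀ a ∈ [aNode, aRank, aDisc, aTe, aPx, aPar, aTz, aSt, aStk, aT], a ∉ P.warr) :
    AtSearch S s' := by
  simp only [List.mem_cons, List.not_mem_nil, or_false, forall_eq_or_imp, forall_eq] at h₁ h₂
  obtain ⟨h₁, h₃⟩ := h₁
  obtain ⟨g₁, g₂, g₃, g₄, g₅, g₆, g₇, g₈, g₉, g₁₀⟩ := h₂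
  exact ⟨(hf.reg _ h₁).trans h.k, (hf.reg _ h₃).trans h.p, (hf.mem _ g₁).trans h.node,
    (hf.mem _ g₂).trans h.rank, (hf.mem _ g₃).trans h.disc, (hf.mem _ g₄).trans h.te,
    (hf.mem _ g₅).trans h.px, (hf.mem _ g₆).trans h.par, (hf.mem _ g₇).trans h.tz,
    (hf.mem _ g₈).trans h.st, (hf.mem _ g₉).trans h.stk, (hf.mem _ g₁₀).trans h.t⟩

/-- The whole preparation. -/
def prepareProg : Prog :=
  readProg ;; balanceProg ;; linkProg ;; searchProg ;; renameProg ;; endsProg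

/-- The enumeration of all solutions. -/
def mainProg : Prog :=
  prepareProg ;;
  ite (var rOk) coreProg skip

theorem prepare_spec {I : Inst} (hI : I.Valid) {W : ℕ} (hW : I.n + I.m + I.total + 2 ≤ W)
    {input : List ℕ} (hin : Input I ((init input).mem 0)) :
    WP W prepareProg (init input) fun s t => Known I s ∧ s.out = [] ∧
      (∀ i < I.m, s.mem aPr i ≠ 0 ↔ I.Compulsory i) ∧
      (∃ S : Inst.Search, S.Inv I ∧ AtSearch S s ∧ S.p = 0 ∧
        (∀ j < S.k, S.ClosedAt I (S.node j)) ∧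
        (s.reg rOk ≠ 0 ↔ (∀ v < I.n, I.outDeg v = I.inDeg v) ∧ ∀ i < I.m, S.disc (I.tl i) ≠ 0) ∧
        (∀ i < I.m, s.mem aTl i = S.rank (I.tl i)) ∧
        (∀ i < I.m, s.mem aHd i = S.rank (I.hd i)) ∧
        ∀ v < S.k, Inst.SubtreeEnd S.par S.k v (s.mem aEn v)) ∧ t ≤ 600 * (I.n + I.m + 1) := by
  have hz : ∀ a, a ≠ 0 → (init input).mem a = 0 := fun a ha => by
    funext i
    simp [init, ha]
  simp only [prepareProg]
  rw [wp_seq]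
  refine (read_spec hI hW hin rfl rfl (hz _ (by decide)) (hz _ (by decide))).mono
    fun s₁ t₁ f₁ ⟨k₁, ht₁⟩ => ?_
  rw [wp_seq]
  refine (balance_spec hW k₁).mono fun s₂ t₂ f₂ ⟨b₂, ht₂⟩ => ?_
  have k₂ := k₁.frame f₂ (by decide) (by decide)
  rw [wp_seq]
  refine (link_spec hI hW k₂
    (((f₂.mem _ (by decide)).trans (f₁.mem _ (by decide))).trans (hz _ (by decide)))
    (((f₂.mem _ (by decide)).trans (f₁.mem _ (by decide))).trans (hz _ (by decide)))).mono
    fun s₃ t₃ f₃ ⟨l₃, ht₃⟩ => ?_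
  have k₃ := k₂.frame f₃ (by decide) (by decide)
  rw [wp_seq]
  refine (search_spec hI hW k₃ l₃ fun a ha => ?_).mono
    fun s₄ t₄ f₄ ⟨⟨S, hS, a₄, hp, hcl⟩, ht₄⟩ => ?_
  · simp only [List.mem_cons, List.not_mem_nil, or_false] at ha
    rcases ha with rfl | rfl | rfl | rfl | rfl | rfl | rfl | rfl | rfl | rfl <;>
      exact (((f₃.mem _ (by decide)).trans (f₂.mem _ (by decide))).trans
        (f₁.mem _ (by decide))).trans (hz _ (by decide))
  have k₄ := k₃.frame f₄ (by decide) (by decide)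
  have hkle := hS.k_le
  rw [wp_seq]
  refine (rename_spec hI hW k₄ fun v hv => ?_).mono fun s₅ t₅ f₅ ⟨o₅, tl₅, hd₅, ht₅⟩ => ?_
  · rw [a₄.rank]
    have := hS.rank_le v
    omega
  have k₅ := k₄.frame f₅ (by decide) (by decide)
  have a₅ := a₄.frame f₅ (by decide) (by decide)
  refine (ends_spec (l := S.k) (by omega) a₅.k
    (fun j h₁ h₂ => by rw [a₅.par]; exact (hS.par j h₁ h₂).2.1)
    (by rw [a₅.par]; exact hS.noncrossing) (((((f₅.mem _ (by decide)).trans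
      (f₄.mem _ (by decide))).trans (f₃.mem _ (by decide))).trans ((f₂.mem _ (by decide)).trans
      (f₁.mem _ (by decide)))).trans (hz _ (by decide)))).mono fun s₆ t₆ f₆ ⟨en₆, ht₆⟩ => ?_
  have hok : s₆.reg rOk = s₅.reg rOk := f₆.reg _ (by decide)
  have hok' : s₄.reg rOk = s₂.reg rOk := (f₄.reg _ (by decide)).trans (f₃.reg _ (by decide))
  refine ⟨k₅.frame f₆ (by decide) (by decide), ?_, ?_, ⟨S, hS, a₅.frame f₆ (by decide) (by decide),
    hp, hcl, ?_, ?_, ?_, ?_⟩, by omega⟩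
  · rw [f₆.out (by decide), f₅.out (by decide), f₄.out (by decide), f₃.out (by decide),
      f₂.out (by decide), f₁.out (by decide)]
    rfl
  · rw [f₆.mem _ (by decide), f₅.mem _ (by decide), f₄.mem _ (by decide)]
    exact fun i hi => (l₃.pr i hi).trans (and_iff_right hi)
  · rw [hok, o₅, hok', b₂, a₄.disc]
  · rw [f₆.mem _ (by decide), ← a₄.rank]
    exact tl₅
  · rw [f₆.mem _ (by decide), ← a₄.rank]
    exact hd₅
  · rw [← a₅.par]
    exact en₆

theorem main_spec {I : Inst} (hI : I.Valid) {W : ℕ} (hW : I.n + I.m + 2 * I.total + 2 ≤ W)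
    {input : List ℕ} (hin : Input I ((init input).mem 0)) :
    WP W mainProg (init input) fun s t =>
      (I.Infeasible ∧ s.out = [] ∧ t ≤ 700 * (I.n + I.m + 1)) ∨
      ∃ (K : Core) (D : ℕ → Prop) (rank : ℕ → ℕ) (Q : List (List ℕ)), K.Valid ∧
        Inst.Represents K I D rank ∧ Q.Nodup ∧ (∀ q, q ∈ Q ↔ K.IsSol q) ∧
        (∃ ta ha : ℕ → ℕ, (∀ i < I.m, ta i = I.tl i ∧ ha i = I.hd i) ∧
          s.out = Q.flatMap (Core.enc ta ha)) ∧
        t ≤ 700 * (I.n + I.m + 1) + 4000 * ((I.n + I.total + 1) * Q.length) := by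
  simp only [mainProg]
  rw [wp_seq]
  refine (prepare_spec hI (by omega) hin).mono
    fun s t _ ⟨hk, ho, hpr, ⟨S, hS, ha, hp, hcl, hok, htl, hhd, hen⟩, ht⟩ => ?_
  rw [wp_ite]
  simp only [Expr.eval, Expr.cost, wp_skip]
  refine ⟨fun h => ?_, fun h => .inl ⟨hS.infeasible hI hp hcl fun hc => hok.2 hc h, ho, by omega⟩⟩
  obtain ⟨hb, hd⟩ := hok.1 h
  obtain ⟨hK, hR⟩ := Inst.core_valid hI hS hp hb hd htl hhd hk.mu hpr hen
  have hkle := hS.k_le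
  refine (core_spec hK (ta := s.mem aTail) (ha := s.mem aHead)
    ⟨?_, fun i hi => ?_, fun i hi => ?_⟩ ⟨ha.k, hk.m, hk.M, rfl, rfl, rfl, rfl, ha.st, ha.tz, rfl,
    rfl, rfl⟩ ha.t).mono fun s' t' _ ⟨Q, h₁, h₂, h₃, h₄, h₅⟩ => ?_
  · change S.k + I.m + I.total + 2 ≤ W
    omega
  · have := hI.tl_lt i hi
    rw [hk.tl i hi]
    omega
  · have := hI.hd_lt i hi
    rw [hk.hd i hi]
    omega
  · refine .inr ⟨_, _, _, Q, hK, hR, h₁, h₃, ⟨_, _, fun i hi => ⟨hk.tl i hi, hk.hd i hi⟩,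
      by rw [h₄, ho, List.nil_append]⟩, ?_⟩
    have h₆ : (S.k + I.total + 1) * Q.length ≤ (I.n + I.total + 1) * Q.length :=
      Nat.mul_le_mul_right _ (by omega)
    have h₇ : t' ≤ 4000 * ((S.k + I.total + 1) * Q.length) := h₅
    omega

end RAM

/-! ## Solutions as sequences of edge numbers -/

namespace Inst

variable {I : Inst}

def IsWalk (I : Inst) : ℕ → List ℕ → ℕ → Prop
  | u, [], v => u = v
  | u, i :: q, v => i < I.m ∧ I.tl i = u ∧ I.IsWalk (I.hd i) q v

structure IsSol (I : Inst) (q : List ℕ) : Prop where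
  walk : I.IsWalk I.r q I.r
  count : ∀ i < I.m, q.count i = I.mu i
  prio : ∀ i < I.m, I.fl i ≠ 0 → ∀ q₁ q₂, q = q₁ ++ i :: q₂ → ∀ j ∈ q₁, I.tl j ≠ I.tl i

theorem IsWalk.lt {u v : ℕ} {q : List ℕ} (h : I.IsWalk u q v) : ∀ i ∈ q, i < I.m := by
  induction q generalizing u with
  | nil => simp
  | cons i q ih =>
    obtain ⟨h₁, -, h₂⟩ := h
    simpa using ⟨h₁, ih h₂⟩

theorem IsWalk.countP {u v : ℕ} {q : List ℕ} (h : I.IsWalk u q v) (x : ℕ) :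
    q.countP (I.tl · = x) + (if v = x then 1 else 0) =
      q.countP (I.hd · = x) + if u = x then 1 else 0 := by
  induction q generalizing u with
  | nil => cases h; rfl
  | cons i q ih =>
    obtain ⟨-, h₁, h₂⟩ := h
    have := ih h₂
    simp only [List.countP_cons, h₁, decide_eq_true_eq]
    omega

theorem sum_count {m : ℕ} {q : List ℕ} (hq : ∀ i ∈ q, i < m) (f : ℕ → ℕ) (x : ℕ) :
    ∑ i ∈ Finset.range m with f i = x, q.count i = q.countP (f · = x) := by
  induction q with
  | nil => simp
  | cons i q ih =>
    simp only [List.count_cons, Finset.sum_add_distrib, List.countP_cons, decide_eq_true_eq]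
    rw [ih fun j hj => hq j (by simp [hj])]
    congr 1
    simp only [beq_iff_eq, Finset.sum_ite_eq, Finset.mem_filter, Finset.mem_range]
    simp [hq i (by simp)]

theorem IsSol.outDeg {q : List ℕ} (hq : I.IsSol q) (x : ℕ) : I.outDeg x = q.countP (I.tl · = x) := by
  rw [← sum_count hq.walk.lt]
  exact Finset.sum_congr rfl fun i hi => by
    simp only [Finset.mem_filter, Finset.mem_range] at hi
    exact (hq.count i hi.1).symm

theorem IsSol.inDeg {q : List ℕ} (hq : I.IsSol q) (x : ℕ) : I.inDeg x = q.countP (I.hd · = x) := by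
  rw [← sum_count hq.walk.lt]
  exact Finset.sum_congr rfl fun i hi => by
    simp only [Finset.mem_filter, Finset.mem_range] at hi
    exact (hq.count i hi.1).symm

/-- The last step of a walk that enters the set `D` for good. -/
theorem IsWalk.exists_last {D : ℕ → Prop} {u v : ℕ} {q : List ℕ} (h : I.IsWalk u q v) (hv : D v)
    (hq : ∃ i ∈ q, ¬ D (I.tl i)) : ∃ q₁ i q₂, q = q₁ ++ i :: q₂ ∧ ¬ D (I.tl i) ∧ D (I.hd i) ∧
      ∀ j ∈ q₂, D (I.tl j) := by
  induction q generalizing u with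
  | nil => simp at hq
  | cons i q ih =>
    obtain ⟨-, h₁, h₂⟩ := h
    by_cases hc : ∃ i ∈ q, ¬ D (I.tl i)
    · obtain ⟨q₁, j, q₂, rfl, h₃⟩ := ih h₂ hc
      exact ⟨i :: q₁, j, q₂, rfl, h₃⟩
    · push Not at hc
      refine ⟨[], i, q, rfl, ?_, ?_, hc⟩
      · obtain ⟨j, hj, hd⟩ := hq
        rcases List.mem_cons.1 hj with rfl | hj
        · exact hd
        · exact absurd (hc j hj) hd
      · cases q with
        | nil => cases h₂; exact hv
        | cons j q =>
          obtain ⟨-, h₃, -⟩ := h₂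
          rw [← h₃]
          exact hc j (by simp)

/-- Balance is necessary since the walk is closed. For the second alternative, consider the last
edge `j` of the cycle that enters `D` from outside. It is the last exit of its tail. As it is not
usable and its tail is not the root, it is a priority edge with a rival; being the first exit as
well, it would be the only one. -/
theorem IsSol.not_infeasible (hI : I.Valid) {q : List ℕ} (hq : I.IsSol q) : ¬ I.Infeasible := by
  rintro (⟨v, -, hv⟩ | ⟨D, hr, hD, i, hi, hdi⟩)
  · have := hq.walk.countP v
    rw [hq.outDeg, hq.inDeg] at hv
    omega
  · have hmem : i ∈ q := List.count_pos_iff.1 (by rw [hq.count i hi]; exact hI.mu_pos i hi)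
    obtain ⟨q₁, j, q₂, he, h₁, h₂, h₃⟩ := hq.walk.exists_last hr ⟨i, hmem, hdi⟩
    have hj : j < I.m := hq.walk.lt j (by simp [he])
    refine h₁ (hD j hj ⟨fun h => h₁ (h ▸ hr), ?_⟩ h₂)
    by_contra hc
    have hfl : I.fl j ≠ 0 := by omega
    have h₄ := hq.prio j hj hfl q₁ q₂ he
    have h₅ := hq.outDeg (I.tl j)
    rw [he, List.countP_append, List.countP_cons,
      List.countP_eq_zero.2 (by simpa using h₄), List.countP_eq_zero.2 (fun k hk => by
        simp only [decide_eq_true_eq]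
        intro h
        exact h₁ (h ▸ h₃ k hk))] at h₅
    simp at h₅
    omega

theorem outDeg_ge {i j : ℕ} (hi : i < I.m) (hj : j < I.m) (hij : i ≠ j) (h : I.tl j = I.tl i) :
    I.mu i + I.mu j ≤ I.outDeg (I.tl i) := by
  rw [← Finset.sum_pair (f := I.mu) hij]
  refine Finset.sum_le_sum_of_subset fun k hk => ?_
  simp only [Finset.mem_insert, Finset.mem_singleton] at hk
  rcases hk with rfl | rfl <;> simp [*]

theorem Represents.isWalk_iff {K : Core} {D : ℕ → Prop} {rank : ℕ → ℕ}
    (h : Represents K I D rank) {u v : ℕ} (hu : D u) (hv : D v) (q : List ℕ) :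
    K.IsWalk (rank u) q (rank v) ↔ I.IsWalk u q v := by
  induction q generalizing u with
  | nil => exact ⟨h.inj u v hu hv, congrArg rank⟩
  | cons i q ih =>
    refine Iff.trans (and_congr_right fun hi => ?_) (and_congr_left' (by rw [h.m]))
    rw [h.m] at hi
    rw [h.tl i hi, h.hd i hi, ih (h.dhd i hi)]
    exact and_congr_left' ⟨h.inj _ _ (h.dtl i hi) hu, congrArg rank⟩

/-- The point is that flags without a counterpart in `K` demand nothing. An exit preceding such an
edge would be either a second copy of it, against multiplicity one, or a different edge, which makes
the flag compulsory. -/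
theorem Represents.isSol_iff (hI : I.Valid) {K : Core} {D : ℕ → Prop} {rank : ℕ → ℕ}
    (h : Represents K I D rank) (q : List ℕ) : K.IsSol q ↔ I.IsSol q := by
  have hw := h.isWalk_iff h.dr h.dr q
  rw [h.r] at hw
  have htl : ∀ i < I.m, ∀ j < I.m, K.tl j = K.tl i ↔ I.tl j = I.tl i := fun i hi j hj => by
    rw [h.tl i hi, h.tl j hj]
    exact ⟨h.inj _ _ (h.dtl j hj) (h.dtl i hi), congrArg rank⟩
  constructor
  · intro hq
    have hwq := hw.1 hq.walk
    have hcount : ∀ i < I.m, q.count i = I.mu i := fun i hi => by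
      rw [hq.count i (h.m ▸ hi), h.mu i hi]
    refine ⟨hwq, hcount, fun i hi hfl q₁ q₂ he j hj => ?_⟩
    have hjm : j < I.m := hwq.lt j (by simp [he, hj])
    intro hij
    by_cases hc : I.Compulsory i
    · exact hq.prio i (h.m ▸ hi) ((h.pr i hi).2 hc) q₁ q₂ he j hj ((htl i hi j hjm).2 hij)
    · have hmu := hI.fl_mu i hi hfl
      by_cases hji : i = j
      · subst hji
        have h₁ := hcount i hi
        have h₂ : 0 < q₁.count i := List.count_pos_iff.2 hj
        rw [he, List.count_append, List.count_cons_self] at h₁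
        omega
      · have h₁ := outDeg_ge hi hjm hji hij
        have h₂ := hI.mu_pos j hjm
        exact hc ⟨hfl, .inr (by omega)⟩
  · intro hq
    refine ⟨hw.2 hq.walk, fun i hi => ?_, fun i hi hpr q₁ q₂ he j hj => ?_⟩
    · rw [h.m] at hi
      rw [hq.count i hi, h.mu i hi]
    · rw [h.m] at hi
      have hjm : j < I.m := hq.walk.lt j (by simp [he, hj])
      rw [Ne, htl i hi j hjm]
      exact hq.prio i hi ((h.pr i hi).1 hpr).1 q₁ q₂ he j hj

end Inst

/-! ### Edge numbers and edges -/

namespace ECPInstance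

variable (I : ECPInstance) (L : List (Fin I.n × Fin I.n))

/-- The edge with number `i`. -/
def edge (i : ℕ) : Fin I.n × Fin I.n := L.getD i (I.r, I.r)

/-- The instance with numbers for nodes and edges. -/
def toInst : Inst where
  n := I.n
  r := I.r
  m := L.length
  tl i := (I.edge L i).1
  hd i := (I.edge L i).2
  mu i := I.G.mult (I.edge L i)
  fl i := if I.edge L i ∈ I.F then 1 else 0

variable {I L}

theorem edge_eq {i : ℕ} (hi : i < L.length) : I.edge L i = L[i] := by
  simp [edge, hi]

theorem edge_inj (hL : L.Nodup) {i j : ℕ} (hi : i < L.length) (hj : j < L.length)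
    (h : I.edge L i = I.edge L j) : i = j := by
  rw [edge_eq hi, edge_eq hj] at h
  exact (hL.getElem_inj_iff).1 h

theorem edge_mem (hE : ∀ e, e ∈ L ↔ e ∈ I.G.edges) {i : ℕ} (hi : i < L.length) :
    I.edge L i ∈ I.G.edges := by
  rw [edge_eq hi, ← hE]
  exact List.getElem_mem hi

theorem exists_edge (hE : ∀ e, e ∈ L ↔ e ∈ I.G.edges) {e : Fin I.n × Fin I.n}
    (he : e ∈ I.G.edges) : ∃ i < L.length, I.edge L i = e := by
  obtain ⟨i, hi, h⟩ := List.getElem_of_mem ((hE e).2 he)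
  exact ⟨i, hi, by rw [edge_eq hi, h]⟩

theorem map_edge_range : (List.range L.length).map (I.edge L) = L := by
  refine List.ext_getElem (by simp) fun i h₁ h₂ => ?_
  simp [edge_eq h₂]

theorem total_toInst (hL : L.Nodup) (hE : ∀ e, e ∈ L ↔ e ∈ I.G.edges) :
    (I.toInst L).total = I.G.totalMult := by
  have h₁ : L.toFinset = I.G.edges := by ext e; simp [hE]
  rw [DiMultigraph.totalMult, ← h₁, List.sum_toFinset _ hL]
  conv_rhs => rw [← map_edge_range (I := I) (L := L)]
  rw [List.map_map]
  rfl

theorem length_eq_card (hL : L.Nodup) (hE : ∀ e, e ∈ L ↔ e ∈ I.G.edges) :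
    L.length = I.G.edges.card := by
  rw [← List.toFinset_card_of_nodup hL]
  congr 1
  ext e
  simp [hE]

theorem valid_toInst (hL : L.Nodup) (hE : ∀ e, e ∈ L ↔ e ∈ I.G.edges) : (I.toInst L).Valid where
  r_lt := I.r.2
  tl_lt i _ := (I.edge L i).1.2
  hd_lt i _ := (I.edge L i).2.2
  mu_pos i hi := I.G.mult_pos _ (edge_mem hE hi)
  fl_le i _ := by
    change (if _ then 1 else 0) ≤ 1
    split_ifs <;> omega
  fl_mu i hi h := I.F_mult _ (by by_contra hc; exact h (if_neg hc))
  fl_unique i hi j hj h h' he := edge_inj hL hi hj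
    (I.F_tail _ (by by_contra hc; exact h (if_neg hc)) _ (by by_contra hc; exact h' (if_neg hc))
      (Fin.ext he))

theorem isWalk_iff (hE : ∀ e, e ∈ L ↔ e ∈ I.G.edges) {u v : Fin I.n} {q : List ℕ}
    (hq : ∀ i ∈ q, i < L.length) :
    (I.toInst L).IsWalk u q v ↔ I.G.IsPath u (q.map (I.edge L)) v := by
  induction q generalizing u with
  | nil => exact Fin.ext_iff.symm
  | cons i q ih =>
    have hi : i < L.length := hq i (by simp)
    exact and_congr (iff_of_true hi (edge_mem hE hi)) (and_congr Fin.ext_iff.symm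
      (ih fun j hj => hq j (by simp [hj])))

theorem isECP_iff (hL : L.Nodup) (hE : ∀ e, e ∈ L ↔ e ∈ I.G.edges) {q : List ℕ}
    (hq : ∀ i ∈ q, i < L.length) : I.IsECP (q.map (I.edge L)) ↔ (I.toInst L).IsSol q := by
  have hcount : ∀ i < L.length, (q.map (I.edge L)).count (I.edge L i) = q.count i := fun i hi => by
    rw [List.count, List.count, List.countP_map]
    refine List.countP_congr fun j hj => ?_
    simp only [Function.comp, beq_iff_eq]
    exact ⟨edge_inj hL (hq j hj) hi, congrArg _⟩
  constructor
  · rintro ⟨⟨h₁, h₂⟩, h₃⟩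
    refine ⟨(isWalk_iff hE hq).2 h₁, fun i hi => ?_, fun i hi hfl q₁ q₂ he j hj hij => ?_⟩
    · rw [← hcount i hi]
      exact h₂ _ (edge_mem hE hi)
    · refine h₃ (I.edge L i) (by by_contra hc; exact hfl (if_neg hc)) (q₁.map (I.edge L))
        (q₂.map (I.edge L)) (by simp [he]) (I.edge L j) (List.mem_map_of_mem hj) (Fin.ext hij)
  · intro h
    refine ⟨⟨(isWalk_iff hE hq).1 h.walk, fun e he => ?_⟩, fun f hf p₁ p₂ he e hep => ?_⟩
    · obtain ⟨i, hi, rfl⟩ := exists_edge hE he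
      rw [hcount i hi]
      exact h.count i hi
    · obtain ⟨q₁, q₂', rfl, rfl, h₁⟩ := List.map_eq_append_iff.1 he
      obtain ⟨i, q₂, rfl, rfl, rfl⟩ := List.map_eq_cons_iff.1 h₁
      obtain ⟨j, hj, rfl⟩ := List.mem_map.1 hep
      intro hij
      refine h.prio i (hq i (by simp)) ?_ q₁ q₂ rfl j hj (congrArg Fin.val hij)
      rw [show (I.toInst L).fl i = 1 from if_pos hf]
      exact one_ne_zero

theorem isPath_mem {u v : Fin I.n} {p : List (Fin I.n × Fin I.n)} (h : I.G.IsPath u p v) :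
    ∀ e ∈ p, e ∈ I.G.edges := by
  induction p generalizing u with
  | nil => simp
  | cons e p ih =>
    obtain ⟨h₁, -, h₂⟩ := h
    exact List.forall_mem_cons.2 ⟨h₁, ih h₂⟩

theorem exists_map_edge (hE : ∀ e, e ∈ L ↔ e ∈ I.G.edges) {p : List (Fin I.n × Fin I.n)}
    (hp : ∀ e ∈ p, e ∈ I.G.edges) : ∃ q : List ℕ, (∀ i ∈ q, i < L.length) ∧
      q.map (I.edge L) = p := by
  induction p with
  | nil => exact ⟨[], by simp, rfl⟩
  | cons e p ih =>
    obtain ⟨q, h₁, h₂⟩ := ih fun e he => hp e (by simp [he])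
    obtain ⟨i, hi, h₃⟩ := exists_edge hE (hp e (by simp))
    exact ⟨i :: q, by simpa using ⟨hi, h₁⟩, by rw [List.map_cons, h₂, h₃]⟩

theorem isECP_iff_exists (hL : L.Nodup) (hE : ∀ e, e ∈ L ↔ e ∈ I.G.edges)
    (p : List (Fin I.n × Fin I.n)) :
    I.IsECP p ↔ ∃ q, (I.toInst L).IsSol q ∧ q.map (I.edge L) = p := by
  constructor
  · intro h
    obtain ⟨q, h₁, rfl⟩ := exists_map_edge hE (isPath_mem h.1.1)
    exact ⟨q, (isECP_iff hL hE h₁).1 h, rfl⟩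
  · rintro ⟨q, h, rfl⟩
    exact (isECP_iff hL hE h.walk.lt).2 h

theorem map_edge_inj (hL : L.Nodup) {q q' : List ℕ} (hq : ∀ i ∈ q, i < L.length)
    (hq' : ∀ i ∈ q', i < L.length) (h : q.map (I.edge L) = q'.map (I.edge L)) : q = q' := by
  induction q generalizing q' with
  | nil => simpa using h
  | cons i q ih =>
    cases q' with
    | nil => simp at h
    | cons j q' =>
      simp only [List.map_cons, List.cons.injEq] at h
      rw [edge_inj hL (hq i (by simp)) (hq' j (by simp)) h.1,
        ih (fun k hk => hq k (by simp [hk])) (fun k hk => hq' k (by simp [hk])) h.2]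

theorem getD_flatMap_four {α : Type*} (f : α → List ℕ) (hf : ∀ a, (f a).length = 4) (L : List α)
    {i c : ℕ} (hi : i < L.length) (hc : c < 4) :
    (L.flatMap f).getD (i + i + (i + i) + c) 0 = (f L[i]).getD c 0 := by
  induction L generalizing i with
  | nil => simp at hi
  | cons a L ih =>
    rw [List.flatMap_cons]
    cases i with
    | zero =>
      rw [List.getD_append _ _ _ _ (by rw [hf]; omega)]
      simp
    | succ i =>
      rw [List.getD_append_right _ _ _ _ (by rw [hf]; omega), hf]
      rw [show i + 1 + (i + 1) + (i + 1 + (i + 1)) + c - 4 = i + i + (i + i) + c by omega]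
      exact ih (by simpa using hi)

theorem input_encode : RAM.Input (I.toInst L) ((RAM.init (I.encode L)).mem 0) := by
  have key : ∀ i < L.length, ∀ c < 4, (RAM.init (I.encode L)).mem 0 (i + i + (i + i) + (3 + c)) =
      [((I.edge L i).1 : ℕ), ((I.edge L i).2 : ℕ), I.G.mult (I.edge L i),
        if I.edge L i ∈ I.F then 1 else 0].getD c 0 := fun i hi c hc => by
    rw [edge_eq hi, ← getD_flatMap_four (fun e : Fin I.n × Fin I.n => [(e.1 : ℕ), (e.2 : ℕ),
      I.G.mult e, if e ∈ I.F then 1 else 0]) (fun _ => rfl) L hi hc]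
    simp only [RAM.init, if_true, encode]
    rw [show i + i + (i + i) + (3 + c) = i + i + (i + i) + c + 1 + 1 + 1 by omega]
    rfl
  exact ⟨rfl, rfl, rfl, fun i hi => key i hi 0 (by omega), fun i hi => key i hi 1 (by omega),
    fun i hi => key i hi 2 (by omega), fun i hi => key i hi 3 (by omega)⟩

theorem enc_eq {ta ha : ℕ → ℕ}
    (h : ∀ i < L.length, ta i = (I.toInst L).tl i ∧ ha i = (I.toInst L).hd i) {q : List ℕ}
    (hq : ∀ i ∈ q, i < L.length) : Core.enc ta ha q = encodeEdges (q.map (I.edge L)) := by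
  rw [Core.enc, encodeEdges, List.length_map, List.flatMap_map]
  congr 1
  refine List.flatMap_congr fun i hi => ?_
  rw [(h i (hq i hi)).1, (h i (hq i hi)).2]
  rfl

end ECPInstance

theorem ECPInstance.exec_mainProg {I : ECPInstance} {L : List (Fin I.n × Fin I.n)} (hL : L.Nodup)
    (hE : ∀ e, e ∈ L ↔ e ∈ I.G.edges) {W : ℕ} (hW : (I.n + I.G.totalMult + 2) ^ 2 ≤ W) :
    ∃ (sols : List (List (Fin I.n × Fin I.n))) (s : RAM.State) (t : ℕ),
      sols.Nodup ∧ (∀ p, p ∈ sols ↔ I.IsECP p) ∧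
      RAM.Exec W RAM.mainProg (RAM.init (I.encode L)) s t ∧ s.out = sols.flatMap encodeEdges ∧
      t ≤ 8000 * (I.n + I.G.edges.card) + 8000 * sols.length * (I.n + I.G.totalMult) := by
  have hI := ECPInstance.valid_toInst hL hE
  have hM : (I.toInst L).total = I.G.totalMult := ECPInstance.total_toInst hL hE
  have hm : (I.toInst L).m = I.G.edges.card := ECPInstance.length_eq_card hL hE
  have hmM : I.G.edges.card ≤ I.G.totalMult := by
    rw [Finset.card_eq_sum_ones]
    exact Finset.sum_le_sum I.G.mult_pos
  have hn : 0 < I.n := I.r.pos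
  have hnI : (I.toInst L).n = I.n := rfl
  have hW' : (I.toInst L).n + (I.toInst L).m + 2 * (I.toInst L).total + 2 ≤ W := by
    -- The square suffices because `|E| ≤ M` and `n ≥ 1`.
    refine le_trans ?_ hW
    rw [hM, hm, hnI]
    nlinarith
  obtain ⟨s, t, hexec, hres⟩ := RAM.main_spec hI hW' (ECPInstance.input_encode (I := I) (L := L))
  rw [hm, hM, hnI] at hres
  rcases hres with ⟨hinf, hout, ht⟩ | ⟨K, D, rank, Q, hK, hR, hnd, hmem, ⟨ta, ha, hta, hout⟩, ht⟩
  · refine ⟨[], s, t, List.nodup_nil, fun p => ?_, hexec, by simpa using hout, by simp; omega⟩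
    rw [ECPInstance.isECP_iff_exists hL hE]
    simp only [List.not_mem_nil, false_iff, not_exists, not_and]
    exact fun q hq => absurd hinf (hq.not_infeasible hI)
  · have hsol : ∀ q, q ∈ Q ↔ (I.toInst L).IsSol q := fun q => by rw [hmem, hR.isSol_iff hI]
    have hlt : ∀ q ∈ Q, ∀ i ∈ q, i < L.length := fun q hq => ((hsol q).1 hq).walk.lt
    refine ⟨Q.map (List.map (I.edge L)), s, t, ?_, fun p => ?_, hexec, ?_, ?_⟩
    · exact hnd.map_on fun q hq q' hq' h =>
        ECPInstance.map_edge_inj hL (hlt q hq) (hlt q' hq') h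
    · rw [ECPInstance.isECP_iff_exists hL hE, List.mem_map]
      exact exists_congr fun q => and_congr_left' (hsol q)
    · rw [hout, List.flatMap_map]
      exact List.flatMap_congr fun q hq => ECPInstance.enc_eq (fun i hi => hta i (hi.trans_eq hm)) (hlt q hq)
    · rw [List.length_map]
      -- The summand `1` is absorbed since `n ≥ 1`, at the price of the factor `2` that turns `4000`
      -- into `8000`.
      have h₁ : (I.n + I.G.totalMult + 1) * Q.length ≤ 2 * (Q.length * (I.n + I.G.totalMult)) := by
        rw [Nat.mul_comm _ Q.length, Nat.mul_left_comm]
        exact Nat.mul_le_mul_left _ (by omega)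
      rw [Nat.mul_assoc]
      omega

theorem mainTheorem5 :
    ∃ (P : RAM.Prog) (C : ℕ), ∀ (I : ECPInstance) (L : List (Fin I.n × Fin I.n)),
      L.Nodup → (∀ e, e ∈ L ↔ e ∈ I.G.edges) →
      ∃ (sols : List (List (Fin I.n × Fin I.n))) (s : RAM.State) (t : ℕ),
        sols.Nodup ∧ (∀ p, p ∈ sols ↔ I.IsECP p) ∧
        RAM.Exec ((I.n + I.G.totalMult + 2) ^ C) P (RAM.init (I.encode L)) s t ∧
        s.out = sols.flatMap encodeEdges ∧
        t ≤ C * (I.n + I.G.edges.card) + C * sols.length * (I.n + I.G.totalMult) := by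
  -- The value stays hidden behind an equation, so that the power with this exponent is not
  -- evaluated.
  obtain ⟨C, hC⟩ : ∃ C, C = 8000 := ⟨_, rfl⟩
  refine ⟨RAM.mainProg, C, fun I L hL hE => ?_⟩
  obtain ⟨sols, s, t, h₁, h₂, h₃, h₄, h₅⟩ := ECPInstance.exec_mainProg hL hE
    (Nat.pow_le_pow_right (Nat.succ_pos _) (show 2 ≤ C by omega))
  exact ⟨sols, s, t, h₁, h₂, h₃, h₄, by rwa [hC]⟩
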